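/- **Setting.** Let $E_t$ ($t=1,2,3$) be finite-dimensional real spaces with an arbitrary norm $\|\cdot\|$ and dual norm $\|\cdot\|_*$, and let $F_t$ be Euclidean spaces. Let $X^t\subset E_t$ be compact convex sets, $K^t\subset F_t$ closed convex cones, and $K^t_*$ their dual cones. Consider the three-stage problem $$\min\{f(x^1):=h^1(x^1,c^1)+v^2(x^1):\ x^1\in X^1,\ A^1x^1-b^1\in K^1\},\qquad v^2(x^1)=\mathbb E_{\xi^2}[V^2(x^1,\xi^2)],$$ $$V^2(x^1,\xi^2)=\min\{h^2(x^2,c^2)+v^3(x^2):\ x^2\in X^2,\ A^2x^2-b^2-B^2x^1\in K^2\},\qquad v^3(x^2)=\mathbb E[V^3(x^2,\xi^3)\mid\xi^2],$$ $$V^3(x^2,\xi^3)=\min\{h^3(x^3,c^3):\ x^3\in X^3,\ A^3x^3-b^3-B^3x^2\in K^3\},$$ with random data $\xi^t=(A^t,b^t,B^t,c^t)$, $t=2,3$ (so $v^3$ may depend on $\xi^2$). On $X^t$ a continuously differentiable distance generating function $\omega_t$ is given with $\langle\nabla\omega_t(x_1)-\nabla\omega_t(x),x_1-x\rangle\ge\alpha_t\|x_1-x\|^2$,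 $\alpha_t>0$, and prox-function $P_t(x,x_1)=\omega_t(x_1)-\omega_t(x)-\langle\nabla\omega_t(x),x_1-x\rangle$. The function $h^t(x,c)$ is continuous in $x\in X^t$, measurable in $c$, and strongly convex with modulus $\mu_t>0$: $h^t(x_1,c)-h^t(x_2,c)-\langle (h^t)'(x_2,c),x_1-x_2\rangle\ge\mu_tP_t(x_2,x_1)$ for $x_1,x_2\in X^t$, for some subgradient $(h^t)'(x_2,c)$. **Assumptions.** $v^2$ and $v^3$ are well defined and finite. $A^1\ne0$ and, almost surely, $\|B^2\|\le\mathcal B_2$, $\|B^3\|\le\mathcal B_3$, $0<a\le\|A^2\|\le a'$ and $A^3\ne0$. Strong Lagrange duality holds: there are optimal multipliers $y^1_*$, $y^2_*(x^1,\xi^2)$, $y^3_*(x^2,\xi^3)$, that is, dual parts of saddle points over $X^t\times K^t_*$ of $\langle b^t+B^tu-A^tx,y\rangle+h^t(x,c^t)+v^{t+1}(x)$ (with $u=x^{t-1}$, $v^4=0$, and $B^1u$ absent), for $t=2,3$ almost surely and for all $u\in X^{t-1}$; the multipliers of the stages $2,3$ depend measurably on their arguments and satisfy $\|y^t_*\|\le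 R$. **Algorithm (DSA).** Given initial points $(x_0^t,y_0^t)\in X^t\times K^t_*$, a loop of stage $t$ with data $(A,b,B,c)$ and $u$ starts at $(x_0,y_0)=(x^t_0,y^t_0)$, $y_{-1}=y_0$, and performs for $k=1,\dots,N$ $$\tilde y_k=\theta_k(y_{k-1}-y_{k-2})+y_{k-1},$$ $$x_k=\operatorname*{argmin}_{x\in X^t}\langle b+Bu-Ax,\tilde y_k\rangle+h^t(x,c)+\langle G_{k-1},x\rangle+\tau_kP_t(x_{k-1},x),$$ $$y_k=\operatorname*{argmin}_{y\in K^t_*}\langle -b-Bu+Ax_k,y\rangle+\tfrac{\eta_k}2\|y-y_{k-1}\|^2,$$ with $w_k=k$, $\theta_k=w_{k-1}/w_k$, $\tau_k=\frac{k-1}2\mu_t$; it returns $(\bar x,\bar y)=\sum_{k=1}^N w_k(x_k,y_k)/\sum_{k=1}^N w_k$. * Inner loop ($t=3$, $u=x^2_{j-1}$, data $\xi^3_j$): $G\equiv0$, $\eta_k=\frac{4\|A^3_j\|^2}{k\alpha_3\mu_3}$, $N_3=\frac{2\sqrt6\,\|A_j^3\|\,\|y^3_{*}-y_0^3\|}{\sqrt{\alpha_3\mu_3\epsilon}}$,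 with output $\bar y^3_j$. * Middle loop ($t=2$, $u=x^1_{i-1}$, data $\xi_i^2$): step $j$ draws a new sample $\xi^3_j$ conditionally on $\xi^2_i$ and uses $G_{j-1}=(B^3_j)^T\bar y^3_j$; $\eta_j=\frac{4\|A_i^2\|^2N_2}{j\alpha_2\mu_2}$, $N_2=\frac{24\|A_i^2\|^2\|y_0^2-y^2_*\|^2+72M_3^2}{\alpha_2\mu_2\epsilon}$, with output $\bar y_i^2$. * Outer loop ($t=1$): step $i$ draws a new independent sample $\xi_i^2$ and uses $G_{i-1}=(B^2_i)^T\bar y^2_i$; $\eta_i=\frac{4\|A^1\|^2}{i\alpha_1\mu_1}$ and $$N_1=\max\Big\{\tfrac{4\sqrt3\|A^1\|\|y_0^1\|}{\sqrt{\alpha_1\mu_1\epsilon}}+\tfrac{4(6M_2)^2}{\alpha_1\mu_1\epsilon},\ \tfrac{4\sqrt3\|A^1\|(\sqrt{\|y_*^1-y_0^1\|}+\sqrt2)}{\sqrt{\alpha_1\mu_1\epsilon}}+\Big(\tfrac{24\sqrt6\|A^1\|M_2}{\alpha_1\mu_1\epsilon}\Big)^{2/3}\Big\},$$ with output $\bar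 x^1$. In the inner and middle loops $y^3_*,y^2_*$ are the multipliers at the current $(u,\xi)$, and $N_1,N_2,N_3$ are rounded up to positive integers. **Theorem.** There is a constant $\underline M_3\ge0$ such that for every $M_3\ge\underline M_3$ there is a constant $\underline M_2\ge0$ such that for every $M_2\ge\underline M_2$ there is a constant $C$ (none of them depending on $\epsilon$) with the following properties. The function $v^3$ is, almost surely, $M_3$-Lipschitz on $X^2$, and $v^2$ is $M_2$-Lipschitz on $X^1$. For every $\epsilon>0$ the algorithm satisfies $\mathbb E\|(B^3_j)^T\bar y_j^3\|_*^2\le M_3^2$ and $\mathbb E\|(B_i^2)^T\bar y_i^2\|_*^2\le M_2^2$ in all steps, and it finds $\bar x^1\in X^1$ for which there is a random vector $\delta\in F_1$ with $$\mathbb E[f(\bar x^1)-f(x^*)]\le\epsilon,\qquad A^1\bar x^1-b^1-\delta\in K^1\ \text{a.s.},\qquad \mathbb E\|\delta\|\le\epsilon,$$ where $x^*$ is an optimal solution of the problem. For $\epsilon\le1$ it uses at most $C/\epsilon$ samples of $\xi^2$ and, almost surely, at most $C/\epsilon^2$ samples of $\xi^3$ in total. -/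

import Mathlib

open MeasureTheory ProbabilityTheory
open scoped RealInnerProductSpace ENNReal

noncomputable section

namespace DSA

/-- A realization `ξ = (A, b, B, c)` of the data of one stage. -/
abbrev Scenario (E₀ E F C : Type*) [NormedAddCommGroup E₀] [NormedSpace ℝ E₀]
    [NormedAddCommGroup E] [NormedSpace ℝ E] [NormedAddCommGroup F] [InnerProductSpace ℝ F] :=
  (E →L[ℝ] F) × F × (E₀ →L[ℝ] F) × C

section ScenarioParts

variable {E₀ E F C : Type*} [NormedAddCommGroup E₀] [NormedSpace ℝ E₀]
  [NormedAddCommGroup E] [NormedSpace ℝ E] [NormedAddCommGroup F] [InnerProductSpace ℝ F]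

def Scenario.A (ξ : Scenario E₀ E F C) : E →L[ℝ] F := ξ.1

def Scenario.b (ξ : Scenario E₀ E F C) : F := ξ.2.1

def Scenario.B (ξ : Scenario E₀ E F C) : E₀ →L[ℝ] F := ξ.2.2.1

def Scenario.c (ξ : Scenario E₀ E F C) : C := ξ.2.2.2

/-- The right-hand side `b + B u` of the conic constraint `A x - (b + B u) ∈ K`. -/
def Scenario.rhs (ξ : Scenario E₀ E F C) (u : E₀) : F := ξ.b + ξ.B u

/-- The functional `Bᵀ y`. -/
def Scenario.adj (ξ : Scenario E₀ E F C) (y : F) : E₀ →L[ℝ] ℝ := (innerSL ℝ y).comp ξ.B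

end ScenarioParts

/-- The deterministic data of one stage: feasible set `X`, cone `K`, objective `h (x, c)`,
distance generating function `omega` with its gradient `gradOmega` and modulus `α`,
strong convexity modulus `μ` of the objective, and the initial point `(x₀, y₀)`.
The norm of `E` is arbitrary, functionals on `E` carry its dual norm, and `F` is Euclidean. -/
structure Stage (E F C : Type*) [NormedAddCommGroup E] [NormedSpace ℝ E]
    [NormedAddCommGroup F] [InnerProductSpace ℝ F] where
  X : Set E
  K : ProperCone ℝ F
  h : E → C → ℝ
  omega : E → ℝ
  gradOmega : E → (E →L[ℝ] ℝ)
  α : ℝ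
  μ : ℝ
  x₀ : E
  y₀ : F

open Classical in
/-- A minimizer of `f` over `s` (`0` if there is none). -/
def argmin {V : Type*} [Zero V] (s : Set V) (f : V → ℝ) : V :=
  if H : ∃ x ∈ s, ∀ z ∈ s, f x ≤ f z then H.choose else 0

/-- The weights `w_k = k`. -/
def weight (k : ℕ) : ℝ := k

/-- The extrapolation parameters `θ_k = w_{k-1} / w_k`, for `k ≥ 1`. -/
def theta (k : ℕ) : ℝ := weight (k - 1) / weight k

namespace Stage

variable {E F C : Type*} [NormedAddCommGroup E] [NormedSpace ℝ E]
  [NormedAddCommGroup F] [InnerProductSpace ℝ F]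

/-- The prox-function `P_X(x, x₁)`. -/
def prox (S : Stage E F C) (x x₁ : E) : ℝ :=
  S.omega x₁ - S.omega x - S.gradOmega x (x₁ - x)

/-- The dual cone `K_*`. -/
def dualCone (S : Stage E F C) : Set F :=
  {y | ∀ z ∈ S.K, 0 ≤ ⟪z, y⟫}

/-- The standing assumptions on the deterministic data of one stage. -/
structure IsRegular [MeasurableSpace C] (S : Stage E F C) : Prop where
  isCompact : IsCompact S.X
  convex : Convex ℝ S.X
  α_pos : 0 < S.α
  μ_pos : 0 < S.μ
  hasGrad : ∀ x ∈ S.X, HasFDerivWithinAt S.omega (S.gradOmega x) S.X x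
  grad_continuousOn : ContinuousOn S.gradOmega S.X
  omega_strong : ∀ x ∈ S.X, ∀ x₁ ∈ S.X,
    S.α * ‖x₁ - x‖ ^ 2 ≤ (S.gradOmega x₁ - S.gradOmega x) (x₁ - x)
  h_continuousOn : ∀ c, ContinuousOn (fun x => S.h x c) S.X
  h_measurable : ∀ x ∈ S.X, Measurable (S.h x)
  /-- `h(x₁,c) - h(x₂,c) - ⟨h'(x₂,c), x₁ - x₂⟩ ≥ μ P(x₂,x₁)` for a subgradient `h'(x₂,c)`. -/
  h_strong : ∀ c, ∀ x₂ ∈ S.X, ∃ g : E →L[ℝ] ℝ, ∀ x₁ ∈ S.X,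
    S.μ * S.prox x₂ x₁ ≤ S.h x₁ c - S.h x₂ c - g (x₁ - x₂)
  x₀_mem : S.x₀ ∈ S.X
  y₀_mem : S.y₀ ∈ S.dualCone

/-- The feasible set `{x ∈ X : A x - r ∈ K}`. -/
def feasible (S : Stage E F C) (A : E →L[ℝ] F) (r : F) : Set E :=
  {x | x ∈ S.X ∧ A x - r ∈ S.K}

/-- `min {h(x,c) + v(x) : x ∈ X, A x - r ∈ K}`. -/
def value (S : Stage E F C) (A : E →L[ℝ] F) (r : F) (c : C) (v : E → ℝ) : ℝ :=
  sInf ((fun x => S.h x c + v x) '' S.feasible A r)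

/-- The Lagrangian `⟨r - A x, y⟩ + h(x,c) + v(x)`. -/
def lagrangian (S : Stage E F C) (A : E →L[ℝ] F) (r : F) (c : C) (v : E → ℝ)
    (x : E) (y : F) : ℝ :=
  ⟪r - A x, y⟫ + S.h x c + v x

/-- `y` is the dual part of a saddle point of the Lagrangian on `X × K_*`. -/
def IsMultiplier (S : Stage E F C) (A : E →L[ℝ] F) (r : F) (c : C)
    (v : E → ℝ) (y : F) : Prop :=
  y ∈ S.dualCone ∧ ∃ x ∈ S.X,
    (∀ x' ∈ S.X, S.lagrangian A r c v x y ≤ S.lagrangian A r c v x' y) ∧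
    (∀ y' ∈ S.dualCone, S.lagrangian A r c v x y' ≤ S.lagrangian A r c v x y)

/-- The step sizes `τ_k = (k - 1) μ / 2`. -/
def tau (S : Stage E F C) (k : ℕ) : ℝ := ((k : ℝ) - 1) / 2 * S.μ

/-- The step sizes `η_k = 4 ‖A‖² / (k α μ)`. -/
def etaShort (S : Stage E F C) (A : E →L[ℝ] F) (k : ℕ) : ℝ :=
  4 * ‖A‖ ^ 2 / (k * S.α * S.μ)

/-- The step sizes `η_k = 4 ‖A‖² N / (k α μ)`. -/
def etaLong (S : Stage E F C) (A : E →L[ℝ] F) (N : ℕ) (k : ℕ) : ℝ :=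
  4 * ‖A‖ ^ 2 * N / (k * S.α * S.μ)

/-- The stochastic primal-dual transformation. The state `(p, d, d₋)` holds the current primal
point, the current dual point and the previous dual point; `g` is the approximate subgradient of
the cost-to-go function at `p`. -/
def spdt (S : Stage E F C) (A : E →L[ℝ] F) (r : F) (c : C) (g : E →L[ℝ] ℝ)
    (θ τ η : ℝ) (z : E × F × F) : E × F × F :=
  let dt : F := θ • (z.2.1 - z.2.2) + z.2.1
  let p : E := argmin S.X fun x => ⟪r - A x, dt⟫ + S.h x c + g x + τ * S.prox z.1 x
  let d : F := argmin S.dualCone fun y => ⟪-r + A p, y⟫ + η / 2 * ‖y - z.2.1‖ ^ 2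
  (p, d, z.2.1)

/-- The states `(x_k, y_k, y_{k-1})`, `k = 0, 1, …`, of one loop with weights `k`, step sizes `τ_k`
and `η_k`. Step `k + 1` uses the approximate subgradient `G k x_k`. The value of `y_{-1}` has
no influence, since `θ_1 = 0`. -/
def iterate (S : Stage E F C) (A : E →L[ℝ] F) (r : F) (c : C) (η : ℕ → ℝ)
    (G : ℕ → E → (E →L[ℝ] ℝ)) : ℕ → E × F × F
  | 0 => (S.x₀, S.y₀, S.y₀)
  | k + 1 =>
    let z := iterate S A r c η G k
    S.spdt A r c (G k z.1) (theta (k + 1)) (S.tau (k + 1)) (η (k + 1)) z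

end Stage

/-- The weighted average `(∑ w_k)⁻¹ ∑ w_k z_k` over `k = 1, …, N`. -/
def weightedAverage {V : Type*} [AddCommGroup V] [Module ℝ V] (N : ℕ) (z : ℕ → V) : V :=
  (∑ k ∈ Finset.Icc 1 N, weight k)⁻¹ • ∑ k ∈ Finset.Icc 1 N, weight k • z k

section ThreeStage

variable {E₁ E₂ E₃ F₁ F₂ F₃ C₁ C₂ C₃ : Type*}
  [NormedAddCommGroup E₁] [NormedSpace ℝ E₁]
  [NormedAddCommGroup E₂] [NormedSpace ℝ E₂]
  [NormedAddCommGroup E₃] [NormedSpace ℝ E₃]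
  [NormedAddCommGroup F₁] [InnerProductSpace ℝ F₁]
  [NormedAddCommGroup F₂] [InnerProductSpace ℝ F₂] [MeasurableSpace F₂]
  [NormedAddCommGroup F₃] [InnerProductSpace ℝ F₃] [MeasurableSpace F₃]
  [MeasurableSpace C₂] [MeasurableSpace C₃]

/-- A three-stage problem: the data of the stages, the deterministic `(A¹, b¹, c¹)`, the law `P₂`
of `ξ²`, and the conditional law `κ` of `ξ³` given `ξ²`. -/
structure Problem (E₁ E₂ E₃ F₁ F₂ F₃ C₁ C₂ C₃ : Type*)
    [NormedAddCommGroup E₁] [NormedSpace ℝ E₁]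
    [NormedAddCommGroup E₂] [NormedSpace ℝ E₂]
    [NormedAddCommGroup E₃] [NormedSpace ℝ E₃]
    [NormedAddCommGroup F₁] [InnerProductSpace ℝ F₁]
    [NormedAddCommGroup F₂] [InnerProductSpace ℝ F₂] [MeasurableSpace F₂]
    [NormedAddCommGroup F₃] [InnerProductSpace ℝ F₃] [MeasurableSpace F₃]
    [MeasurableSpace C₂] [MeasurableSpace C₃] where
  S₁ : Stage E₁ F₁ C₁
  S₂ : Stage E₂ F₂ C₂
  S₃ : Stage E₃ F₃ C₃
  A₁ : E₁ →L[ℝ] F₁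
  b₁ : F₁
  c₁ : C₁
  P₂ : Measure (Scenario E₁ E₂ F₂ C₂)
  κ : Kernel (Scenario E₁ E₂ F₂ C₂) (Scenario E₂ E₃ F₃ C₃)

namespace Problem

/-- `V³(x², ξ³)`. -/
def V₃ (D : Problem E₁ E₂ E₃ F₁ F₂ F₃ C₁ C₂ C₃) (u : E₂) (ξ : Scenario E₂ E₃ F₃ C₃) : ℝ :=
  D.S₃.value ξ.A (ξ.rhs u) ξ.c 0

/-- `v³(x²)`, the conditional expectation of `V³(x², ξ³)` given `ξ²`. -/
def v₃ (D : Problem E₁ E₂ E₃ F₁ F₂ F₃ C₁ C₂ C₃) (ξ₂ : Scenario E₁ E₂ F₂ C₂) (u : E₂) : ℝ :=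
  ∫ ξ₃, D.V₃ u ξ₃ ∂(D.κ ξ₂)

/-- `V²(x¹, ξ²)`. -/
def V₂ (D : Problem E₁ E₂ E₃ F₁ F₂ F₃ C₁ C₂ C₃) (u : E₁) (ξ : Scenario E₁ E₂ F₂ C₂) : ℝ :=
  D.S₂.value ξ.A (ξ.rhs u) ξ.c (D.v₃ ξ)

/-- `v²(x¹)`. -/
def v₂ (D : Problem E₁ E₂ E₃ F₁ F₂ F₃ C₁ C₂ C₃) (u : E₁) : ℝ :=
  ∫ ξ₂, D.V₂ u ξ₂ ∂D.P₂

/-- The first-stage objective `h¹(x¹, c¹) + v²(x¹)`. -/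
def obj (D : Problem E₁ E₂ E₃ F₁ F₂ F₃ C₁ C₂ C₃) (x : E₁) : ℝ :=
  D.S₁.h x D.c₁ + D.v₂ x

/-- `x` is an optimal solution of the first-stage problem. -/
def IsSolution (D : Problem E₁ E₂ E₃ F₁ F₂ F₃ C₁ C₂ C₃) (x : E₁) : Prop :=
  x ∈ D.S₁.feasible D.A₁ D.b₁ ∧ ∀ x' ∈ D.S₁.feasible D.A₁ D.b₁, D.obj x ≤ D.obj x'

end Problem

/-- Optimal dual multipliers `y¹_*`, `y²_*(x¹, ξ²)`, `y³_*(x², ξ³)` entering the iteration limits. -/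
structure Multipliers (E₁ E₂ E₃ F₁ F₂ F₃ C₂ C₃ : Type*)
    [NormedAddCommGroup E₁] [NormedSpace ℝ E₁]
    [NormedAddCommGroup E₂] [NormedSpace ℝ E₂]
    [NormedAddCommGroup E₃] [NormedSpace ℝ E₃]
    [NormedAddCommGroup F₂] [InnerProductSpace ℝ F₂]
    [NormedAddCommGroup F₃] [InnerProductSpace ℝ F₃] where
  y₁ : F₁
  y₂ : E₁ → Scenario E₁ E₂ F₂ C₂ → F₂
  y₃ : E₂ → Scenario E₂ E₃ F₃ C₃ → F₃

/-- The multipliers are optimal (so strong Lagrange duality holds at every stage), depend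
measurably on their arguments, and those of the stages 2 and 3 are bounded by `R`. -/
structure Multipliers.IsOptimal [MeasurableSpace E₁] [MeasurableSpace E₂]
    (D : Problem E₁ E₂ E₃ F₁ F₂ F₃ C₁ C₂ C₃) (R : ℝ)
    (m : Multipliers E₁ E₂ E₃ F₁ F₂ F₃ C₂ C₃) : Prop where
  measurable₂ : Measurable (Function.uncurry m.y₂)
  measurable₃ : Measurable (Function.uncurry m.y₃)
  optimal₁ : D.S₁.IsMultiplier D.A₁ D.b₁ D.c₁ D.v₂ m.y₁
  optimal₂ : ∀ᵐ ξ₂ ∂D.P₂, ∀ u ∈ D.S₁.X,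
    D.S₂.IsMultiplier ξ₂.A (ξ₂.rhs u) ξ₂.c (D.v₃ ξ₂) (m.y₂ u ξ₂) ∧ ‖m.y₂ u ξ₂‖ ≤ R
  optimal₃ : ∀ᵐ ξ₂ ∂D.P₂, ∀ᵐ ξ₃ ∂(D.κ ξ₂), ∀ u ∈ D.S₂.X,
    D.S₃.IsMultiplier ξ₃.A (ξ₃.rhs u) ξ₃.c 0 (m.y₃ u ξ₃) ∧ ‖m.y₃ u ξ₃‖ ≤ R

namespace Problem

variable (D : Problem E₁ E₂ E₃ F₁ F₂ F₃ C₁ C₂ C₃) (m : Multipliers E₁ E₂ E₃ F₁ F₂ F₃ C₂ C₃)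

/-! The iteration limits are rounded up to positive integers. -/

/-- The length of the innermost loop for the data `(x², ξ³)`. -/
def N₃ (ε : ℝ) (u : E₂) (ξ : Scenario E₂ E₃ F₃ C₃) : ℕ :=
  max 1 ⌈2 * √6 * ‖ξ.A‖ * ‖m.y₃ u ξ - D.S₃.y₀‖ / √(D.S₃.α * D.S₃.μ * ε)⌉₊

/-- The length of the middle loop for the data `(x¹, ξ²)`. -/
def N₂ (M₃ ε : ℝ) (u : E₁) (ξ : Scenario E₁ E₂ F₂ C₂) : ℕ :=
  max 1 ⌈(24 * ‖ξ.A‖ ^ 2 * ‖D.S₂.y₀ - m.y₂ u ξ‖ ^ 2 + 72 * M₃ ^ 2) / (D.S₂.α * D.S₂.μ * ε)⌉₊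

/-- The length of the outer loop. -/
def N₁ (M₂ ε : ℝ) : ℕ :=
  max 1 ⌈max
    (4 * √3 * ‖D.A₁‖ * ‖D.S₁.y₀‖ / √(D.S₁.α * D.S₁.μ * ε)
      + 4 * (6 * M₂) ^ 2 / (D.S₁.α * D.S₁.μ * ε))
    (4 * √3 * ‖D.A₁‖ * (√‖m.y₁ - D.S₁.y₀‖ + √2) / √(D.S₁.α * D.S₁.μ * ε)
      + (24 * √6 * ‖D.A₁‖ * M₂ / (D.S₁.α * D.S₁.μ * ε)) ^ (2 / 3 : ℝ))⌉₊

/-- The output `ȳ³` of the innermost loop for the data `(x², ξ³)`. -/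
def ybar₃ (ε : ℝ) (u : E₂) (ξ : Scenario E₂ E₃ F₃ C₃) : F₃ :=
  weightedAverage (D.N₃ m ε u ξ) fun k =>
    (D.S₃.iterate ξ.A (ξ.rhs u) ξ.c (D.S₃.etaShort ξ.A) (fun _ _ => 0) k).2.1

/-- The approximate subgradient `(B³)ᵀ ȳ³` of `v³` at `x²`, computed from the sample `ξ³`. -/
def G₃ (ε : ℝ) (u : E₂) (ξ : Scenario E₂ E₃ F₃ C₃) : E₂ →L[ℝ] ℝ :=
  ξ.adj (D.ybar₃ m ε u ξ)

/-- The states of the middle loop for the data `(x¹, ξ²)`; its step `j + 1` uses the sample `s j`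
of `ξ³`. -/
def iter₂ (M₃ ε : ℝ) (u : E₁) (ξ : Scenario E₁ E₂ F₂ C₂) (s : ℕ → Scenario E₂ E₃ F₃ C₃) :
    ℕ → E₂ × F₂ × F₂ :=
  D.S₂.iterate ξ.A (ξ.rhs u) ξ.c (D.S₂.etaLong ξ.A (D.N₂ m M₃ ε u ξ))
    (fun j x => D.G₃ m ε x (s j))

/-- The output `ȳ²` of the middle loop. -/
def ybar₂ (M₃ ε : ℝ) (u : E₁) (ξ : Scenario E₁ E₂ F₂ C₂) (s : ℕ → Scenario E₂ E₃ F₃ C₃) : F₂ :=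
  weightedAverage (D.N₂ m M₃ ε u ξ) fun j => (D.iter₂ m M₃ ε u ξ s j).2.1

/-- The approximate subgradient `(B²)ᵀ ȳ²` of `v²` at `x¹`. -/
def G₂ (M₃ ε : ℝ) (u : E₁) (ξ : Scenario E₁ E₂ F₂ C₂) (s : ℕ → Scenario E₂ E₃ F₃ C₃) :
    E₁ →L[ℝ] ℝ :=
  ξ.adj (D.ybar₂ m M₃ ε u ξ s)

/-- The states of the outer loop; its step `i + 1` uses the sample `ξ₂ i` of `ξ²` and the
samples `ξ₃ i j`, `j = 0, 1, …`, of `ξ³`. -/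
def iter₁ (M₃ ε : ℝ) (ξ₂ : ℕ → Scenario E₁ E₂ F₂ C₂) (ξ₃ : ℕ → ℕ → Scenario E₂ E₃ F₃ C₃) :
    ℕ → E₁ × F₁ × F₁ :=
  D.S₁.iterate D.A₁ D.b₁ D.c₁ (D.S₁.etaShort D.A₁) (fun i x => D.G₂ m M₃ ε x (ξ₂ i) (ξ₃ i))

/-- The output `x̄¹` of the algorithm. -/
def xbar₁ (M₂ M₃ ε : ℝ) (ξ₂ : ℕ → Scenario E₁ E₂ F₂ C₂)
    (ξ₃ : ℕ → ℕ → Scenario E₂ E₃ F₃ C₃) : E₁ :=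
  weightedAverage (D.N₁ m M₂ ε) fun i => (D.iter₁ m M₃ ε ξ₂ ξ₃ i).1

/-- The number of samples of `ξ³` that the algorithm uses in its outer step `i + 1`. -/
def count₃ (M₃ ε : ℝ) (ξ₂ : ℕ → Scenario E₁ E₂ F₂ C₂)
    (ξ₃ : ℕ → ℕ → Scenario E₂ E₃ F₃ C₃) (i : ℕ) : ℕ :=
  D.N₂ m M₃ ε (D.iter₁ m M₃ ε ξ₂ ξ₃ i).1 (ξ₂ i)

/-- Scenario generation: the blocks `(ξ₂ i, (ξ₃ i j)_j)` are independent, `ξ₂ i` has law `P₂`, and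
given `ξ₂ i` the `ξ₃ i j`, `j = 0, 1, …`, are independent with law `κ (ξ₂ i)`. -/
structure IsSampling {Ω : Type*} [MeasurableSpace Ω] (Pr : Measure Ω)
    (ξ₂ : ℕ → Ω → Scenario E₁ E₂ F₂ C₂) (ξ₃ : ℕ → ℕ → Ω → Scenario E₂ E₃ F₃ C₃) : Prop where
  measurable₂ : ∀ i, Measurable (ξ₂ i)
  measurable₃ : ∀ i j, Measurable (ξ₃ i j)
  indep : iIndepFun (fun i ω => (ξ₂ i ω, fun j => ξ₃ i j ω)) Pr
  law : ∀ i n (U : Set (Scenario E₁ E₂ F₂ C₂)), MeasurableSet U →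
    ∀ T : ℕ → Set (Scenario E₂ E₃ F₃ C₃), (∀ j, MeasurableSet (T j)) →
      Pr (ξ₂ i ⁻¹' U ∩ ⋂ j ∈ Finset.range n, ξ₃ i j ⁻¹' T j)
        = ∫⁻ s in U, ∏ j ∈ Finset.range n, D.κ s (T j) ∂D.P₂

end Problem

end ThreeStage

end DSA

end

noncomputable section

set_option linter.unusedSectionVars false

namespace DSA

open Set Filter Topology

/-! All three nested loops run the same primal-dual method, so a single loop is analysed once and
the three are chained by duality.

One loop. Add the three-point inequalities of the primal and dual steps
(`Stage.IsRegular.three_point`, `Stage.dual_step_three_point`) and weight step `k` by `k`. The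
parameters are such that prox terms, dual distances and extrapolation terms telescope. What is left
of the extrapolation is a product of consecutive primal and dual increments, absorbed by the dual
term and by half of the primal prox term as soon as `4 ‖A‖² ≤ α μ Ce`, where `Ce` is the constant
value of `k η_k` (`Stage.IsRegular.iterate_invariant`). The other half pays for using a subgradient
taken at the previous iterate (`Stage.le_noise`). The result, `Stage.IsRegular.sum_gap_le`, bounds
the weighted Lagrangian gap plus the final dual distance by the initial dual distance, a noise term
per step and the accumulated subgradient error. Tested with a multiplier it bounds the dual gap of
the averaged dual output, tested with a saddle point the distance of the dual iterates to the
multiplier, and tested with `y = 0` the objective gap. Constraint violation comes from summing the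
optimality conditions of the dual steps (`Stage.residual_mem_K`).

Chaining. If `y` is a dual point of the recourse problem at `u`, weak duality at `u'` bounds the
error of `Bᵀ y` as a subgradient of the value function by the dual gap of `y` at a solution `x` for
`u'` (`Stage.IsMultiplier.exists_recourse`). This `x` does not depend on the samples, so an expected
gap at each fixed `x` suffices. The inner loop makes an error `ε / 6`, the middle loop adds `ε / 6`,
and the outer loop has `2 ε / 3` left for the objective.

Second moments are derived, not assumed. The inner dual iterates stay in a ball around the
multiplier, so the inner subgradients are bounded. In the middle loop `Ce` is proportional to `N`
while the number of steps times the bias stays bounded, which bounds the expected squared dual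
distance uniformly in `ε` (`Problem.middle_dist_arith`); this is where `‖A²‖ ≥ a` enters. Thus `M₃`
only has to dominate inner quantities, and `M₂` quantities depending on `M₃`.

Probability. An iterate depends on past samples only and is independent of the next one, so oracle
bounds at frozen points pass to the iterates by Fubini (`Stage.IsRegular.oracle_step`). For the
outer loop the samples are blocks, i.i.d. with law `P₂ ⊗ₘ seqKernel κ` (`map_block_eq`).
Measurability of the iterates rests on uniqueness of the minimizers; the degenerate operator `A =
0`, a null event, is removed by the modified step sizes `etaReg`. -/

theorem argmin_spec {V : Type*} [Zero V] {s : Set V} {f : V → ℝ}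
    (H : ∃ x ∈ s, ∀ z ∈ s, f x ≤ f z) :
    argmin s f ∈ s ∧ ∀ z ∈ s, f (argmin s f) ≤ f z := by
  unfold argmin
  rw [dif_pos H]
  exact H.choose_spec

namespace Stage

/-! ### The dual cone and the dual step. -/

section Cone

variable {E F C : Type*} [NormedAddCommGroup E] [NormedSpace ℝ E]
  [NormedAddCommGroup F] [InnerProductSpace ℝ F]

theorem zero_mem_dualCone (S : Stage E F C) : (0 : F) ∈ S.dualCone := fun z _ => by simp

theorem isClosed_dualCone (S : Stage E F C) : IsClosed S.dualCone := by
  have : S.dualCone = ⋂ z ∈ S.K, {y | 0 ≤ ⟪z, y⟫} := by ext; simp [dualCone]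
  rw [this]
  exact isClosed_biInter fun z _ => isClosed_le continuous_const (by fun_prop)

theorem convex_dualCone (S : Stage E F C) : Convex ℝ S.dualCone := by
  intro x hx y hy a b ha hb _ z hz
  rw [inner_add_right, inner_smul_right, inner_smul_right]
  exact add_nonneg (mul_nonneg ha (hx z hz)) (mul_nonneg hb (hy z hz))

theorem add_mem_dualCone {S : Stage E F C} {x y : F} (hx : x ∈ S.dualCone)
    (hy : y ∈ S.dualCone) : x + y ∈ S.dualCone := fun z hz => by
  rw [inner_add_right]; exact add_nonneg (hx z hz) (hy z hz)

/-- The bipolar theorem for the cone `K`. -/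
theorem mem_K_of_forall [CompleteSpace F] {S : Stage E F C} {z : F}
    (h : ∀ y ∈ S.dualCone, 0 ≤ ⟪z, y⟫) : z ∈ S.K := by
  rw [← ProperCone.innerDual_innerDual S.K, ProperCone.mem_innerDual]
  intro y hy
  rw [real_inner_comm]
  exact h y hy

/-- The objective of the dual step. -/
def dualObj (s : F) (η : ℝ) (d : F) (y : F) : ℝ := ⟪s, y⟫ + η / 2 * ‖y - d‖ ^ 2

/-- Completing the square shows that the dual step is the metric projection of `d - η⁻¹ • s` onto
the dual cone; existence of the minimizer and, later, its continuity in the data rest on this. -/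
theorem dualObj_eq {η : ℝ} (hη : 0 < η) (s d y : F) :
    dualObj s η d y = η / 2 * ‖(d - η⁻¹ • s) - y‖ ^ 2
      + (⟪s, d⟫ - η⁻¹ / 2 * ‖s‖ ^ 2) := by
  have h1 : (d - η⁻¹ • s) - y = -((y - d) + η⁻¹ • s) := by module
  rw [dualObj, h1, norm_neg, norm_add_sq_real, inner_smul_right, norm_smul, Real.norm_eq_abs,
    abs_of_pos (inv_pos.2 hη), inner_sub_left, real_inner_comm s y, real_inner_comm s d]
  field_simp
  ring

theorem exists_argmin_dualObj [CompleteSpace F] (S : Stage E F C) {η : ℝ} (hη : 0 < η)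
    (s d : F) : ∃ y ∈ S.dualCone, ∀ z ∈ S.dualCone, dualObj s η d y ≤ dualObj s η d z := by
  obtain ⟨y, hy, hmin⟩ := exists_norm_eq_iInf_of_complete_convex ⟨0, S.zero_mem_dualCone⟩
    S.isClosed_dualCone.isComplete S.convex_dualCone (d - η⁻¹ • s)
  refine ⟨y, hy, fun z hz => ?_⟩
  rw [dualObj_eq hη, dualObj_eq hη, hmin]
  have : ⨅ w : S.dualCone, ‖(d - η⁻¹ • s) - w‖ ≤ ‖(d - η⁻¹ • s) - z‖ :=
    ciInf_le ⟨0, forall_mem_range.2 fun _ => norm_nonneg _⟩ (⟨z, hz⟩ : S.dualCone)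
  have h0 : 0 ≤ ⨅ w : S.dualCone, ‖(d - η⁻¹ • s) - w‖ := hmin ▸ norm_nonneg _
  have := pow_le_pow_left₀ h0 this 2
  have := mul_le_mul_of_nonneg_left this (half_pos hη).le
  linarith

/-- The variational inequality for the dual step. -/
theorem dual_step_variational {S : Stage E F C} {η : ℝ} {s d y : F}
    (hy : y ∈ S.dualCone) (hmin : ∀ z ∈ S.dualCone, dualObj s η d y ≤ dualObj s η d z)
    {z : F} (hz : z ∈ S.dualCone) : 0 ≤ ⟪s + η • (y - d), z - y⟫ := by
  -- The minimizer is compared with a point at parameter `t` on the segment towards `z`; after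
  -- division by `t` the quadratic term vanishes in the limit.
  have key : ∀ t ∈ Ioc (0 : ℝ) 1,
      0 ≤ ⟪s + η • (y - d), z - y⟫ + t * (η / 2 * ‖z - y‖ ^ 2) := by
    intro t ht
    have h1 := hmin _ (S.convex_dualCone.add_smul_sub_mem hy hz ⟨ht.1.le, ht.2⟩)
    have h2 : y + t • (z - y) - d = (y - d) + t • (z - y) := by module
    simp only [dualObj] at h1
    rw [h2, norm_add_sq_real, inner_add_right, inner_smul_right, inner_smul_right, norm_smul,
      Real.norm_eq_abs, mul_pow, sq_abs] at h1
    have h3 : 0 ≤ t * (⟪s + η • (y - d), z - y⟫ + t * (η / 2 * ‖z - y‖ ^ 2)) := by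
      rw [inner_add_left, inner_smul_left, RCLike.conj_to_real]
      linarith
    exact nonneg_of_mul_nonneg_right h3 ht.1
  have hlim : Tendsto (fun t : ℝ => ⟪s + η • (y - d), z - y⟫ + t * (η / 2 * ‖z - y‖ ^ 2))
      (𝓝[>] 0) (𝓝 (⟪s + η • (y - d), z - y⟫ + 0 * (η / 2 * ‖z - y‖ ^ 2))) := by
    apply Tendsto.mono_left _ nhdsWithin_le_nhds
    apply Continuous.tendsto
    fun_prop
  rw [zero_mul, add_zero] at hlim
  exact ge_of_tendsto hlim (by
    filter_upwards [Ioc_mem_nhdsGT (zero_lt_one' ℝ)] with t ht using key t ht)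

/-- The three-point identity turned inequality for the dual step. -/
theorem dual_step_three_point {S : Stage E F C} {η : ℝ} {s d y : F}
    (hy : y ∈ S.dualCone) (hmin : ∀ z ∈ S.dualCone, dualObj s η d y ≤ dualObj s η d z)
    {z : F} (hz : z ∈ S.dualCone) :
    ⟪s, y⟫ - ⟪s, z⟫ + η / 2 * ‖y - d‖ ^ 2 + η / 2 * ‖z - y‖ ^ 2 ≤ η / 2 * ‖z - d‖ ^ 2 := by
  have h := dual_step_variational hy hmin hz
  have h2 : z - d = (y - d) + (z - y) := by module
  rw [h2, norm_add_sq_real]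
  rw [inner_add_left, inner_smul_left, RCLike.conj_to_real, inner_sub_right s] at h
  linarith

/-- The optimality condition of the dual step in conic form. -/
theorem dual_step_mem_K [CompleteSpace F] {S : Stage E F C} {η : ℝ} {s d y : F}
    (hy : y ∈ S.dualCone) (hmin : ∀ z ∈ S.dualCone, dualObj s η d y ≤ dualObj s η d z) :
    s + η • (y - d) ∈ S.K := by
  -- Since the dual cone is closed under addition, `y + z` is admissible in the variational
  -- inequality, which leaves the pairing with `z` alone.
  refine mem_K_of_forall fun z hz => ?_
  simpa using dual_step_variational hy hmin (add_mem_dualCone hy hz)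

theorem argmin_dualObj_spec [CompleteSpace F] (S : Stage E F C) {η : ℝ} (hη : 0 < η)
    (s d : F) : argmin S.dualCone (dualObj s η d) ∈ S.dualCone ∧
      ∀ z ∈ S.dualCone, dualObj s η d (argmin S.dualCone (dualObj s η d)) ≤ dualObj s η d z :=
  argmin_spec (S.exists_argmin_dualObj hη s d)

end Cone

/-! ### The prox-function and the primal step. -/

section Deterministic

variable {E F C : Type*} [NormedAddCommGroup E] [NormedSpace ℝ E]
  [NormedAddCommGroup F] [InnerProductSpace ℝ F] [MeasurableSpace C]

theorem IsRegular.omega_continuousOn {S : Stage E F C} (hS : S.IsRegular) :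
    ContinuousOn S.omega S.X :=
  fun x hx => (hS.hasGrad x hx).continuousWithinAt

/-- The distance generating function along a segment. -/
theorem IsRegular.hasDerivWithinAt_segment {S : Stage E F C} (hS : S.IsRegular) {x x₁ : E}
    (hx : x ∈ S.X) (hx₁ : x₁ ∈ S.X) {t : ℝ} (ht : t ∈ Icc (0 : ℝ) 1) :
    HasDerivWithinAt (fun t : ℝ => S.omega (x + t • (x₁ - x)))
      (S.gradOmega (x + t • (x₁ - x)) (x₁ - x)) (Icc 0 1) t := by
  have hmaps : MapsTo (fun t : ℝ => x + t • (x₁ - x)) (Icc 0 1) S.X := fun s hs =>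
    hS.convex.add_smul_sub_mem hx hx₁ hs
  have hline : HasDerivWithinAt (fun t : ℝ => x + t • (x₁ - x)) (x₁ - x) (Icc 0 1) t := by
    simpa using ((hasDerivAt_id t).smul_const (x₁ - x)).const_add x |>.hasDerivWithinAt
  exact (hS.hasGrad _ (hmaps ht)).comp_hasDerivWithinAt t hline hmaps

theorem IsRegular.prox_lower {S : Stage E F C} (hS : S.IsRegular) {x x₁ : E}
    (hx : x ∈ S.X) (hx₁ : x₁ ∈ S.X) : S.α / 2 * ‖x₁ - x‖ ^ 2 ≤ S.prox x x₁ := by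
  set ψ : ℝ → ℝ := fun t => S.omega (x + t • (x₁ - x)) - t * S.gradOmega x (x₁ - x)
    - S.α * t ^ 2 / 2 * ‖x₁ - x‖ ^ 2 with hψ
  have hder : ∀ t ∈ Icc (0 : ℝ) 1, HasDerivWithinAt ψ
      (S.gradOmega (x + t • (x₁ - x)) (x₁ - x) - S.gradOmega x (x₁ - x)
        - S.α * t * ‖x₁ - x‖ ^ 2) (Icc 0 1) t := by
    intro t ht
    have h1 := hS.hasDerivWithinAt_segment hx hx₁ ht
    have h2 : HasDerivAt (fun t : ℝ => t * S.gradOmega x (x₁ - x))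
        (S.gradOmega x (x₁ - x)) t := by
      simpa using (hasDerivAt_id t).mul_const (S.gradOmega x (x₁ - x))
    have h3 : HasDerivAt (fun t : ℝ => S.α * t ^ 2 / 2 * ‖x₁ - x‖ ^ 2)
        (S.α * t * ‖x₁ - x‖ ^ 2) t := by
      have := (((hasDerivAt_pow 2 t).const_mul S.α).div_const 2).mul_const (‖x₁ - x‖ ^ 2)
      refine HasDerivAt.congr_deriv this ?_
      rw [Nat.cast_ofNat, show 2 - 1 = 1 from rfl, pow_one]
      ring
    exact (h1.sub h2.hasDerivWithinAt).sub h3.hasDerivWithinAt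
  have hmono : MonotoneOn ψ (Icc 0 1) := by
    refine monotoneOn_of_hasDerivWithinAt_nonneg (convex_Icc 0 1)
      (fun t ht => (hder t ht).continuousWithinAt)
      (fun t ht => (hder t (interior_subset ht)).mono interior_subset) ?_
    intro t ht
    rw [interior_Icc] at ht
    have hm := hS.omega_strong x hx _ (hS.convex.add_smul_sub_mem hx hx₁ ⟨ht.1.le, ht.2.le⟩)
    rw [add_sub_cancel_left, map_smul, norm_smul, smul_eq_mul, Real.norm_eq_abs, mul_pow,
      sq_abs, sub_apply] at hm
    have : 0 ≤ t * (S.gradOmega (x + t • (x₁ - x)) (x₁ - x) - S.gradOmega x (x₁ - x)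
        - S.α * t * ‖x₁ - x‖ ^ 2) := by nlinarith
    exact nonneg_of_mul_nonneg_right this ht.1
  have h01 := hmono (left_mem_Icc.2 zero_le_one) (right_mem_Icc.2 zero_le_one) zero_le_one
  simp only [hψ, zero_smul, add_zero, one_smul, add_sub_cancel] at h01
  unfold prox
  nlinarith

theorem IsRegular.prox_nonneg {S : Stage E F C} (hS : S.IsRegular) {x x₁ : E}
    (hx : x ∈ S.X) (hx₁ : x₁ ∈ S.X) : 0 ≤ S.prox x x₁ :=
  le_trans (by have := hS.α_pos; positivity) (hS.prox_lower hx hx₁)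

/-- A function with a supporting functional at each point of a convex set is convex on it. -/
theorem _root_.DSA.convexOn_of_subgradient {X : Set E} (hX : Convex ℝ X) {f : E → ℝ}
    (h : ∀ x ∈ X, ∃ g : E →L[ℝ] ℝ, ∀ y ∈ X, f x + g (y - x) ≤ f y) : ConvexOn ℝ X f := by
  refine ⟨hX, fun x hx y hy a b ha hb hab => ?_⟩
  obtain ⟨g, hg⟩ := h _ (hX hx hy ha hb hab)
  have h1 := hg x hx
  have h2 := hg y hy
  have h3 : a * g (x - (a • x + b • y)) + b * g (y - (a • x + b • y)) = 0 := by
    rw [← smul_eq_mul, ← smul_eq_mul, ← map_smul, ← map_smul, ← map_add]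
    convert map_zero g
    have : a • (x - (a • x + b • y)) + b • (y - (a • x + b • y))
      = (a • x + b • y) - (a + b) • (a • x + b • y) := by module
    rw [this, hab, one_smul, sub_self]
  simp only [smul_eq_mul]
  have h4 := mul_le_mul_of_nonneg_left h1 ha
  have h5 := mul_le_mul_of_nonneg_left h2 hb
  have h6 : a * f (a • x + b • y) + b * f (a • x + b • y) = f (a • x + b • y) := by
    rw [← add_mul, hab, one_mul]
  nlinarith

/-- Strong convexity relative to `omega` provides the supporting functionals `g - μ ∇ω`. This form
lets the modulus of `h` join the prox coefficient, giving `τ + μ` in the three-point inequality. -/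
theorem IsRegular.convexOn_h_sub {S : Stage E F C} (hS : S.IsRegular) (c : C) :
    ConvexOn ℝ S.X (fun x => S.h x c - S.μ * S.omega x) := by
  refine convexOn_of_subgradient hS.convex fun x hx => ?_
  obtain ⟨g, hg⟩ := hS.h_strong c x hx
  refine ⟨g - S.μ • S.gradOmega x, fun y hy => ?_⟩
  have := hg y hy
  simp only [prox, sub_apply, smul_apply,
    smul_eq_mul] at this ⊢
  linarith

theorem IsRegular.convexOn_h {S : Stage E F C} (hS : S.IsRegular) (c : C) :
    ConvexOn ℝ S.X (fun x => S.h x c) := by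
  refine convexOn_of_subgradient hS.convex fun x hx => ?_
  obtain ⟨g, hg⟩ := hS.h_strong c x hx
  refine ⟨g, fun y hy => ?_⟩
  have h1 := hg y hy
  have h2 := mul_nonneg hS.μ_pos.le (hS.prox_nonneg hx hy)
  linarith

/-- The objective of the primal step. -/
def primalObj (S : Stage E F C) (A : E →L[ℝ] F) (r : F) (c : C) (g : E →L[ℝ] ℝ) (τ : ℝ)
    (p : E) (dt : F) (x : E) : ℝ :=
  ⟪r - A x, dt⟫ + S.h x c + g x + τ * S.prox p x

theorem IsRegular.continuousOn_primalObj {S : Stage E F C} (hS : S.IsRegular)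
    (A : E →L[ℝ] F) (r : F) (c : C) (g : E →L[ℝ] ℝ) (τ : ℝ) (p : E) (dt : F) :
    ContinuousOn (S.primalObj A r c g τ p dt) S.X := by
  unfold primalObj prox
  have h1 := hS.h_continuousOn c
  have h2 := hS.omega_continuousOn
  have h3 : Continuous fun x => ⟪r - A x, dt⟫ := by fun_prop
  have h4 : Continuous fun x => S.gradOmega p (x - p) := by fun_prop
  exact ((h3.continuousOn.add h1).add g.continuous.continuousOn).add
    (continuousOn_const.mul ((h2.sub continuousOn_const).sub h4.continuousOn))

theorem IsRegular.argmin_primalObj {S : Stage E F C} (hS : S.IsRegular)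
    (A : E →L[ℝ] F) (r : F) (c : C) (g : E →L[ℝ] ℝ) (τ : ℝ) (p : E) (dt : F) :
    argmin S.X (S.primalObj A r c g τ p dt) ∈ S.X ∧
      ∀ z ∈ S.X, S.primalObj A r c g τ p dt (argmin S.X (S.primalObj A r c g τ p dt))
        ≤ S.primalObj A r c g τ p dt z :=
  argmin_spec (hS.isCompact.exists_isMinOn ⟨_, hS.x₀_mem⟩
    (hS.continuousOn_primalObj A r c g τ p dt))

/-- The three-point inequality for the primal step. -/
theorem IsRegular.three_point {S : Stage E F C} (hS : S.IsRegular)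
    {A : E →L[ℝ] F} {r : F} {c : C} {g : E →L[ℝ] ℝ} {τ : ℝ} {p : E} {dt : F}
    {q : E} (hq : q ∈ S.X)
    (hmin : ∀ z ∈ S.X, S.primalObj A r c g τ p dt q ≤ S.primalObj A r c g τ p dt z)
    {x : E} (hx : x ∈ S.X) :
    S.primalObj A r c g τ p dt q + (τ + S.μ) * S.prox q x
      ≤ S.primalObj A r c g τ p dt x := by
  -- The objective is a convex part `ψ` plus `(τ + μ) ω`. Only `ω` is differentiated; along the
  -- segment `ψ` is replaced by its chord, so no subdifferential calculus is needed.
  set ψ : E → ℝ := fun x => (S.h x c - S.μ * S.omega x) + (⟪r - A x, dt⟫ + g x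
    - τ * S.omega p - τ * S.gradOmega p (x - p)) with hψ
  have hobj : ∀ x, S.primalObj A r c g τ p dt x = ψ x + (τ + S.μ) * S.omega x := by
    intro x
    simp only [primalObj, prox, hψ]
    ring
  have hconv : ∀ t ∈ Icc (0 : ℝ) 1, ψ (q + t • (x - q)) ≤ ψ q + t * (ψ x - ψ q) := by
    intro t ht
    have h1 := (hS.convexOn_h_sub c).2 hq hx (sub_nonneg.2 ht.2) ht.1 (sub_add_cancel 1 t)
    have h2 : (1 - t) • q + t • x = q + t • (x - q) := by module
    rw [h2] at h1
    simp only [smul_eq_mul] at h1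
    simp only [hψ]
    have h3 : ⟪r - A (q + t • (x - q)), dt⟫
        = (1 - t) * ⟪r - A q, dt⟫ + t * ⟪r - A x, dt⟫ := by
      simp only [map_add, map_smul, map_sub, inner_sub_left, inner_add_left, inner_smul_left,
        RCLike.conj_to_real]
      ring
    have h4 : g (q + t • (x - q)) = (1 - t) * g q + t * g x := by
      simp only [map_add, map_smul, map_sub, smul_eq_mul]; ring
    have h5 : S.gradOmega p (q + t • (x - q) - p)
        = (1 - t) * S.gradOmega p (q - p) + t * S.gradOmega p (x - p) := by
      simp only [map_add, map_smul, map_sub, smul_eq_mul]; ring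
    rw [h3, h4, h5]
    linarith
  set φ : ℝ → ℝ := fun t => t * (ψ x - ψ q) + (τ + S.μ) * S.omega (q + t • (x - q)) with hφ
  have hφd : HasDerivWithinAt φ ((ψ x - ψ q) + (τ + S.μ) * S.gradOmega q (x - q))
      (Icc 0 1) 0 := by
    have h1 := hS.hasDerivWithinAt_segment hq hx (left_mem_Icc.2 zero_le_one)
    rw [zero_smul, add_zero] at h1
    have h2 : HasDerivAt (fun t : ℝ => t * (ψ x - ψ q)) (ψ x - ψ q) 0 := by
      simpa using (hasDerivAt_id (0 : ℝ)).mul_const (ψ x - ψ q)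
    exact h2.hasDerivWithinAt.add (h1.const_mul _)
  have hφmin : ∀ t ∈ Icc (0 : ℝ) 1, φ 0 ≤ φ t := by
    intro t ht
    have h1 := hmin _ (hS.convex.add_smul_sub_mem hq hx ht)
    rw [hobj, hobj] at h1
    have h2 := hconv t ht
    simp only [hφ, zero_mul, zero_smul, add_zero, zero_add]
    linarith
  have hnonneg : 0 ≤ (ψ x - ψ q) + (τ + S.μ) * S.gradOmega q (x - q) := by
    have h1 : Tendsto (slope φ 0) (𝓝[>] 0)
        (𝓝 ((ψ x - ψ q) + (τ + S.μ) * S.gradOmega q (x - q))) := by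
      have := (hasDerivWithinAt_iff_tendsto_slope' (s := Ioc (0 : ℝ) 1) (x := (0 : ℝ))
        (by simp)).1 (hφd.mono Ioc_subset_Icc_self)
      rwa [nhdsWithin_Ioc_eq_nhdsGT zero_lt_one] at this
    refine ge_of_tendsto h1 ?_
    filter_upwards [Ioc_mem_nhdsGT (zero_lt_one' ℝ)] with t ht
    rw [slope_def_field]
    exact div_nonneg (sub_nonneg.2 (hφmin t ⟨ht.1.le, ht.2⟩)) (by linarith [ht.1])
  rw [hobj, hobj, prox]
  linarith

end Deterministic

end Stage

namespace Stage

/-! ### Telescoping the steps of one loop. -/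

section Loop

variable {E F C : Type*} [NormedAddCommGroup E] [NormedSpace ℝ E]
  [NormedAddCommGroup F] [InnerProductSpace ℝ F] [MeasurableSpace C]

/-- The linearized primal-dual gap at `(p, d)` with respect to `(x, y)`, where the functional `g`
replaces the cost-to-go function. -/
def linGap (S : Stage E F C) (A : E →L[ℝ] F) (r : F) (c : C) (g : E →L[ℝ] ℝ)
    (p : E) (d : F) (x : E) (y : F) : ℝ :=
  ⟪r - A p, y⟫ - ⟪r - A x, d⟫ + S.h p c - S.h x c + g (p - x)

theorem iterate_succ_eq (S : Stage E F C) (A : E →L[ℝ] F) (r : F) (c : C) (η : ℕ → ℝ)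
    (G : ℕ → E → (E →L[ℝ] ℝ)) (k : ℕ) :
    (S.iterate A r c η G (k + 1)).1 = argmin S.X (S.primalObj A r c
        (G k (S.iterate A r c η G k).1) (S.tau (k + 1)) (S.iterate A r c η G k).1
        (theta (k + 1) • ((S.iterate A r c η G k).2.1 - (S.iterate A r c η G k).2.2)
          + (S.iterate A r c η G k).2.1)) ∧
    (S.iterate A r c η G (k + 1)).2.1 = argmin S.dualCone
      (dualObj (-r + A (S.iterate A r c η G (k + 1)).1) (η (k + 1))
        (S.iterate A r c η G k).2.1) ∧
    (S.iterate A r c η G (k + 1)).2.2 = (S.iterate A r c η G k).2.1 :=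
  ⟨rfl, rfl, rfl⟩

theorem IsRegular.iterate_mem {S : Stage E F C} (hS : S.IsRegular) (A : E →L[ℝ] F) (r : F)
    (c : C) (η : ℕ → ℝ) (G : ℕ → E → (E →L[ℝ] ℝ)) (k : ℕ) :
    (S.iterate A r c η G k).1 ∈ S.X := by
  cases k with
  | zero => exact hS.x₀_mem
  | succ k =>
    rw [(S.iterate_succ_eq A r c η G k).1]
    exact (hS.argmin_primalObj _ _ _ _ _ _ _).1

theorem IsRegular.iterate_dual_mem [CompleteSpace F] {S : Stage E F C} (hS : S.IsRegular)
    (A : E →L[ℝ] F) (r : F) (c : C) {η : ℕ → ℝ} (hη : ∀ k, 0 < η (k + 1))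
    (G : ℕ → E → (E →L[ℝ] ℝ)) (k : ℕ) :
    (S.iterate A r c η G k).2.1 ∈ S.dualCone := by
  cases k with
  | zero => exact hS.y₀_mem
  | succ k =>
    rw [(S.iterate_succ_eq A r c η G k).2.1]
    exact (S.argmin_dualObj_spec (hη k) _ _).1

/-- The basic inequality for one step of a loop. -/
theorem IsRegular.iterate_step [CompleteSpace F] {S : Stage E F C} (hS : S.IsRegular)
    (A : E →L[ℝ] F) (r : F) (c : C) {η : ℕ → ℝ} (hη : ∀ k, 0 < η (k + 1))
    (G : ℕ → E → (E →L[ℝ] ℝ)) (k : ℕ) {x : E} (hx : x ∈ S.X) {y : F} (hy : y ∈ S.dualCone) :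
    S.linGap A r c (G k (S.iterate A r c η G k).1) (S.iterate A r c η G (k + 1)).1
        (S.iterate A r c η G (k + 1)).2.1 x y
      ≤ theta (k + 1) * ⟪A ((S.iterate A r c η G (k + 1)).1 - x),
            (S.iterate A r c η G k).2.1 - (S.iterate A r c η G k).2.2⟫
        - ⟪A ((S.iterate A r c η G (k + 1)).1 - x),
            (S.iterate A r c η G (k + 1)).2.1 - (S.iterate A r c η G k).2.1⟫
        + S.tau (k + 1) * S.prox (S.iterate A r c η G k).1 x
        - (S.tau (k + 1) + S.μ) * S.prox (S.iterate A r c η G (k + 1)).1 x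
        - S.tau (k + 1) * S.prox (S.iterate A r c η G k).1 (S.iterate A r c η G (k + 1)).1
        + η (k + 1) / 2 * ‖y - (S.iterate A r c η G k).2.1‖ ^ 2
        - η (k + 1) / 2 * ‖y - (S.iterate A r c η G (k + 1)).2.1‖ ^ 2
        - η (k + 1) / 2
          * ‖(S.iterate A r c η G (k + 1)).2.1 - (S.iterate A r c η G k).2.1‖ ^ 2 := by
  obtain ⟨e1, e2, -⟩ := S.iterate_succ_eq A r c η G k
  set z := S.iterate A r c η G k
  set p := (S.iterate A r c η G (k + 1)).1
  set d := (S.iterate A r c η G (k + 1)).2.1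
  have hp := hS.argmin_primalObj A r c (G k z.1) (S.tau (k + 1)) z.1
    (theta (k + 1) • (z.2.1 - z.2.2) + z.2.1)
  have hd := S.argmin_dualObj_spec (hη k) (-r + A p) z.2.1
  rw [← e1] at hp
  rw [← e2] at hd
  have h1 := hS.three_point hp.1 hp.2 hx
  have h2 := dual_step_three_point hd.1 hd.2 hy
  simp only [primalObj, linGap, inner_sub_left, inner_add_left, inner_neg_left,
    inner_sub_right, inner_add_right, inner_smul_right, map_sub] at h1 h2 ⊢
  linarith

theorem _root_.DSA.step_pos {η : ℕ → ℝ} {Ce : ℝ} (hCe0 : 0 < Ce)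
    (hη : ∀ k : ℕ, ((k : ℝ) + 1) * η (k + 1) = Ce) (k : ℕ) : 0 < η (k + 1) :=
  pos_of_mul_pos_right ((hη k).symm ▸ hCe0) (by positivity)

theorem _root_.DSA.succ_mul_theta (k : ℕ) : ((k : ℝ) + 1) * theta (k + 1) = k := by
  have : (k : ℝ) + 1 ≠ 0 := by positivity
  simp only [theta, weight, Nat.add_sub_cancel, Nat.cast_add, Nat.cast_one]
  field_simp

theorem tau_succ (S : Stage E F C) (k : ℕ) : S.tau (k + 1) = k / 2 * S.μ := by
  simp [tau]

theorem _root_.DSA.mul_le_of_quadratic {N n κ q Ce b d : ℝ}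
    (hq : 0 < q)
    (hCe : 4 * N ^ 2 ≤ q * Ce) (hκ : n ^ 2 ≤ 8 * κ) (hκ0 : 0 ≤ κ) :
    n * (N * b * d) ≤ κ * q * b ^ 2 + Ce / 2 * d ^ 2 := by
  have h1 : (n * N * b * d) ^ 2 ≤ 4 * (κ * q * b ^ 2) * (Ce / 2 * d ^ 2) := by
    have h2 : (n ^ 2) * (4 * N ^ 2) ≤ (8 * κ) * (q * Ce) :=
      mul_le_mul hκ hCe (by positivity) (by positivity)
    have h3 := mul_le_mul_of_nonneg_right h2 (by positivity : 0 ≤ b ^ 2 * d ^ 2)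
    nlinarith
  have hCe0 : 0 ≤ Ce := by
    by_contra h
    push Not at h
    nlinarith [mul_neg_of_pos_of_neg hq h, sq_nonneg N]
  have h4 : 4 * (κ * q * b ^ 2) * (Ce / 2 * d ^ 2) ≤ (κ * q * b ^ 2 + Ce / 2 * d ^ 2) ^ 2 := by
    nlinarith [sq_nonneg (κ * q * b ^ 2 - Ce / 2 * d ^ 2)]
  have h5 := abs_le_of_sq_le_sq (h1.trans h4) (by positivity)
  have := (le_abs_self _).trans h5
  linarith

/-- The share `κ` is left free because the extrapolation term is estimated twice, with `n (n + 1) /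
8` at each induction step and with `n (n + 1) / 4` at the end. -/
theorem _root_.DSA.neg_inner_le_quadratic {A : E →L[ℝ] F} {n κ q Ce : ℝ} (hn : 0 ≤ n)
    (hq : 0 < q) (hCe : 4 * ‖A‖ ^ 2 ≤ q * Ce) (hκ : n ^ 2 ≤ 8 * κ) (hκ0 : 0 ≤ κ) (u : E) (w : F) :
    |n * ⟪A u, w⟫| ≤ κ * q * ‖u‖ ^ 2 + Ce / 2 * ‖w‖ ^ 2 := by
  refine le_trans ?_ (mul_le_of_quadratic hq hCe hκ hκ0)
  rw [abs_mul, abs_of_nonneg hn]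
  refine mul_le_mul_of_nonneg_left ?_ hn
  exact (abs_real_inner_le_norm _ _).trans
    (mul_le_mul_of_nonneg_right (A.le_opNorm u) (norm_nonneg w))

/-- The invariant of a loop, before the discarding of the cross term. -/
theorem IsRegular.iterate_invariant [CompleteSpace F] {S : Stage E F C} (hS : S.IsRegular)
    {A : E →L[ℝ] F} (r : F) (c : C) {η : ℕ → ℝ} {Ce : ℝ} (hCe0 : 0 < Ce)
    (hCe : 4 * ‖A‖ ^ 2 ≤ S.α * S.μ * Ce) (hη : ∀ k : ℕ, ((k : ℝ) + 1) * η (k + 1) = Ce)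
    (G : ℕ → E → (E →L[ℝ] ℝ)) {x : E} (hx : x ∈ S.X) {y : F} (hy : y ∈ S.dualCone) (n : ℕ) :
    (∑ k ∈ Finset.range n, ((k : ℝ) + 1) *
        S.linGap A r c (G k (S.iterate A r c η G k).1) (S.iterate A r c η G (k + 1)).1
          (S.iterate A r c η G (k + 1)).2.1 x y)
      + n * (n + 1) / 2 * S.μ * S.prox (S.iterate A r c η G n).1 x
      + Ce / 2 * ‖y - (S.iterate A r c η G n).2.1‖ ^ 2
      + n * ⟪A ((S.iterate A r c η G n).1 - x),
          (S.iterate A r c η G n).2.1 - (S.iterate A r c η G n).2.2⟫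
      + Ce / 2 * ‖(S.iterate A r c η G n).2.1 - (S.iterate A r c η G n).2.2‖ ^ 2
      + ∑ k ∈ Finset.range n, (k : ℝ) * (k + 1) / 8 * (S.α * S.μ)
          * ‖(S.iterate A r c η G (k + 1)).1 - (S.iterate A r c η G k).1‖ ^ 2
      ≤ Ce / 2 * ‖y - S.y₀‖ ^ 2 := by
  have hηpos := step_pos hCe0 hη
  induction n with
  | zero =>
    have h0 : S.iterate A r c η G 0 = (S.x₀, S.y₀, S.y₀) := rfl
    simp [h0]
  | succ n ih =>
    have hstep := hS.iterate_step A r c hηpos G n hx hy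
    have hpx := hS.prox_lower (hS.iterate_mem A r c η G n) (hS.iterate_mem A r c η G (n + 1))
    have e3 := (S.iterate_succ_eq A r c η G n).2.2
    rw [Finset.sum_range_succ, Finset.sum_range_succ, e3]
    set z := S.iterate A r c η G n
    set p := (S.iterate A r c η G (n + 1)).1
    set d := (S.iterate A r c η G (n + 1)).2.1
    set L := S.linGap A r c (G n z.1) p d x y
    have hq : 0 < S.α * S.μ := mul_pos hS.α_pos hS.μ_pos
    have hn : (0 : ℝ) ≤ n := Nat.cast_nonneg n
    -- The prox term is worth `n (n + 1) / 4 * (α μ)` times the squared increment. Half of it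
    -- absorbs the cross term here, the other half is kept in the sum to pay for inexact
    -- subgradients.
    have hcross := (abs_le.1 (neg_inner_le_quadratic (κ := n * (n + 1) / 8) hn hq hCe
      (by nlinarith) (by positivity) (p - z.1) (z.2.1 - z.2.2))).2
    have hsplit : ⟪A (p - x), z.2.1 - z.2.2⟫
        = ⟪A (z.1 - x), z.2.1 - z.2.2⟫ + ⟪A (p - z.1), z.2.1 - z.2.2⟫ := by
      rw [← inner_add_left, ← map_add]; congr 2; abel
    have hmul := mul_le_mul_of_nonneg_left hstep (by positivity : (0 : ℝ) ≤ (n : ℝ) + 1)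
    have hpx' := mul_le_mul_of_nonneg_left hpx
      (by have := hS.μ_pos; positivity : 0 ≤ (n : ℝ) * (n + 1) / 2 * S.μ)
    rw [S.tau_succ, hsplit] at hmul
    have ht := succ_mul_theta n
    have hη' := hη n
    push_cast
    generalize ⟪A (z.1 - x), z.2.1 - z.2.2⟫ = i1 at *
    generalize ⟪A (p - z.1), z.2.1 - z.2.2⟫ = i2 at *
    generalize ⟪A (p - x), d - z.2.1⟫ = i3 at *
    -- All weighted coefficients telescope: `(n + 1) τ_{n+1} = n (n + 1) / 2 * μ`, `(n + 1) (τ_{n+1}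
    -- + μ) = (n + 1) (n + 2) / 2 * μ`, `(n + 1) θ_{n+1} = n` and `(n + 1) η_{n+1} = Ce`.
    have hexp : ((n : ℝ) + 1) * (theta (n + 1) * (i1 + i2) - i3
          + (n : ℝ) / 2 * S.μ * S.prox z.1 x - ((n : ℝ) / 2 * S.μ + S.μ) * S.prox p x
          - (n : ℝ) / 2 * S.μ * S.prox z.1 p + η (n + 1) / 2 * ‖y - z.2.1‖ ^ 2
          - η (n + 1) / 2 * ‖y - d‖ ^ 2 - η (n + 1) / 2 * ‖d - z.2.1‖ ^ 2)
        = n * (i1 + i2) - (n + 1) * i3 + n * (n + 1) / 2 * S.μ * S.prox z.1 x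
          - (n + 1) * (n + 1 + 1) / 2 * S.μ * S.prox p x
          - n * (n + 1) / 2 * S.μ * S.prox z.1 p
          + Ce / 2 * ‖y - z.2.1‖ ^ 2 - Ce / 2 * ‖y - d‖ ^ 2 - Ce / 2 * ‖d - z.2.1‖ ^ 2 := by
      rw [← hη']
      linear_combination (i1 + i2) * ht
    rw [hexp] at hmul
    linarith

/-- The summed inequality for a loop. -/
theorem IsRegular.sum_linGap_le [CompleteSpace F] {S : Stage E F C} (hS : S.IsRegular)
    {A : E →L[ℝ] F} (r : F) (c : C) {η : ℕ → ℝ} {Ce : ℝ} (hCe0 : 0 < Ce)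
    (hCe : 4 * ‖A‖ ^ 2 ≤ S.α * S.μ * Ce) (hη : ∀ k : ℕ, ((k : ℝ) + 1) * η (k + 1) = Ce)
    (G : ℕ → E → (E →L[ℝ] ℝ)) {x : E} (hx : x ∈ S.X) {y : F} (hy : y ∈ S.dualCone) (n : ℕ) :
    (∑ k ∈ Finset.range n, ((k : ℝ) + 1) *
        S.linGap A r c (G k (S.iterate A r c η G k).1) (S.iterate A r c η G (k + 1)).1
          (S.iterate A r c η G (k + 1)).2.1 x y)
      + Ce / 2 * ‖y - (S.iterate A r c η G n).2.1‖ ^ 2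
      + ∑ k ∈ Finset.range n, (k : ℝ) * (k + 1) / 8 * (S.α * S.μ)
          * ‖(S.iterate A r c η G (k + 1)).1 - (S.iterate A r c η G k).1‖ ^ 2
      ≤ Ce / 2 * ‖y - S.y₀‖ ^ 2 := by
  have h := hS.iterate_invariant r c hCe0 hCe hη G hx hy n
  have hq : 0 < S.α * S.μ := mul_pos hS.α_pos hS.μ_pos
  have hn : (0 : ℝ) ≤ n := Nat.cast_nonneg n
  -- The cross term at the last iterate is absorbed by the final prox term together with the last
  -- dual increment.
  have hpx := hS.prox_lower (hS.iterate_mem A r c η G n) hx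
  have hpx' := mul_le_mul_of_nonneg_left hpx
    (by have := hS.μ_pos; positivity : 0 ≤ (n : ℝ) * (n + 1) / 2 * S.μ)
  have hcross := (abs_le.1 (neg_inner_le_quadratic (κ := n * (n + 1) / 4) hn hq hCe
      (by nlinarith) (by positivity) ((S.iterate A r c η G n).1 - x)
      ((S.iterate A r c η G n).2.1 - (S.iterate A r c η G n).2.2))).1
  rw [norm_sub_rev (S.iterate A r c η G n).1 x] at hcross
  linarith

end Loop

end Stage

/-! ### Weighted averages and Jensen's inequality. -/

section WeightedAverage

variable {V : Type*} [AddCommGroup V] [Module ℝ V]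

theorem sum_range_succ_cast (n : ℕ) :
    ∑ k ∈ Finset.range n, ((k : ℝ) + 1) = n * (n + 1) / 2 := by
  induction n with
  | zero => simp
  | succ n ih => rw [Finset.sum_range_succ, ih]; push_cast; ring

theorem sum_Icc_one_eq {M : Type*} [AddCommMonoid M] (n : ℕ) (f : ℕ → M) :
    ∑ k ∈ Finset.Icc 1 n, f k = ∑ k ∈ Finset.range n, f (k + 1) := by
  induction n with
  | zero => simp
  | succ n ih => rw [Finset.sum_Icc_succ_top (by omega), Finset.sum_range_succ, ih]

theorem weightedAverage_eq (n : ℕ) (z : ℕ → V) :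
    weightedAverage n z
      = ((n : ℝ) * (n + 1) / 2)⁻¹ • ∑ k ∈ Finset.range n, ((k : ℝ) + 1) • z (k + 1) := by
  rw [weightedAverage, sum_Icc_one_eq, sum_Icc_one_eq, ← sum_range_succ_cast]
  simp [weight]

theorem weightedAverage_smul {n : ℕ} (hn : 0 < n) (z : ℕ → V) :
    ((n : ℝ) * (n + 1) / 2) • weightedAverage n z
      = ∑ k ∈ Finset.range n, ((k : ℝ) + 1) • z (k + 1) := by
  have : (0 : ℝ) < n := Nat.cast_pos.2 hn
  rw [weightedAverage_eq, smul_smul, mul_inv_cancel₀ (by positivity), one_smul]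

theorem weightedAverage_eq_centerMass (n : ℕ) (z : ℕ → V) :
    weightedAverage n z
      = (Finset.range n).centerMass (fun k => (k : ℝ) + 1) (fun k => z (k + 1)) := by
  rw [weightedAverage_eq, Finset.centerMass, sum_range_succ_cast]

theorem sum_range_succ_pos {n : ℕ} (hn : 0 < n) :
    0 < ∑ k ∈ Finset.range n, ((k : ℝ) + 1) := by
  have : (0 : ℝ) < n := Nat.cast_pos.2 hn
  rw [sum_range_succ_cast]; positivity

theorem weightedAverage_mem {X : Set V} (hX : Convex ℝ X) {n : ℕ} (hn : 0 < n) {z : ℕ → V}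
    (hz : ∀ k, z (k + 1) ∈ X) : weightedAverage n z ∈ X := by
  rw [weightedAverage_eq_centerMass]
  exact hX.centerMass_mem (fun k _ => by positivity) (sum_range_succ_pos hn) fun k _ => hz k

theorem mul_convex_weightedAverage_le {X : Set V} {f : V → ℝ} (hf : ConvexOn ℝ X f) {n : ℕ}
    (hn : 0 < n) {z : ℕ → V} (hz : ∀ k, z (k + 1) ∈ X) :
    ((n : ℝ) * (n + 1) / 2) * f (weightedAverage n z)
      ≤ ∑ k ∈ Finset.range n, ((k : ℝ) + 1) * f (z (k + 1)) := by
  have h := hf.map_centerMass_le (t := Finset.range n) (w := fun k => (k : ℝ) + 1)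
    (p := fun k => z (k + 1)) (fun k _ => by positivity) (sum_range_succ_pos hn)
    fun k _ => hz k
  rw [← weightedAverage_eq_centerMass, Finset.centerMass, sum_range_succ_cast,
    smul_eq_mul] at h
  have hn' : (0 : ℝ) < n := Nat.cast_pos.2 hn
  have h2 := mul_le_mul_of_nonneg_left h (by positivity : 0 ≤ (n : ℝ) * (n + 1) / 2)
  rw [mul_inv_cancel_left₀ (by positivity)] at h2
  simpa using h2

end WeightedAverage

namespace Stage

/-! ### Saddle points, multipliers and the value function. -/

section Duality

variable {E F C : Type*} [NormedAddCommGroup E] [NormedSpace ℝ E]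
  [NormedAddCommGroup F] [InnerProductSpace ℝ F]

theorem lagrangian_le_of_feasible {S : Stage E F C} {A : E →L[ℝ] F} {r : F} (c : C) (v : E → ℝ)
    {x : E} (hx : x ∈ S.feasible A r) {y : F} (hy : y ∈ S.dualCone) :
    S.lagrangian A r c v x y ≤ S.h x c + v x := by
  have h := hy _ hx.2
  have : r - A x = -(A x - r) := by abel
  rw [lagrangian, this, inner_neg_left]
  linarith

theorem lagrangian_change (S : Stage E F C) (A : E →L[ℝ] F) (r r' : F) (c : C) (v : E → ℝ)
    (x : E) (y : F) :
    S.lagrangian A r' c v x y = S.lagrangian A r c v x y + ⟪r' - r, y⟫ := by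
  simp only [lagrangian, inner_sub_left]; ring

/-- A multiplier comes with a feasible optimal solution attaining the value of the Lagrangian. -/
theorem IsMultiplier.exists_solution [CompleteSpace F] {S : Stage E F C} {A : E →L[ℝ] F}
    {r : F} {c : C} {v : E → ℝ} {y : F} (h : S.IsMultiplier A r c v y) :
    ∃ x ∈ S.feasible A r, S.h x c + v x = S.value A r c v ∧
      (∀ x' ∈ S.feasible A r, S.h x c + v x ≤ S.h x' c + v x') ∧
      (∀ x' ∈ S.X, S.value A r c v ≤ S.lagrangian A r c v x' y) := by
  obtain ⟨hy, x, hx, h1, h2⟩ := h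
  -- Testing the saddle point with the dual points `0` and `y + z` yields complementarity and, by
  -- the bipolar theorem, feasibility of its primal part.
  have h3 : 0 ≤ ⟪r - A x, y⟫ := by
    have := h2 0 S.zero_mem_dualCone
    simp only [lagrangian, inner_zero_right] at this
    linarith
  have hfeas : x ∈ S.feasible A r := by
    refine ⟨hx, mem_K_of_forall fun z hz => ?_⟩
    have := h2 _ (add_mem_dualCone hy hz)
    simp only [lagrangian, inner_add_right] at this
    have e : A x - r = -(r - A x) := by abel
    rw [e, inner_neg_left]
    linarith
  have h4 : S.lagrangian A r c v x y = S.h x c + v x := by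
    refine le_antisymm (lagrangian_le_of_feasible c v hfeas hy) ?_
    rw [lagrangian]; linarith
  have h5 : ∀ x' ∈ S.feasible A r, S.h x c + v x ≤ S.h x' c + v x' := fun x' hx' =>
    h4 ▸ (h1 x' hx'.1).trans (lagrangian_le_of_feasible c v hx' hy)
  have h6 : S.h x c + v x = S.value A r c v := by
    have hl : IsLeast ((fun x => S.h x c + v x) '' S.feasible A r) (S.h x c + v x) := by
      refine ⟨⟨x, hfeas, rfl⟩, ?_⟩
      rintro _ ⟨x', hx', rfl⟩
      exact h5 x' hx'
    exact hl.csInf_eq.symm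
  exact ⟨x, hfeas, h6, h5, fun x' hx' => by rw [← h6, ← h4]; exact h1 x' hx'⟩

/-- Weak duality after a change of the right-hand side. -/
theorem IsMultiplier.lagrangian_le_value [CompleteSpace F] {S : Stage E F C} {A : E →L[ℝ] F}
    {r' : F} {c : C} {v : E → ℝ} {y' : F} (h' : S.IsMultiplier A r' c v y') :
    ∃ x ∈ S.X, ∀ (r y : F), y ∈ S.dualCone →
      S.lagrangian A r c v x y + ⟪r' - r, y⟫ ≤ S.value A r' c v := by
  obtain ⟨x, hx, h1, -, -⟩ := h'.exists_solution
  refine ⟨x, hx.1, fun r y hy => ?_⟩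
  rw [← lagrangian_change, ← h1]
  exact lagrangian_le_of_feasible c v hx hy

/-- Multipliers are subgradients of the value with respect to the right-hand side. -/
theorem IsMultiplier.value_add_le [CompleteSpace F] {S : Stage E F C} {A : E →L[ℝ] F}
    {r r' : F} {c : C} {v : E → ℝ} {y y' : F} (h : S.IsMultiplier A r c v y)
    (h' : S.IsMultiplier A r' c v y') :
    S.value A r c v + ⟪r' - r, y⟫ ≤ S.value A r' c v := by
  obtain ⟨x, hx, h1⟩ := h'.lagrangian_le_value
  obtain ⟨-, -, -, -, h2⟩ := h.exists_solution
  have := h1 r y h.1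
  have := h2 x hx
  linarith

end Duality

/-! ### Loops with an inexact subgradient of the cost-to-go function. -/

section Loop

variable {E F C : Type*} [NormedAddCommGroup E] [NormedSpace ℝ E]
  [NormedAddCommGroup F] [InnerProductSpace ℝ F] [MeasurableSpace C]

/-- The per-step bound for the error due to an inexact subgradient of norm `γ`. -/
def noise (S : Stage E F C) (L D γ : ℝ) : ℝ :=
  (8 * L ^ 2 + 8 * γ ^ 2) / (S.α * S.μ) + S.α * S.μ * D ^ 2

/-- The error of `g` as a subgradient of `v` at `p`. -/
def _root_.DSA.subgradError (v : E → ℝ) (g : E →L[ℝ] ℝ) (p x : E) : ℝ :=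
  v p - v x - g (p - x)

theorem le_noise {S : Stage E F C} (hS : S.IsRegular) {L D γ a : ℝ} (haD : a ≤ D) (ha : 0 ≤ a)
    (k : ℕ) :
    ((k : ℝ) + 1) * ((L + γ) * a) - k * (k + 1) / 8 * (S.α * S.μ) * a ^ 2
      ≤ S.noise L D γ := by
  have hq : 0 < S.α * S.μ := mul_pos hS.α_pos hS.μ_pos
  unfold noise
  generalize S.α * S.μ = q at *
  have hs : (L + γ) ^ 2 ≤ 2 * L ^ 2 + 2 * γ ^ 2 := by nlinarith [sq_nonneg (L - γ)]
  rw [← sub_nonneg]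
  have hD : a ^ 2 ≤ D ^ 2 := pow_le_pow_left₀ ha haD 2
  have main : ((k : ℝ) + 1) * ((L + γ) * a) - k * (k + 1) / 8 * q * a ^ 2
      ≤ 4 * (L + γ) ^ 2 / q + q * a ^ 2 := by
    rw [div_add' _ _ _ hq.ne', le_div_iff₀ hq]
    -- For `k = 0` the negative quadratic term is absent and only the extra `q * a ^ 2`, later
    -- bounded through the diameter, helps. For `k ≥ 1` one has `(k + 1) / 16 ≤ k / 8`.
    rcases Nat.eq_zero_or_pos k with rfl | hk
    · simp only [Nat.cast_zero]
      nlinarith [sq_nonneg ((L + γ) - q * a / 2), sq_nonneg (q * a), sq_nonneg (L + γ)]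
    · have hk1 : (1 : ℝ) ≤ k := by exact_mod_cast hk
      have h1 : ((k : ℝ) + 1) * ((L + γ) * a) * q
          ≤ 4 * (L + γ) ^ 2 + ((k : ℝ) + 1) ^ 2 / 16 * (q * a) ^ 2 := by
        nlinarith [sq_nonneg (2 * (L + γ) - ((k : ℝ) + 1) / 4 * (q * a))]
      have h2 : ((k : ℝ) + 1) ^ 2 / 16 * (q * a) ^ 2 ≤ k * (k + 1) / 8 * (q * a) ^ 2 := by
        apply mul_le_mul_of_nonneg_right _ (sq_nonneg _)
        nlinarith
      nlinarith [sq_nonneg (q * a)]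
  have h3 : 4 * (L + γ) ^ 2 / q ≤ (8 * L ^ 2 + 8 * γ ^ 2) / q := by
    gcongr; linarith
  have h4 := mul_le_mul_of_nonneg_left hD hq.le
  linarith

/-- The gap of the Lagrangian summed over a loop. -/
theorem IsRegular.sum_gap_le [CompleteSpace F] {S : Stage E F C} (hS : S.IsRegular)
    {A : E →L[ℝ] F} (r : F) (c : C) {η : ℕ → ℝ} {Ce : ℝ} (hCe0 : 0 < Ce)
    (hCe : 4 * ‖A‖ ^ 2 ≤ S.α * S.μ * Ce) (hη : ∀ k : ℕ, ((k : ℝ) + 1) * η (k + 1) = Ce)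
    (G : ℕ → E → (E →L[ℝ] ℝ)) {v : E → ℝ} {L D : ℝ}
    (hv : ∀ x ∈ S.X, ∀ x' ∈ S.X, |v x - v x'| ≤ L * ‖x - x'‖)
    (hD : ∀ x ∈ S.X, ∀ x' ∈ S.X, ‖x - x'‖ ≤ D)
    {x : E} (hx : x ∈ S.X) {y : F} (hy : y ∈ S.dualCone) (n : ℕ) :
    (∑ k ∈ Finset.range n, ((k : ℝ) + 1) *
        (S.lagrangian A r c v (S.iterate A r c η G (k + 1)).1 y
          - S.lagrangian A r c v x (S.iterate A r c η G (k + 1)).2.1))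
      + Ce / 2 * ‖y - (S.iterate A r c η G n).2.1‖ ^ 2
      ≤ Ce / 2 * ‖y - S.y₀‖ ^ 2
        + ∑ k ∈ Finset.range n, (S.noise L D ‖G k (S.iterate A r c η G k).1‖
          + ((k : ℝ) + 1) * subgradError v (G k (S.iterate A r c η G k).1)
              (S.iterate A r c η G k).1 x) := by
  have h := hS.sum_linGap_le r c hCe0 hCe hη G hx hy n
  have hterm : ∀ k ∈ Finset.range n,
      ((k : ℝ) + 1) * (S.lagrangian A r c v (S.iterate A r c η G (k + 1)).1 y
          - S.lagrangian A r c v x (S.iterate A r c η G (k + 1)).2.1)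
      ≤ ((k : ℝ) + 1) *
        S.linGap A r c (G k (S.iterate A r c η G k).1) (S.iterate A r c η G (k + 1)).1
          (S.iterate A r c η G (k + 1)).2.1 x y
        + (k : ℝ) * (k + 1) / 8 * (S.α * S.μ)
          * ‖(S.iterate A r c η G (k + 1)).1 - (S.iterate A r c η G k).1‖ ^ 2
        + (S.noise L D ‖G k (S.iterate A r c η G k).1‖
          + ((k : ℝ) + 1) * subgradError v (G k (S.iterate A r c η G k).1)
              (S.iterate A r c η G k).1 x) := by
    intro k _
    have hp := hS.iterate_mem A r c η G (k + 1)
    have hz := hS.iterate_mem A r c η G k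
    set p := (S.iterate A r c η G (k + 1)).1
    set z := (S.iterate A r c η G k).1
    set g := G k z
    set d := (S.iterate A r c η G (k + 1)).2.1
    have hn := le_noise hS (L := L) (γ := ‖g‖) (hD p hp z hz) (norm_nonneg _) k
    have h1 := (abs_le.1 (hv p hp z hz)).2
    have h2 : -(‖g‖ * ‖p - z‖) ≤ g (p - z) :=
      (abs_le.1 ((Real.norm_eq_abs _).symm.le.trans (g.le_opNorm (p - z)))).1
    have h3 : g (p - x) = g (p - z) + g (z - x) := by rw [← map_add]; congr 1; abel
    -- The functional `g` belongs to `z` while the step ends at `p`. Passing from `z` to `p` costs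
    -- `L ‖p - z‖` for `v` and `‖g‖ ‖p - z‖` for `g`.
    have h4 : S.lagrangian A r c v p y - S.lagrangian A r c v x d
        ≤ S.linGap A r c g p d x y + subgradError v g z x + (L + ‖g‖) * ‖p - z‖ := by
      simp only [lagrangian, linGap, subgradError]
      rw [h3]
      linarith
    have h5 := mul_le_mul_of_nonneg_left h4 (by positivity : (0 : ℝ) ≤ (k : ℝ) + 1)
    linarith
  have hsum := Finset.sum_le_sum hterm
  rw [Finset.sum_add_distrib, Finset.sum_add_distrib] at hsum
  linarith

theorem lagrangian_weightedAverage (S : Stage E F C) (A : E →L[ℝ] F) (r : F) (c : C)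
    (v : E → ℝ) (x : E) {n : ℕ} (hn : 0 < n) (y : ℕ → F) (a : ℝ) :
    ((n : ℝ) * (n + 1) / 2) * (a - S.lagrangian A r c v x (weightedAverage n y))
      = ∑ k ∈ Finset.range n, ((k : ℝ) + 1) * (a - S.lagrangian A r c v x (y (k + 1))) := by
  have h1 := congrArg (fun w => ⟪r - A x, w⟫) (weightedAverage_smul hn y)
  simp only [inner_smul_right, inner_sum] at h1
  have h2 : ∑ k ∈ Finset.range n, ((k : ℝ) + 1) * (a - S.lagrangian A r c v x (y (k + 1)))
      = (∑ k ∈ Finset.range n, ((k : ℝ) + 1)) * (a - S.h x c - v x)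
        - ∑ k ∈ Finset.range n, ((k : ℝ) + 1) * ⟪r - A x, y (k + 1)⟫ := by
    rw [Finset.sum_mul, ← Finset.sum_sub_distrib]
    refine Finset.sum_congr rfl fun k _ => ?_
    rw [lagrangian]; ring
  rw [h2, ← h1, sum_range_succ_cast, lagrangian]
  ring

/-- The error of the averaged dual output of a loop. -/
theorem IsRegular.dual_gap_le [CompleteSpace F] {S : Stage E F C} (hS : S.IsRegular)
    {A : E →L[ℝ] F} {r : F} {c : C} {η : ℕ → ℝ} {Ce : ℝ} (hCe0 : 0 < Ce)
    (hCe : 4 * ‖A‖ ^ 2 ≤ S.α * S.μ * Ce) (hη : ∀ k : ℕ, ((k : ℝ) + 1) * η (k + 1) = Ce)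
    (G : ℕ → E → (E →L[ℝ] ℝ)) {v : E → ℝ} {L D : ℝ}
    (hv : ∀ x ∈ S.X, ∀ x' ∈ S.X, |v x - v x'| ≤ L * ‖x - x'‖)
    (hD : ∀ x ∈ S.X, ∀ x' ∈ S.X, ‖x - x'‖ ≤ D) {ys : F} (hys : S.IsMultiplier A r c v ys)
    {x : E} (hx : x ∈ S.X) {n : ℕ} (hn : 0 < n) :
    ((n : ℝ) * (n + 1) / 2) * (S.value A r c v - S.lagrangian A r c v x
        (weightedAverage n fun k => (S.iterate A r c η G k).2.1))
      ≤ Ce / 2 * ‖ys - S.y₀‖ ^ 2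
        + ∑ k ∈ Finset.range n, (S.noise L D ‖G k (S.iterate A r c η G k).1‖
          + ((k : ℝ) + 1) * subgradError v (G k (S.iterate A r c η G k).1)
              (S.iterate A r c η G k).1 x) := by
  obtain ⟨xs, hxs, -, -, h1⟩ := hys.exists_solution
  have h2 := hS.sum_gap_le r c hCe0 hCe hη G hv hD hx hys.1 n
  rw [S.lagrangian_weightedAverage A r c v x hn]
  have h3 : 0 ≤ Ce / 2 * ‖ys - (S.iterate A r c η G n).2.1‖ ^ 2 := by positivity
  refine le_trans (Finset.sum_le_sum fun k _ => ?_) (le_trans (le_add_of_nonneg_right h3) h2)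
  exact mul_le_mul_of_nonneg_left
    (sub_le_sub_right (h1 _ (hS.iterate_mem A r c η G (k + 1))) _) (by positivity)

/-- The distance of the dual iterates of a loop to a multiplier. -/
theorem IsRegular.dual_dist_le [CompleteSpace F] {S : Stage E F C} (hS : S.IsRegular)
    {A : E →L[ℝ] F} {r : F} {c : C} {η : ℕ → ℝ} {Ce : ℝ} (hCe0 : 0 < Ce)
    (hCe : 4 * ‖A‖ ^ 2 ≤ S.α * S.μ * Ce) (hη : ∀ k : ℕ, ((k : ℝ) + 1) * η (k + 1) = Ce)
    {v : E → ℝ} {L D : ℝ}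
    (hv : ∀ x ∈ S.X, ∀ x' ∈ S.X, |v x - v x'| ≤ L * ‖x - x'‖)
    (hD : ∀ x ∈ S.X, ∀ x' ∈ S.X, ‖x - x'‖ ≤ D) {ys : F} (hys : S.IsMultiplier A r c v ys) :
    ∃ xs ∈ S.X, ∀ (G : ℕ → E → (E →L[ℝ] ℝ)) (n : ℕ),
      Ce / 2 * ‖ys - (S.iterate A r c η G n).2.1‖ ^ 2
      ≤ Ce / 2 * ‖ys - S.y₀‖ ^ 2
        + ∑ k ∈ Finset.range n, (S.noise L D ‖G k (S.iterate A r c η G k).1‖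
          + ((k : ℝ) + 1) * subgradError v (G k (S.iterate A r c η G k).1)
              (S.iterate A r c η G k).1 xs) := by
  obtain ⟨hy, xs, hxs, h1, h2⟩ := hys
  -- The point `xs` is fixed before `G`, hence does not depend on the samples when `G` becomes
  -- random.
  refine ⟨xs, hxs, fun G n => ?_⟩
  have h3 := hS.sum_gap_le r c hCe0 hCe hη G hv hD hxs hy n
  have hηpos := step_pos hCe0 hη
  have h4 : 0 ≤ ∑ k ∈ Finset.range n, ((k : ℝ) + 1) *
        (S.lagrangian A r c v (S.iterate A r c η G (k + 1)).1 ys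
          - S.lagrangian A r c v xs (S.iterate A r c η G (k + 1)).2.1) := by
    refine Finset.sum_nonneg fun k _ => mul_nonneg (by positivity) (sub_nonneg.2 ?_)
    exact (h2 _ (hS.iterate_dual_mem A r c hηpos G (k + 1))).trans
      (h1 _ (hS.iterate_mem A r c η G (k + 1)))
  linarith

/-- The constraint residual of the averaged primal output of a loop. -/
theorem residual_mem_K [CompleteSpace F] (S : Stage E F C)
    (A : E →L[ℝ] F) (r : F) (c : C) {η : ℕ → ℝ} {Ce : ℝ} (hCe0 : 0 < Ce)
    (hη : ∀ k : ℕ, ((k : ℝ) + 1) * η (k + 1) = Ce)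
    (G : ℕ → E → (E →L[ℝ] ℝ)) {n : ℕ} (hn : 0 < n) :
    A (weightedAverage n fun k => (S.iterate A r c η G k).1) - r
      - (Ce / ((n : ℝ) * (n + 1) / 2)) • (S.y₀ - (S.iterate A r c η G n).2.1) ∈ S.K := by
  have hηpos := step_pos hCe0 hη
  have hstep : ∀ k, (-r + A (S.iterate A r c η G (k + 1)).1) + η (k + 1) •
      ((S.iterate A r c η G (k + 1)).2.1 - (S.iterate A r c η G k).2.1) ∈ S.K := by
    intro k
    have h := S.argmin_dualObj_spec (hηpos k) (-r + A (S.iterate A r c η G (k + 1)).1)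
      (S.iterate A r c η G k).2.1
    rw [← (S.iterate_succ_eq A r c η G k).2.1] at h
    exact dual_step_mem_K h.1 h.2
  have hn' : (0 : ℝ) < n := Nat.cast_pos.2 hn
  have hW : 0 < (n : ℝ) * (n + 1) / 2 := by positivity
  -- In the weighted sum of the optimality conditions every dual increment has the same coefficient
  -- `Ce`, so the increments add up to `y_n - y₀`.
  have hsum : ∑ k ∈ Finset.range n, ((k : ℝ) + 1) •
      ((-r + A (S.iterate A r c η G (k + 1)).1) + η (k + 1) •
        ((S.iterate A r c η G (k + 1)).2.1 - (S.iterate A r c η G k).2.1)) ∈ S.K :=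
    Submodule.sum_mem _ fun k _ =>
      S.K.smul_mem (hstep k) (by positivity)
  have hmem := S.K.smul_mem hsum (inv_pos.2 hW).le
  convert hmem using 1
  have e1 : ∀ k ∈ Finset.range n, ((k : ℝ) + 1) •
      ((-r + A (S.iterate A r c η G (k + 1)).1) + η (k + 1) •
        ((S.iterate A r c η G (k + 1)).2.1 - (S.iterate A r c η G k).2.1))
      = ((k : ℝ) + 1) • A (S.iterate A r c η G (k + 1)).1 - ((k : ℝ) + 1) • r
        + Ce • ((S.iterate A r c η G (k + 1)).2.1 - (S.iterate A r c η G k).2.1) := by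
    intro k _
    rw [← hη k]
    module
  rw [Finset.sum_congr rfl e1, Finset.sum_add_distrib, Finset.sum_sub_distrib,
    ← Finset.smul_sum, Finset.sum_range_sub (fun k => (S.iterate A r c η G k).2.1),
    ← Finset.sum_smul, sum_range_succ_cast]
  have e2 : ∑ k ∈ Finset.range n, ((k : ℝ) + 1) • A (S.iterate A r c η G (k + 1)).1
      = ((n : ℝ) * (n + 1) / 2) •
        A (weightedAverage n fun k => (S.iterate A r c η G k).1) := by
    rw [← map_smul, weightedAverage_smul hn, map_sum]
    simp
  rw [e2]
  change _ = ((n : ℝ) * (n + 1) / 2)⁻¹ • (_ - _ + Ce • ((S.iterate A r c η G n).2.1 - S.y₀))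
  rw [div_eq_inv_mul]
  generalize (n : ℝ) * (n + 1) / 2 = W at *
  rw [smul_add, smul_sub W⁻¹, inv_smul_smul₀ hW.ne', inv_smul_smul₀ hW.ne', smul_smul]
  module

end Loop

end Stage

/-! ### Measurability of evaluations and of minimizers. -/

instance secondCountable_clm {E F : Type*} [NormedAddCommGroup E] [NormedSpace ℝ E]
    [FiniteDimensional ℝ E] [NormedAddCommGroup F] [NormedSpace ℝ F] [FiniteDimensional ℝ F] :
    SecondCountableTopology (E →L[ℝ] F) :=
  haveI : ProperSpace (E →L[ℝ] F) := FiniteDimensional.proper_real _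
  inferInstance

theorem measurable_clm_apply {E F Ω : Type*} [NormedAddCommGroup E] [NormedSpace ℝ E]
    [FiniteDimensional ℝ E] [NormedAddCommGroup F] [NormedSpace ℝ F] [FiniteDimensional ℝ F]
    [MeasurableSpace E] [BorelSpace E] [MeasurableSpace F] [BorelSpace F] [MeasurableSpace Ω]
    {A : Ω → E →L[ℝ] F} {x : Ω → E} (hA : Measurable A) (hx : Measurable x) :
    Measurable fun ω => A ω (x ω) := by
  have : ProperSpace E := FiniteDimensional.proper_real _
  have hc : Continuous fun p : (E →L[ℝ] F) × E => p.1 p.2 := isBoundedBilinearMap_apply.continuous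
  exact hc.measurable.comp (hA.prodMk hx)

/-- Continuity is available on `X` only, so the composition is factored through the subtype. -/
theorem measurable_continuousOn_comp {E V Ω : Type*} [TopologicalSpace E] [MeasurableSpace E]
    [BorelSpace E] [TopologicalSpace V] [MeasurableSpace V] [BorelSpace V] [MeasurableSpace Ω]
    {X : Set E} {f : E → V} (hf : ContinuousOn f X) {x : Ω → E} (hx : Measurable x)
    (hxX : ∀ ω, x ω ∈ X) : Measurable fun ω => f (x ω) :=
  (continuousOn_iff_continuous_domRestrict.1 hf).measurable.comp (hx.subtype_mk (h := hxX))

theorem le_of_forall_dense {E : Type*} [TopologicalSpace E] {X t : Set E} {f : E → ℝ} {a : ℝ}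
    (hf : ContinuousOn f X) (ht : t ⊆ X) (hd : X ⊆ closure t) (h : ∀ q ∈ t, a ≤ f q) {x : E}
    (hx : x ∈ X) : a ≤ f x := by
  have : (𝓝[t] x).NeBot := mem_closure_iff_nhdsWithin_neBot.1 (hd hx)
  refine ge_of_tendsto ((hf x hx).mono ht) ?_
  filter_upwards [self_mem_nhdsWithin] with q hq using h q hq

/-- The unique minimizer of a Carathéodory function on a compact set is measurable. -/
theorem measurable_argmin {E Ω : Type*} [NormedAddCommGroup E] [SecondCountableTopology E]
    [MeasurableSpace E] [BorelSpace E] [MeasurableSpace Ω] {X : Set E} (hX : IsCompact X)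
    (hne : X.Nonempty) {f : Ω → E → ℝ} (hc : ∀ ω, ContinuousOn (f ω) X)
    (hm : ∀ x ∈ X, Measurable fun ω => f ω x)
    (huniq : ∀ ω, ∀ x ∈ X, ∀ y ∈ X, (∀ z ∈ X, f ω x ≤ f ω z) → (∀ z ∈ X, f ω y ≤ f ω z) → x = y) :
    Measurable fun ω => argmin X (f ω) := by
  have hspec : ∀ ω, argmin X (f ω) ∈ X ∧ ∀ z ∈ X, f ω (argmin X (f ω)) ≤ f ω z := fun ω =>
    argmin_spec (hX.exists_isMinOn hne (hc ω))
  refine measurable_of_isClosed fun Z hZ => ?_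
  obtain ⟨dX, hdXs, hdXc, hdX⟩ := (TopologicalSpace.IsSeparable.of_separableSpace
    X).exists_countable_dense_subset
  obtain ⟨dZ, hdZs, hdZc, hdZ⟩ := (TopologicalSpace.IsSeparable.of_separableSpace
    (X ∩ Z)).exists_countable_dense_subset
  -- The minimizer lies in `Z` exactly when the infimum over `X ∩ Z` does not exceed the infimum
  -- over `X`; both infima are read off countable dense sets.
  have hset : (fun ω => argmin X (f ω)) ⁻¹' Z
      = ⋂ q ∈ dX, ⋂ n : ℕ, ⋃ p ∈ dZ, {ω | f ω p < f ω q + 1 / ((n : ℝ) + 1)} := by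
    ext ω
    simp only [mem_preimage, mem_iInter, mem_iUnion, mem_ofPred_eq, exists_prop]
    constructor
    · intro ha q hq n
      by_contra! hcon
      have h1 := le_of_forall_dense ((hc ω).mono inter_subset_left) hdZs hdZ hcon
        ⟨(hspec ω).1, ha⟩
      have h2 := (hspec ω).2 q (hdXs hq)
      have h3 : (0 : ℝ) < 1 / ((n : ℝ) + 1) := by positivity
      linarith
    · intro h
      obtain ⟨q₀, hq₀⟩ : dX.Nonempty := by
        obtain ⟨x, hx⟩ := hne
        exact closure_nonempty_iff.1 ⟨x, hdX hx⟩
      obtain ⟨p₀, hp₀, -⟩ := h q₀ hq₀ 0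
      -- By compactness the infimum over `X ∩ Z` is attained, and uniqueness identifies the point
      -- attaining it with the chosen minimizer.
      obtain ⟨p, hp, hpmin⟩ := (hX.inter_right hZ).exists_isMinOn ⟨p₀, hdZs hp₀⟩
        ((hc ω).mono inter_subset_left)
      have h1 : ∀ q ∈ dX, f ω p ≤ f ω q := fun q hq => by
        refine le_of_forall_pos_lt_add fun ε hε => ?_
        obtain ⟨n, hn⟩ := exists_nat_one_div_lt hε
        obtain ⟨p', hp', hlt⟩ := h q hq n
        exact (hpmin (hdZs hp')).trans_lt (hlt.trans (by linarith))
      have h2 : ∀ x ∈ X, f ω p ≤ f ω x := fun x hx =>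
        le_of_forall_dense (hc ω) hdXs hdX h1 hx
      rw [huniq ω _ (hspec ω).1 p hp.1 (hspec ω).2 h2]
      exact hp.2
  rw [hset]
  refine MeasurableSet.biInter hdXc fun q hq => MeasurableSet.iInter fun n =>
    MeasurableSet.biUnion hdZc fun p hp => ?_
  exact measurableSet_lt (hm p (hdZs hp).1) ((hm q (hdXs hq)).add_const _)

namespace Stage

section DualStep

variable {E F C : Type*} [NormedAddCommGroup E] [NormedSpace ℝ E]
  [NormedAddCommGroup F] [InnerProductSpace ℝ F] [CompleteSpace F]

/-- Since `argmin` is a choice, equality needs uniqueness, which the three-point inequality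
supplies. The dual step thereby depends on its data through a single point, and continuously so. -/
theorem argmin_dualObj_eq (S : Stage E F C) {η : ℝ} (hη : 0 < η) (s d : F) :
    argmin S.dualCone (dualObj s η d)
      = argmin S.dualCone (dualObj 0 1 (d - η⁻¹ • s)) := by
  have h1 := S.argmin_dualObj_spec hη s d
  have h2 := S.argmin_dualObj_spec one_pos 0 (d - η⁻¹ • s)
  set y := argmin S.dualCone (dualObj s η d)
  set y' := argmin S.dualCone (dualObj 0 1 (d - η⁻¹ • s))
  have h3 : dualObj s η d y ≤ dualObj s η d y' := h1.2 y' h2.1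
  have h4 := dual_step_three_point h2.1 h2.2 h1.1
  rw [dualObj_eq hη, dualObj_eq hη] at h3
  simp only [inner_zero_left, norm_sub_rev _ (d - η⁻¹ • s)] at h4
  have h5 : ‖d - η⁻¹ • s - y‖ ^ 2 ≤ ‖d - η⁻¹ • s - y'‖ ^ 2 := by
    have : 0 < η / 2 := half_pos hη
    nlinarith
  have h6 : ‖y - y'‖ ^ 2 ≤ 0 := by linarith
  have h7 : ‖y - y'‖ = 0 := by
    have := sq_nonneg ‖y - y'‖
    exact pow_eq_zero_iff two_ne_zero |>.1 (le_antisymm h6 this)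
  exact sub_eq_zero.1 (norm_eq_zero.1 h7)

theorem continuous_argmin_dualObj (S : Stage E F C) :
    Continuous fun p : F => argmin S.dualCone (dualObj 0 1 p) := by
  refine (LipschitzWith.of_dist_le_mul (K := 1) fun p p' => ?_).continuous
  have h1 := S.argmin_dualObj_spec one_pos 0 p
  have h2 := S.argmin_dualObj_spec one_pos 0 p'
  set y := argmin S.dualCone (dualObj 0 1 p)
  set z := argmin S.dualCone (dualObj 0 1 p')
  have h3 := dual_step_variational h1.1 h1.2 h2.1
  have h4 := dual_step_variational h2.1 h2.2 h1.1
  rw [zero_add, one_smul] at h3 h4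
  have h5 : ‖y - z‖ ^ 2 ≤ ⟪p - p', y - z⟫ := by
    rw [← real_inner_self_eq_norm_sq]
    have e1 : z - y = -(y - z) := by abel
    rw [e1, inner_neg_right] at h3
    have e2 : ⟪y - z, y - z⟫ = ⟪y - p, y - z⟫ - ⟪z - p', y - z⟫ + ⟪p - p', y - z⟫ := by
      rw [← inner_sub_left, ← inner_add_left]; congr 1; abel
    linarith
  have h6 := h5.trans (real_inner_le_norm _ _)
  rw [NNReal.coe_one, one_mul, dist_eq_norm, dist_eq_norm]
  by_contra! h
  have h7 := (norm_nonneg (p - p')).trans_lt h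
  nlinarith

end DualStep

section Loop

variable {E F C Ω : Type*} [NormedAddCommGroup E] [NormedSpace ℝ E] [FiniteDimensional ℝ E]
  [MeasurableSpace E] [BorelSpace E]
  [NormedAddCommGroup F] [InnerProductSpace ℝ F] [FiniteDimensional ℝ F]
  [MeasurableSpace F] [BorelSpace F] [MeasurableSpace C]

theorem IsRegular.primalObj_unique {S : Stage E F C} (hS : S.IsRegular)
    {A : E →L[ℝ] F} {r : F} {c : C} {g : E →L[ℝ] ℝ} {τ : ℝ} (hτ : 0 ≤ τ) {p : E} {dt : F}
    {q q' : E} (hq : q ∈ S.X) (hq' : q' ∈ S.X)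
    (hmin : ∀ z ∈ S.X, S.primalObj A r c g τ p dt q ≤ S.primalObj A r c g τ p dt z)
    (hmin' : ∀ z ∈ S.X, S.primalObj A r c g τ p dt q' ≤ S.primalObj A r c g τ p dt z) :
    q = q' := by
  have h1 := hS.three_point hq hmin hq'
  have h2 := hmin' q hq
  have h3 := hS.prox_lower hq hq'
  have h4 : 0 < τ + S.μ := add_pos_of_nonneg_of_pos hτ hS.μ_pos
  have h5 : S.prox q q' ≤ 0 := by
    by_contra! h
    nlinarith [mul_pos h4 h]
  have h6 : ‖q' - q‖ ^ 2 ≤ 0 := by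
    have := hS.α_pos
    by_contra! h
    nlinarith [mul_pos this h]
  have h7 : ‖q' - q‖ = 0 := pow_eq_zero_iff two_ne_zero |>.1 (le_antisymm h6 (sq_nonneg _))
  exact (sub_eq_zero.1 (norm_eq_zero.1 h7)).symm

/-- Step sizes may be random, because the random loop length enters them. The oracle need be
measurable only for `k < n`, so the statement also applies to the σ-algebra generated by the first
`n` samples. -/
theorem IsRegular.measurable_iterate {S : Stage E F C} (hS : S.IsRegular) {mΩ : MeasurableSpace Ω}
    {A : Ω → E →L[ℝ] F} {r : Ω → F} {c : Ω → C} {η : Ω → ℕ → ℝ}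
    {G : Ω → ℕ → E → (E →L[ℝ] ℝ)} (hA : Measurable A) (hr : Measurable r) (hc : Measurable c)
    (hη : ∀ k, Measurable fun ω => η ω (k + 1)) (hη0 : ∀ ω k, 0 < η ω (k + 1)) (n : ℕ)
    (hG : ∀ k < n, Measurable fun p : Ω × E => G p.1 k p.2) :
    Measurable fun ω => S.iterate (A ω) (r ω) (c ω) (η ω) (G ω) n := by
  have : ProperSpace E := FiniteDimensional.proper_real _
  have : ProperSpace F := FiniteDimensional.proper_real _
  have : CompleteSpace F := FiniteDimensional.complete ℝ F
  induction n with
  | zero => exact measurable_const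
  | succ n ih =>
    have ih := ih fun k hk => hG k (hk.trans (Nat.lt_succ_self n))
    set z : Ω → E × F × F := fun ω => S.iterate (A ω) (r ω) (c ω) (η ω) (G ω) n with hz
    have hzX : ∀ ω, (z ω).1 ∈ S.X := fun ω => hS.iterate_mem _ _ _ _ _ _
    have hg : Measurable fun ω => G ω n (z ω).1 :=
      (hG n (Nat.lt_succ_self n)).comp (measurable_id.prodMk ih.fst)
    have hdt : Measurable fun ω => theta (n + 1) • ((z ω).2.1 - (z ω).2.2) + (z ω).2.1 :=
      ((ih.snd.fst.sub ih.snd.snd).const_smul _).add ih.snd.fst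
    have hp : Measurable fun ω => argmin S.X (S.primalObj (A ω) (r ω) (c ω) (G ω n (z ω).1)
        (S.tau (n + 1)) (z ω).1 (theta (n + 1) • ((z ω).2.1 - (z ω).2.2) + (z ω).2.1)) := by
      refine measurable_argmin hS.isCompact ⟨_, hS.x₀_mem⟩
        (fun ω => hS.continuousOn_primalObj _ _ _ _ _ _ _) (fun x hx => ?_)
        (fun ω x hx y hy h1 h2 => hS.primalObj_unique ?_ hx hy h1 h2)
      · unfold primalObj prox
        have m1 : Measurable fun ω => ⟪r ω - A ω x,
            theta (n + 1) • ((z ω).2.1 - (z ω).2.2) + (z ω).2.1⟫ :=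
          (hr.sub (measurable_clm_apply hA measurable_const)).inner hdt
        have m2 : Measurable fun ω => S.h x (c ω) := (hS.h_measurable x hx).comp hc
        have m3 : Measurable fun ω => G ω n (z ω).1 x := measurable_clm_apply hg measurable_const
        have m4 : Measurable fun ω => S.omega (z ω).1 :=
          measurable_continuousOn_comp hS.omega_continuousOn ih.fst hzX
        have m5 : Measurable fun ω => S.gradOmega (z ω).1 :=
          measurable_continuousOn_comp hS.grad_continuousOn ih.fst hzX
        have m6 : Measurable fun ω => S.gradOmega (z ω).1 (x - (z ω).1) :=
          measurable_clm_apply m5 (measurable_const.sub ih.fst)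
        exact ((m1.add m2).add m3).add (((measurable_const.sub m4).sub m6).const_mul _)
      · rw [S.tau_succ]; have := hS.μ_pos; positivity
    have hd : Measurable fun ω => argmin S.dualCone
        (dualObj (-(r ω) + A ω (S.iterate (A ω) (r ω) (c ω) (η ω) (G ω) (n + 1)).1)
          (η ω (n + 1)) (z ω).2.1) := by
      simp_rw [argmin_dualObj_eq S (hη0 _ n)]
      refine S.continuous_argmin_dualObj.measurable.comp ?_
      exact ih.snd.fst.sub ((hη n).inv.smul (hr.neg.add (measurable_clm_apply hA hp)))
    exact hp.prodMk (hd.prodMk ih.snd.fst)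

end Loop

end Stage

/-! ### Moments, and integration against an independent sample. -/

section Probability

variable {Ω Z T V : Type*} [mΩ : MeasurableSpace Ω] [mZ : MeasurableSpace Z]
  [mT : MeasurableSpace T] [NormedAddCommGroup V] {Pr : Measure Ω} {Q : Measure Z}

theorem enorm_sq_eq (v : V) : ‖v‖ₑ ^ 2 = ENNReal.ofReal (‖v‖ ^ 2) := by
  rw [ENNReal.ofReal_pow (norm_nonneg v), ofReal_norm]

theorem integrable_sq_of_lintegral_le {f : Ω → V} (hf : AEStronglyMeasurable f Pr) {c : ℝ}
    (hc : 0 ≤ c) (h : ∫⁻ ω, ‖f ω‖ₑ ^ 2 ∂Pr ≤ ENNReal.ofReal c) :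
    Integrable (fun ω => ‖f ω‖ ^ 2) Pr ∧ ∫ ω, ‖f ω‖ ^ 2 ∂Pr ≤ c := by
  simp_rw [enorm_sq_eq] at h
  have hint : Integrable (fun ω => ‖f ω‖ ^ 2) Pr := by
    refine ⟨hf.norm.pow 2, ?_⟩
    rw [hasFiniteIntegral_iff_ofReal (ae_of_all _ fun ω => by positivity)]
    exact h.trans_lt ENNReal.ofReal_lt_top
  refine ⟨hint, ?_⟩
  rw [← ofReal_integral_eq_lintegral_ofReal hint (ae_of_all _ fun ω => by positivity)] at h
  exact (ENNReal.ofReal_le_ofReal_iff hc).1 h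

theorem integrable_of_sq [IsFiniteMeasure Pr] {f : Ω → V} (hf : AEStronglyMeasurable f Pr)
    (h : Integrable (fun ω => ‖f ω‖ ^ 2) Pr) : Integrable f Pr := by
  refine ((integrable_const (1 : ℝ)).add h).mono' hf (ae_of_all _ fun ω => ?_)
  simp only [Pi.add_apply]
  nlinarith [sq_nonneg (‖f ω‖ - 1), sq_nonneg ‖f ω‖]

theorem integral_norm_le_sqrt [IsProbabilityMeasure Pr] {f : Ω → V}
    (hf : AEStronglyMeasurable f Pr) (h : Integrable (fun ω => ‖f ω‖ ^ 2) Pr) {c : ℝ}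
    (hc : ∫ ω, ‖f ω‖ ^ 2 ∂Pr ≤ c) : ∫ ω, ‖f ω‖ ∂Pr ≤ √c := by
  refine Real.le_sqrt_of_sq_le (le_trans ?_ hc)
  set a := ∫ ω, ‖f ω‖ ∂Pr with ha
  have h1 : Integrable (fun ω => ‖f ω‖) Pr := (integrable_of_sq hf h).norm
  have h2 : ∫ ω, (2 * a * ‖f ω‖ - a ^ 2) ∂Pr ≤ ∫ ω, ‖f ω‖ ^ 2 ∂Pr :=
    integral_mono ((h1.const_mul _).sub (integrable_const _)) h fun ω => by
      have := sq_nonneg (‖f ω‖ - a); simp only; nlinarith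
  rw [integral_sub (h1.const_mul _) (integrable_const _), integral_const_mul,
    integral_const, ← ha] at h2
  simp at h2
  nlinarith

/-- By independence the joint law is a product, so Tonelli freezes `X`; a bound at every point of a
set containing all values of `X` carries over to the random point. -/
theorem lintegral_indep_le {X : Ω → T} {Y : Ω → Z} (hX : Measurable X) (hY : Measurable Y)
    [IsProbabilityMeasure Pr] [SFinite Q]
    (hind : IndepFun X Y Pr) (hlaw : Pr.map Y = Q) {s : Set T} (hs : ∀ ω, X ω ∈ s)
    {Φ : T × Z → ℝ≥0∞} (hΦ : Measurable Φ) {c : ℝ≥0∞} (h : ∀ u ∈ s, ∫⁻ z, Φ (u, z) ∂Q ≤ c) :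
    ∫⁻ ω, Φ (X ω, Y ω) ∂Pr ≤ c := by
  have h1 := (indepFun_iff_map_prod_eq_prod_map_map hX.aemeasurable hY.aemeasurable).1 hind
  rw [← lintegral_map hΦ (hX.prodMk hY), h1, hlaw, lintegral_prod _ hΦ.aemeasurable,
    lintegral_map hΦ.lintegral_prod_right' hX]
  calc ∫⁻ ω, ∫⁻ z, Φ (X ω, z) ∂Q ∂Pr ≤ ∫⁻ _, c ∂Pr := lintegral_mono fun ω => h _ (hs ω)
    _ = c := by simp

theorem ae_indep {X : Ω → T} {Y : Ω → Z} (hX : Measurable X) (hY : Measurable Y)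
    [IsProbabilityMeasure Pr] [SFinite Q]
    (hind : IndepFun X Y Pr) (hlaw : Pr.map Y = Q) {s : Set T} (hs : ∀ ω, X ω ∈ s)
    {p : T × Z → Prop} (hp : MeasurableSet {q | p q}) (h : ∀ u ∈ s, ∀ᵐ z ∂Q, p (u, z)) :
    ∀ᵐ ω ∂Pr, p (X ω, Y ω) := by
  have h1 := lintegral_indep_le hX hY hind hlaw hs (Φ := {q | ¬ p q}.indicator 1)
    (measurable_one.indicator hp.compl) (c := 0) fun u hu => by
      have : (fun z => ({q | ¬ p q} : Set (T × Z)).indicator (1 : T × Z → ℝ≥0∞) (u, z))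
          =ᵐ[Q] 0 := by
        filter_upwards [h u hu] with z hz
        simp [hz]
      rw [lintegral_congr_ae this]; simp
  have hmeas : MeasurableSet {ω | ¬ p (X ω, Y ω)} := (hX.prodMk hY) hp.compl
  rw [ae_iff]
  refine le_antisymm (le_trans (le_of_eq ?_) h1) zero_le
  rw [← lintegral_indicator_one hmeas]
  rfl

theorem integral_indep_eq {X : Ω → T} {Y : Ω → Z} (hX : Measurable X) (hY : Measurable Y)
    [IsProbabilityMeasure Pr] [SFinite Q]
    (hind : IndepFun X Y Pr) (hlaw : Pr.map Y = Q)
    {Φ : T × Z → ℝ} (hΦ : Measurable Φ) (hint : Integrable (fun ω => Φ (X ω, Y ω)) Pr) :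
    Integrable (fun ω => ∫ z, Φ (X ω, z) ∂Q) Pr ∧
    ∫ ω, Φ (X ω, Y ω) ∂Pr = ∫ ω, ∫ z, Φ (X ω, z) ∂Q ∂Pr := by
  have h1 := (indepFun_iff_map_prod_eq_prod_map_map hX.aemeasurable hY.aemeasurable).1 hind
  have h2 : Integrable Φ ((Pr.map X).prod Q) := by
    rw [← hlaw, ← h1]
    exact (integrable_map_measure hΦ.aestronglyMeasurable (hX.prodMk hY).aemeasurable).2 hint
  have : SFinite (Pr.map X) := inferInstance
  have hm : StronglyMeasurable fun u => ∫ z, Φ (u, z) ∂Q :=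
    hΦ.stronglyMeasurable.integral_prod_right'
  constructor
  · have := h2.integral_prod_left
    exact (integrable_map_measure hm.aestronglyMeasurable hX.aemeasurable).1 this
  · rw [← integral_map (hX.prodMk hY).aemeasurable hΦ.aestronglyMeasurable (f := Φ), h1, hlaw,
      integral_prod _ h2, integral_map hX.aemeasurable hm.aestronglyMeasurable]

/-- Applied to iterates: an iterate built from the samples before `n` is independent of sample `n`,
the one used in the next step. -/
theorem indepFun_of_past {s : ℕ → Ω → Z} (hs : ∀ k, Measurable (s k)) (hind : iIndepFun s Pr)
    {n : ℕ} {X : Ω → T}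
    (hX : Measurable[⨆ k ∈ {k | k < n}, mZ.comap (s k)] X) : IndepFun X (s n) Pr := by
  have h := indep_iSup_of_disjoint (m := fun k => mZ.comap (s k)) (fun k => (hs k).comap_le)
    hind (S := {k | k < n}) (T := {n}) (by simp)
  rw [IndepFun_iff_Indep]
  refine indep_of_indep_of_le_left (indep_of_indep_of_le_right h ?_) hX.comap_le
  simp

end Probability

theorem continuousOn_of_norm_le {E : Type*} [NormedAddCommGroup E] {X : Set E} {v : E → ℝ}
    {L : ℝ} (hv : ∀ x ∈ X, ∀ x' ∈ X, |v x - v x'| ≤ L * ‖x - x'‖) : ContinuousOn v X := by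
  have hL : LipschitzOnWith (Real.toNNReal L) v X := by
    refine LipschitzOnWith.of_dist_le_mul fun a ha b hb => ?_
    rw [Real.dist_eq, dist_eq_norm]
    exact (hv a ha b hb).trans
      (mul_le_mul_of_nonneg_right (Real.le_coe_toNNReal L) (norm_nonneg _))
  exact hL.continuousOn

/-! ### Loops driven by a stochastic oracle. -/

section StochasticLoop

variable {E F C Ω Z : Type*} [NormedAddCommGroup E] [NormedSpace ℝ E] [FiniteDimensional ℝ E]
  [MeasurableSpace E] [BorelSpace E]
  [NormedAddCommGroup F] [InnerProductSpace ℝ F] [FiniteDimensional ℝ F]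
  [MeasurableSpace F] [BorelSpace F] [MeasurableSpace C]
  [mΩ : MeasurableSpace Ω] [mZ : MeasurableSpace Z] {Pr : Measure Ω} [IsProbabilityMeasure Pr]
  {Q : Measure Z} [IsProbabilityMeasure Q]

/-- `G` is a stochastic oracle for subgradients of `v` on the feasible set of the stage, with
bias at most `e` and second moment at most `Γ ^ 2`. -/
structure IsOracle (S : Stage E F C) (Q : Measure Z) (v : E → ℝ) (G : E → Z → (E →L[ℝ] ℝ))
    (Γ e : ℝ) : Prop where
  measurable : Measurable fun p : E × Z => G p.1 p.2
  moment : ∀ u ∈ S.X, ∫⁻ z, ‖G u z‖ₑ ^ 2 ∂Q ≤ ENNReal.ofReal (Γ ^ 2)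
  bias : ∀ u ∈ S.X, ∀ x ∈ S.X, v u - v x - ∫ z, G u z (u - x) ∂Q ≤ e

/-- An independent sample sequence of law `Q`. -/
structure IsIID (s : ℕ → Ω → Z) (Pr : Measure Ω) (Q : Measure Z) : Prop where
  measurable : ∀ k, Measurable (s k)
  indep : iIndepFun s Pr
  law : ∀ k, Pr.map (s k) = Q

namespace Stage

theorem IsRegular.measurable_past_iterate {S : Stage E F C} (hS : S.IsRegular)
    (A : E →L[ℝ] F) (r : F) (c : C) {η : ℕ → ℝ} (hη : ∀ k, 0 < η (k + 1)) {s : ℕ → Ω → Z}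
    {G : E → Z → (E →L[ℝ] ℝ)} (hG : Measurable fun p : E × Z => G p.1 p.2) (n : ℕ) :
    Measurable[⨆ k ∈ {k | k < n}, mZ.comap (s k)]
      fun ω => S.iterate A r c η (fun k x => G x (s k ω)) n := by
  refine hS.measurable_iterate (mΩ := ⨆ k ∈ {k | k < n}, mZ.comap (s k))
    (A := fun _ => A) (r := fun _ => r) (c := fun _ => c) (η := fun _ => η)
    (G := fun ω k x => G x (s k ω)) measurable_const measurable_const measurable_const
    (fun k => measurable_const) (fun _ => hη) n fun k hk => ?_
  have h1 : Measurable[⨆ k ∈ {k | k < n}, mZ.comap (s k)] (s k) :=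
    Measurable.mono (comap_measurable (s k)) (le_iSup₂_of_le k hk le_rfl) le_rfl
  let _ : MeasurableSpace Ω := ⨆ k ∈ {k | k < n}, mZ.comap (s k)
  exact hG.comp (measurable_snd.prodMk (h1.comp measurable_fst))

theorem IsRegular.measurable_iid_iterate {S : Stage E F C} (hS : S.IsRegular)
    (A : E →L[ℝ] F) (r : F) (c : C) {η : ℕ → ℝ} (hη : ∀ k, 0 < η (k + 1)) {s : ℕ → Ω → Z}
    (hs : IsIID s Pr Q)
    {G : E → Z → (E →L[ℝ] ℝ)} (hG : Measurable fun p : E × Z => G p.1 p.2) (n : ℕ) :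
    Measurable fun ω => S.iterate A r c η (fun k x => G x (s k ω)) n :=
  (hS.measurable_past_iterate A r c hη hG n).mono
    (iSup₂_le fun k _ => (hs.measurable k).comap_le) le_rfl

theorem IsRegular.indep_iterate {S : Stage E F C} (hS : S.IsRegular)
    (A : E →L[ℝ] F) (r : F) (c : C) {η : ℕ → ℝ} (hη : ∀ k, 0 < η (k + 1)) {s : ℕ → Ω → Z}
    (hs : IsIID s Pr Q)
    {G : E → Z → (E →L[ℝ] ℝ)} (hG : Measurable fun p : E × Z => G p.1 p.2) (n : ℕ) :
    IndepFun (fun ω => (S.iterate A r c η (fun k x => G x (s k ω)) n).1) (s n) Pr :=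
  indepFun_of_past hs.measurable hs.indep
    (measurable_fst.comp (hS.measurable_past_iterate A r c hη hG n))

/-- Moments and bias of the subgradients used by a loop. -/
theorem IsRegular.oracle_step {S : Stage E F C} (hS : S.IsRegular)
    (A : E →L[ℝ] F) (r : F) (c : C) {η : ℕ → ℝ} (hη : ∀ k, 0 < η (k + 1)) {s : ℕ → Ω → Z}
    (hs : IsIID s Pr Q) {v : E → ℝ} {L : ℝ}
    (hv : ∀ x ∈ S.X, ∀ x' ∈ S.X, |v x - v x'| ≤ L * ‖x - x'‖) {D : ℝ}
    (hD : ∀ x ∈ S.X, ∀ x' ∈ S.X, ‖x - x'‖ ≤ D)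
    {G : E → Z → (E →L[ℝ] ℝ)} {Γ e : ℝ} (hG : IsOracle S Q v G Γ e)
    {x : E} (hx : x ∈ S.X) (n : ℕ) :
    (∫⁻ ω, ‖G (S.iterate A r c η (fun k x => G x (s k ω)) n).1 (s n ω)‖ₑ ^ 2 ∂Pr
      ≤ ENNReal.ofReal (Γ ^ 2)) ∧
    (Integrable (fun ω => S.noise L D
        ‖G (S.iterate A r c η (fun k x => G x (s k ω)) n).1 (s n ω)‖) Pr ∧
      ∫ ω, S.noise L D ‖G (S.iterate A r c η (fun k x => G x (s k ω)) n).1 (s n ω)‖ ∂Pr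
        ≤ S.noise L D Γ) ∧
    (Integrable (fun ω => subgradError v
        (G (S.iterate A r c η (fun k x => G x (s k ω)) n).1 (s n ω))
        (S.iterate A r c η (fun k x => G x (s k ω)) n).1 x) Pr ∧
      ∫ ω, subgradError v (G (S.iterate A r c η (fun k x => G x (s k ω)) n).1 (s n ω))
        (S.iterate A r c η (fun k x => G x (s k ω)) n).1 x ∂Pr ≤ e) := by
  set p : Ω → E := fun ω => (S.iterate A r c η (fun k x => G x (s k ω)) n).1 with hp
  have hpm : Measurable p := (hS.measurable_iid_iterate A r c hη hs hG.measurable n).fst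
  have hpX : ∀ ω, p ω ∈ S.X := fun ω => hS.iterate_mem _ _ _ _ _ _
  have hind : IndepFun p (s n) Pr := hS.indep_iterate A r c hη hs hG.measurable n
  have hgm : Measurable fun ω => G (p ω) (s n ω) :=
    hG.measurable.comp (hpm.prodMk (hs.measurable n))
  have hq : 0 < S.α * S.μ := mul_pos hS.α_pos hS.μ_pos
  have h1 : ∫⁻ ω, ‖G (p ω) (s n ω)‖ₑ ^ 2 ∂Pr ≤ ENNReal.ofReal (Γ ^ 2) :=
    lintegral_indep_le hpm (hs.measurable n) hind (hs.law n) hpX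
      (Φ := fun q => ‖G q.1 q.2‖ₑ ^ 2) (hG.measurable.enorm.pow_const 2) hG.moment
  obtain ⟨h2, h3⟩ := integrable_sq_of_lintegral_le hgm.aestronglyMeasurable (sq_nonneg Γ) h1
  have h4 : Integrable (fun ω => ‖G (p ω) (s n ω)‖) Pr :=
    (integrable_of_sq hgm.aestronglyMeasurable h2).norm
  -- The noise is affine in `γ ^ 2`, so a second moment bound is all that is needed.
  have hn : ∀ γ : ℝ, S.noise L D γ
      = 8 / (S.α * S.μ) * γ ^ 2 + (8 * L ^ 2 / (S.α * S.μ) + S.α * S.μ * D ^ 2) := fun γ => by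
    unfold noise; ring
  refine ⟨h1, ?_, ?_⟩
  · simp_rw [hn]
    refine ⟨(h2.const_mul _).add (integrable_const _), ?_⟩
    change ∫ ω, (8 / (S.α * S.μ) * ‖G (p ω) (s n ω)‖ ^ 2 + _) ∂Pr ≤ _
    rw [integral_add (h2.const_mul _) (integrable_const _), integral_const_mul]
    simp only [integral_const, probReal_univ, one_smul]
    gcongr
  · have hvc : ContinuousOn v S.X := by
      have hL : LipschitzOnWith (Real.toNNReal L) v S.X := by
        refine LipschitzOnWith.of_dist_le_mul fun a ha b hb => ?_
        rw [Real.dist_eq, dist_eq_norm]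
        exact (hv a ha b hb).trans
          (mul_le_mul_of_nonneg_right (Real.le_coe_toNNReal L) (norm_nonneg _))
      exact hL.continuousOn
    have hvm : Measurable fun ω => v (p ω) - v x :=
      (measurable_continuousOn_comp hvc hpm hpX).sub measurable_const
    have hvi : Integrable (fun ω => v (p ω) - v x) Pr := by
      refine Integrable.mono' (integrable_const (|L| * D)) hvm.aestronglyMeasurable
        (ae_of_all _ fun ω => ?_)
      refine (hv _ (hpX ω) x hx).trans ?_
      exact mul_le_mul (le_abs_self L) (hD _ (hpX ω) x hx) (norm_nonneg _) (abs_nonneg _)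
    have hΦ : Measurable fun q : E × Z => G q.1 q.2 (q.1 - x) :=
      measurable_clm_apply hG.measurable (measurable_fst.sub measurable_const)
    have hgi : Integrable (fun ω => G (p ω) (s n ω) (p ω - x)) Pr := by
      refine (h4.mul_const D).mono' (hΦ.comp (hpm.prodMk (hs.measurable n))).aestronglyMeasurable
        (ae_of_all _ fun ω => ?_)
      exact ((G (p ω) (s n ω)).le_opNorm _).trans
        (mul_le_mul_of_nonneg_left (hD _ (hpX ω) x hx) (norm_nonneg _))
    -- Averaging over the fresh sample with the iterate frozen turns the random subgradient into its
    -- mean, to which the bias bound applies.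
    obtain ⟨h5, h6⟩ := integral_indep_eq hpm (hs.measurable n) hind (hs.law n) hΦ hgi
    refine ⟨hvi.sub hgi, ?_⟩
    simp only [subgradError]
    rw [integral_sub hvi hgi, h6, ← integral_sub hvi h5]
    calc ∫ ω, (v (p ω) - v x - ∫ z, G (p ω) z (p ω - x) ∂Q) ∂Pr ≤ ∫ _, e ∂Pr :=
          integral_mono (hvi.sub h5) (integrable_const _) fun ω => hG.bias _ (hpX ω) x hx
      _ = e := by simp

/-- The expected accumulated error of the subgradients used by a loop. -/
theorem IsRegular.oracle_sum {S : Stage E F C} (hS : S.IsRegular)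
    (A : E →L[ℝ] F) (r : F) (c : C) {η : ℕ → ℝ} (hη : ∀ k, 0 < η (k + 1)) {s : ℕ → Ω → Z}
    (hs : IsIID s Pr Q) {v : E → ℝ} {L : ℝ}
    (hv : ∀ x ∈ S.X, ∀ x' ∈ S.X, |v x - v x'| ≤ L * ‖x - x'‖) {D : ℝ}
    (hD : ∀ x ∈ S.X, ∀ x' ∈ S.X, ‖x - x'‖ ≤ D)
    {G : E → Z → (E →L[ℝ] ℝ)} {Γ e : ℝ} (hG : IsOracle S Q v G Γ e)
    {x : E} (hx : x ∈ S.X) (n : ℕ) :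
    Integrable (fun ω => ∑ k ∈ Finset.range n,
      (S.noise L D ‖G (S.iterate A r c η (fun k x => G x (s k ω)) k).1 (s k ω)‖
        + ((k : ℝ) + 1) * subgradError v
          (G (S.iterate A r c η (fun k x => G x (s k ω)) k).1 (s k ω))
          (S.iterate A r c η (fun k x => G x (s k ω)) k).1 x)) Pr ∧
    ∫ ω, ∑ k ∈ Finset.range n,
      (S.noise L D ‖G (S.iterate A r c η (fun k x => G x (s k ω)) k).1 (s k ω)‖
        + ((k : ℝ) + 1) * subgradError v
          (G (S.iterate A r c η (fun k x => G x (s k ω)) k).1 (s k ω))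
          (S.iterate A r c η (fun k x => G x (s k ω)) k).1 x) ∂Pr
      ≤ n * S.noise L D Γ + n * (n + 1) / 2 * e := by
  have h := fun k => (hS.oracle_step A r c hη hs hv hD hG hx k).2
  set B : ℕ → Ω → ℝ := fun k ω =>
    S.noise L D ‖G (S.iterate A r c η (fun k x => G x (s k ω)) k).1 (s k ω)‖
  set B' : ℕ → Ω → ℝ := fun k ω => subgradError v
    (G (S.iterate A r c η (fun k x => G x (s k ω)) k).1 (s k ω))
    (S.iterate A r c η (fun k x => G x (s k ω)) k).1 x
  have hi : ∀ k : ℕ, Integrable (fun ω => B k ω + ((k : ℝ) + 1) * B' k ω) Pr :=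
    fun k => (h k).1.1.add ((h k).2.1.const_mul ((k : ℝ) + 1))
  change Integrable (fun ω => ∑ k ∈ Finset.range n, (B k ω + ((k : ℝ) + 1) * B' k ω)) Pr ∧
    ∫ ω, ∑ k ∈ Finset.range n, (B k ω + ((k : ℝ) + 1) * B' k ω) ∂Pr ≤ _
  refine ⟨integrable_finsetSum _ fun k _ => hi k, ?_⟩
  rw [integral_finsetSum _ fun k _ => hi k, ← sum_range_succ_cast, Finset.sum_mul]
  have e1 : (n : ℝ) * S.noise L D Γ = ∑ k ∈ Finset.range n, S.noise L D Γ := by simp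
  rw [e1, ← Finset.sum_add_distrib]
  refine Finset.sum_le_sum fun k _ => ?_
  rw [integral_add (h k).1.1 ((h k).2.1.const_mul _), integral_const_mul]
  exact add_le_add (h k).1.2 (mul_le_mul_of_nonneg_left (h k).2.2 (by positivity))

end Stage

end StochasticLoop

namespace Stage

/-! ### Regularized step sizes and the loop without cost-to-go. -/

section ExactLoop

variable {E F C : Type*} [NormedAddCommGroup E] [NormedSpace ℝ E]
  [NormedAddCommGroup F] [InnerProductSpace ℝ F] [MeasurableSpace C]

/-- Step sizes `4 ‖A‖² N / (k α μ)` with the value `1` for the degenerate operator `A = 0`. -/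
def etaReg (S : Stage E F C) (A : E →L[ℝ] F) (N : ℕ) (k : ℕ) : ℝ :=
  open Classical in if A = 0 then 1 else 4 * ‖A‖ ^ 2 * N / (k * S.α * S.μ)

theorem etaShort_eq_etaReg (S : Stage E F C) {A : E →L[ℝ] F} (hA : A ≠ 0) :
    S.etaShort A = S.etaReg A 1 := by
  ext k
  simp [etaShort, etaReg, hA]

theorem etaLong_eq_etaReg (S : Stage E F C) {A : E →L[ℝ] F} (hA : A ≠ 0) (N : ℕ) :
    S.etaLong A N = S.etaReg A N := by
  ext k
  simp [etaLong, etaReg, hA]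

/-- Measurability of the iterates needs positive step sizes for every operator, not just almost
surely: with `η = 0` the dual step minimizes a linear form over a cone and may have no minimizer or
several. -/
theorem IsRegular.etaReg_pos {S : Stage E F C} (hS : S.IsRegular) (A : E →L[ℝ] F) {N : ℕ}
    (hN : 0 < N) (k : ℕ) : 0 < S.etaReg A N (k + 1) := by
  have h1 := hS.α_pos
  have h2 := hS.μ_pos
  unfold etaReg
  split_ifs with h
  · exact one_pos
  · have h3 : 0 < ‖A‖ := norm_pos_iff.2 h
    have h4 : (0 : ℝ) < N := Nat.cast_pos.2 hN
    push_cast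
    positivity

theorem IsRegular.etaReg_mul {S : Stage E F C} (hS : S.IsRegular) {A : E →L[ℝ] F}
    (hA : A ≠ 0) (N k : ℕ) :
    ((k : ℝ) + 1) * S.etaReg A N (k + 1) = 4 * ‖A‖ ^ 2 * N / (S.α * S.μ) := by
  have h1 := hS.α_pos
  have h2 := hS.μ_pos
  rw [etaReg, if_neg hA]
  push_cast
  field_simp

theorem IsRegular.stepConst_pos {S : Stage E F C} (hS : S.IsRegular) {A : E →L[ℝ] F}
    (hA : A ≠ 0) {N : ℕ} (hN : 0 < N) : 0 < 4 * ‖A‖ ^ 2 * N / (S.α * S.μ) := by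
  have h1 := hS.α_pos
  have h2 := hS.μ_pos
  have h3 : 0 < ‖A‖ := norm_pos_iff.2 hA
  have h4 : (0 : ℝ) < N := Nat.cast_pos.2 hN
  positivity

theorem IsRegular.le_stepConst {S : Stage E F C} (hS : S.IsRegular) (A : E →L[ℝ] F)
    {N : ℕ} (hN : 0 < N) : 4 * ‖A‖ ^ 2 ≤ S.α * S.μ * (4 * ‖A‖ ^ 2 * N / (S.α * S.μ)) := by
  have hq : 0 < S.α * S.μ := mul_pos hS.α_pos hS.μ_pos
  rw [mul_div_cancel₀ _ hq.ne']
  have h4 : (1 : ℝ) ≤ N := by exact_mod_cast hN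
  exact le_mul_of_one_le_right (by positivity) h4

theorem IsRegular.weightedAverage_dual_mem [CompleteSpace F] {S : Stage E F C}
    (hS : S.IsRegular) (A : E →L[ℝ] F) (r : F) (c : C) {η : ℕ → ℝ} (hη : ∀ k, 0 < η (k + 1))
    (G : ℕ → E → (E →L[ℝ] ℝ)) {n : ℕ} (hn : 0 < n) :
    weightedAverage n (fun k => (S.iterate A r c η G k).2.1) ∈ S.dualCone :=
  weightedAverage_mem S.convex_dualCone hn fun k => hS.iterate_dual_mem A r c hη G (k + 1)

/-- A loop without a cost-to-go function. -/
theorem IsRegular.exact_loop [CompleteSpace F] {S : Stage E F C} (hS : S.IsRegular)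
    {A : E →L[ℝ] F} (hA : A ≠ 0) {r : F} {c : C} {ys : F}
    (hys : S.IsMultiplier A r c 0 ys) {n : ℕ} (hn : 0 < n) :
    (∀ x ∈ S.X, S.value A r c 0 - S.lagrangian A r c 0 x
        (weightedAverage n fun k => (S.iterate A r c (S.etaReg A 1) (fun _ _ => 0) k).2.1)
      ≤ 4 * ‖A‖ ^ 2 * ‖ys - S.y₀‖ ^ 2 / (S.α * S.μ * (n : ℝ) ^ 2)) ∧
    ‖ys - weightedAverage n fun k => (S.iterate A r c (S.etaReg A 1) (fun _ _ => 0) k).2.1‖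
      ≤ ‖ys - S.y₀‖ := by
  have hq : 0 < S.α * S.μ := mul_pos hS.α_pos hS.μ_pos
  have hCe0 := hS.stepConst_pos hA one_pos
  have hCe := hS.le_stepConst A one_pos
  have hη := hS.etaReg_mul hA 1
  have hηpos := hS.etaReg_pos A one_pos
  set Ce := 4 * ‖A‖ ^ 2 * ((1 : ℕ) : ℝ) / (S.α * S.μ) with hCedef
  set z := S.iterate A r c (S.etaReg A 1) (fun _ _ => 0) with hz
  -- Without a cost-to-go function the linearized gap is the exact Lagrangian gap, so no noise
  -- appears and the rate is quadratic.
  have hgap : ∀ (k : ℕ) (x : E) (y : F), S.linGap A r c 0 (z (k + 1)).1 (z (k + 1)).2.1 x y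
      = S.lagrangian A r c 0 (z (k + 1)).1 y - S.lagrangian A r c 0 x (z (k + 1)).2.1 := by
    intro k x y
    simp only [linGap, lagrangian, Pi.zero_apply, zero_apply]
    ring
  have hmain : ∀ x ∈ S.X, ∀ y ∈ S.dualCone, ∀ n : ℕ,
      ∑ k ∈ Finset.range n, ((k : ℝ) + 1) * (S.lagrangian A r c 0 (z (k + 1)).1 y
          - S.lagrangian A r c 0 x (z (k + 1)).2.1) + Ce / 2 * ‖y - (z n).2.1‖ ^ 2
        ≤ Ce / 2 * ‖y - S.y₀‖ ^ 2 := by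
    intro x hx y hy n
    have h := hS.sum_linGap_le r c hCe0 hCe hη (fun _ _ => 0) hx hy n
    simp only [← hz, hgap] at h
    refine le_trans (le_add_of_nonneg_right ?_) h
    exact Finset.sum_nonneg fun k _ => by positivity
  constructor
  · intro x hx
    obtain ⟨xs, hxs, -, -, h1⟩ := hys.exists_solution
    have h2 := hmain x hx ys hys.1 n
    have h3 := S.lagrangian_weightedAverage A r c 0 x hn (fun k => (z k).2.1)
      (S.value A r c 0)
    have h4 : ∑ k ∈ Finset.range n, ((k : ℝ) + 1) *
        (S.value A r c 0 - S.lagrangian A r c 0 x (z (k + 1)).2.1)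
        ≤ ∑ k ∈ Finset.range n, ((k : ℝ) + 1) * (S.lagrangian A r c 0 (z (k + 1)).1 ys
          - S.lagrangian A r c 0 x (z (k + 1)).2.1) :=
      Finset.sum_le_sum fun k _ => mul_le_mul_of_nonneg_left
        (sub_le_sub_right (h1 _ (hS.iterate_mem A r c _ _ (k + 1))) _) (by positivity)
    have h5 : 0 ≤ Ce / 2 * ‖ys - (z n).2.1‖ ^ 2 := by positivity
    rw [← h3] at h4
    set a := S.value A r c 0 - S.lagrangian A r c 0 x (weightedAverage n fun k => (z k).2.1)
    have hn' : (0 : ℝ) < n := Nat.cast_pos.2 hn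
    rw [le_div_iff₀ (by positivity)]
    have h6 : (n : ℝ) * (n + 1) / 2 * a ≤ Ce / 2 * ‖ys - S.y₀‖ ^ 2 := by linarith
    have h7 : S.α * S.μ * Ce = 4 * ‖A‖ ^ 2 := by
      rw [hCedef, mul_div_cancel₀ _ hq.ne', Nat.cast_one, mul_one]
    -- Replacing `n * (n + 1)` by `n ^ 2` requires a nonnegative gap; a nonpositive one satisfies
    -- the bound trivially.
    rcases le_total a 0 with ha | ha
    · have : a * (S.α * S.μ * (n : ℝ) ^ 2) ≤ 0 :=
        mul_nonpos_of_nonpos_of_nonneg ha (by positivity)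
      exact this.trans (by positivity)
    · have h8 : (n : ℝ) ^ 2 * a ≤ Ce * ‖ys - S.y₀‖ ^ 2 := by nlinarith
      calc a * (S.α * S.μ * (n : ℝ) ^ 2) = S.α * S.μ * ((n : ℝ) ^ 2 * a) := by ring
        _ ≤ S.α * S.μ * (Ce * ‖ys - S.y₀‖ ^ 2) := mul_le_mul_of_nonneg_left h8 hq.le
        _ = _ := by rw [← mul_assoc, h7]
  · obtain ⟨hy, xs, hxs, h1, h2⟩ := hys
    -- The gap against a saddle point is nonnegative, so no dual iterate is farther from the
    -- multiplier than the initial one; balls are convex, which transfers this to the average.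
    have h3 : ∀ k, (z k).2.1 ∈ Metric.closedBall ys ‖ys - S.y₀‖ := by
      intro k
      have h4 := hmain xs hxs ys hy k
      have h5 : 0 ≤ ∑ k ∈ Finset.range k, ((k : ℝ) + 1) * (S.lagrangian A r c 0 (z (k + 1)).1 ys
          - S.lagrangian A r c 0 xs (z (k + 1)).2.1) :=
        Finset.sum_nonneg fun k _ => mul_nonneg (by positivity) (sub_nonneg.2
          ((h2 _ (hS.iterate_dual_mem A r c hηpos _ (k + 1))).trans
            (h1 _ (hS.iterate_mem A r c _ _ (k + 1)))))
      have h6 : ‖ys - (z k).2.1‖ ^ 2 ≤ ‖ys - S.y₀‖ ^ 2 := by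
        have : Ce / 2 * ‖ys - (z k).2.1‖ ^ 2 ≤ Ce / 2 * ‖ys - S.y₀‖ ^ 2 := by linarith
        exact le_of_mul_le_mul_left this (by positivity)
      rw [mem_closedBall_iff_norm, norm_sub_rev]
      exact le_of_sq_le_sq h6 (norm_nonneg _)
    have := weightedAverage_mem (z := fun k => (z k).2.1)
      (convex_closedBall ys ‖ys - S.y₀‖) hn fun k => h3 (k + 1)
    rwa [mem_closedBall_iff_norm, norm_sub_rev] at this

end ExactLoop

/-! ### Dual points as approximate subgradients of the value function. -/

section Recourse

variable {E₀ E F C : Type*} [NormedAddCommGroup E₀] [NormedSpace ℝ E₀]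
  [NormedAddCommGroup E] [NormedSpace ℝ E]
  [NormedAddCommGroup F] [InnerProductSpace ℝ F] [CompleteSpace F]

theorem _root_.DSA.Scenario.adj_apply (ξ : Scenario E₀ E F C) (y : F) (w : E₀) :
    ξ.adj y w = ⟪y, ξ.B w⟫ := rfl

theorem _root_.DSA.Scenario.norm_adj_le (ξ : Scenario E₀ E F C) (y : F) {β Y : ℝ}
    (hβ : ‖ξ.B‖ ≤ β) (hY : ‖y‖ ≤ Y) : ‖ξ.adj y‖ ≤ β * Y := by
  have h0 := (norm_nonneg ξ.B).trans hβ
  refine ContinuousLinearMap.opNorm_le_bound _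
    (mul_nonneg h0 ((norm_nonneg y).trans hY)) fun w => ?_
  rw [Scenario.adj_apply]
  calc ‖⟪y, ξ.B w⟫‖ ≤ ‖y‖ * ‖ξ.B w‖ := norm_inner_le_norm _ _
    _ ≤ Y * (β * ‖w‖) := mul_le_mul hY ((ξ.B.le_opNorm w).trans
        (mul_le_mul_of_nonneg_right hβ (norm_nonneg w))) (norm_nonneg _) ((norm_nonneg y).trans hY)
    _ = β * Y * ‖w‖ := by ring

theorem _root_.DSA.Scenario.rhs_sub (ξ : Scenario E₀ E F C) (u u' : E₀) :
    ξ.rhs u' - ξ.rhs u = -ξ.B (u - u') := by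
  simp [Scenario.rhs]

/-- The value at `u'` controls the error of any dual point as a subgradient at `u`. -/
theorem IsMultiplier.exists_recourse {S : Stage E F C} {ξ : Scenario E₀ E F C} {v : E → ℝ}
    {u' : E₀} {y' : F} (h' : S.IsMultiplier ξ.A (ξ.rhs u') ξ.c v y') :
    ∃ x ∈ S.X, ∀ (u : E₀) (y : F), y ∈ S.dualCone →
      S.value ξ.A (ξ.rhs u) ξ.c v - S.value ξ.A (ξ.rhs u') ξ.c v - ξ.adj y (u - u')
        ≤ S.value ξ.A (ξ.rhs u) ξ.c v - S.lagrangian ξ.A (ξ.rhs u) ξ.c v x y := by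
  -- This `x` solves the problem at `u'` and precedes `u` and `y`; it is therefore independent of
  -- the samples that produce `y`.
  obtain ⟨x, hx, h⟩ := h'.lagrangian_le_value
  refine ⟨x, hx, fun u y hy => ?_⟩
  have h1 := h (ξ.rhs u) y hy
  rw [ξ.rhs_sub, inner_neg_left, real_inner_comm] at h1
  rw [Scenario.adj_apply]
  linarith

/-- An exact multiplier `y` makes `Bᵀ y` a genuine subgradient of the value in `u`; Lipschitz
continuity and convexity of the value functions follow from it. -/
theorem IsMultiplier.value_sub_le {S : Stage E F C} {ξ : Scenario E₀ E F C} {v : E → ℝ}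
    {u u' : E₀} {y y' : F} (h : S.IsMultiplier ξ.A (ξ.rhs u) ξ.c v y)
    (h' : S.IsMultiplier ξ.A (ξ.rhs u') ξ.c v y') :
    S.value ξ.A (ξ.rhs u) ξ.c v - S.value ξ.A (ξ.rhs u') ξ.c v ≤ ξ.adj y (u - u') := by
  have h1 := h.value_add_le h'
  rw [ξ.rhs_sub, inner_neg_left, real_inner_comm] at h1
  rw [Scenario.adj_apply]
  linarith

/-- Bounded multipliers make the value Lipschitz continuous. -/
theorem IsMultiplier.value_lipschitz {S : Stage E F C} {ξ : Scenario E₀ E F C} {v : E → ℝ}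
    {u u' : E₀} {y y' : F} (h : S.IsMultiplier ξ.A (ξ.rhs u) ξ.c v y)
    (h' : S.IsMultiplier ξ.A (ξ.rhs u') ξ.c v y') {β R : ℝ} (hβ : ‖ξ.B‖ ≤ β)
    (hy : ‖y‖ ≤ R) (hy' : ‖y'‖ ≤ R) :
    |S.value ξ.A (ξ.rhs u) ξ.c v - S.value ξ.A (ξ.rhs u') ξ.c v| ≤ β * R * ‖u - u'‖ := by
  have h1 := h.value_sub_le h'
  have h2 := h'.value_sub_le h
  have h3 : ∀ (z : F) (w : E₀), ‖z‖ ≤ R → ξ.adj z w ≤ β * R * ‖w‖ := fun z w hz =>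
    (le_abs_self _).trans (((ξ.adj z).le_opNorm w).trans
      (mul_le_mul_of_nonneg_right (ξ.norm_adj_le z hβ hz) (norm_nonneg w)))
  have h4 := h3 y (u - u') hy
  have h5 := h3 y' (u' - u) hy'
  rw [norm_sub_rev] at h5
  rw [abs_le]
  constructor <;> linarith

end Recourse

end Stage

/-! ### Measurability in the scenario data. -/

section ScenarioMeasurability

variable {E₀ E F C Ω : Type*} [NormedAddCommGroup E₀] [NormedSpace ℝ E₀] [FiniteDimensional ℝ E₀]
  [MeasurableSpace E₀] [BorelSpace E₀]
  [NormedAddCommGroup E] [NormedSpace ℝ E] [FiniteDimensional ℝ E]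
  [NormedAddCommGroup F] [InnerProductSpace ℝ F] [FiniteDimensional ℝ F]
  [MeasurableSpace F] [BorelSpace F] [MeasurableSpace C] [MeasurableSpace Ω]

theorem Scenario.measurable_A : Measurable (Scenario.A : Scenario E₀ E F C → _) := measurable_fst

theorem Scenario.measurable_b : Measurable (Scenario.b : Scenario E₀ E F C → _) :=
  measurable_snd.fst

theorem Scenario.measurable_B : Measurable (Scenario.B : Scenario E₀ E F C → _) :=
  measurable_snd.snd.fst

theorem Scenario.measurable_c : Measurable (Scenario.c : Scenario E₀ E F C → _) :=
  measurable_snd.snd.snd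

theorem Scenario.measurable_rhs {ξ : Ω → Scenario E₀ E F C} {u : Ω → E₀} (hξ : Measurable ξ)
    (hu : Measurable u) : Measurable fun ω => (ξ ω).rhs (u ω) :=
  (Scenario.measurable_b.comp hξ).add
    (measurable_clm_apply (Scenario.measurable_B.comp hξ) hu)

theorem Scenario.measurable_adj {ξ : Ω → Scenario E₀ E F C} {y : Ω → F} (hξ : Measurable ξ)
    (hy : Measurable y) : Measurable fun ω => (ξ ω).adj (y ω) := by
  have : ProperSpace F := FiniteDimensional.proper_real _
  have hc : Continuous fun p : F × (E₀ →L[ℝ] F) => (innerSL ℝ p.1).comp p.2 :=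
    ((innerSL ℝ).continuous.comp continuous_fst).clm_comp continuous_snd
  exact hc.measurable.comp (hy.prodMk (Scenario.measurable_B.comp hξ))

/-- Needed because the lengths of the inner and middle loops depend on the random data. -/
theorem measurable_nat_comp {V : Type*} [MeasurableSpace V] {f : ℕ → Ω → V} {n : Ω → ℕ}
    (hf : ∀ k, Measurable (f k)) (hn : Measurable n) : Measurable fun ω => f (n ω) ω :=
  (measurable_from_prod_countable_right (f := fun p : ℕ × Ω => f p.1 p.2) hf).comp
    (hn.prodMk measurable_id)

theorem measurable_weightedAverage {V : Type*} [NormedAddCommGroup V] [NormedSpace ℝ V]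
    [FiniteDimensional ℝ V] [MeasurableSpace V] [BorelSpace V] {z : Ω → ℕ → V} {n : Ω → ℕ}
    (hz : ∀ k, Measurable fun ω => z ω k) (hn : Measurable n) :
    Measurable fun ω => weightedAverage (n ω) (z ω) := by
  have : ProperSpace V := FiniteDimensional.proper_real _
  refine measurable_nat_comp (f := fun k ω => weightedAverage k (z ω)) (fun k => ?_) hn
  exact (Finset.measurable_fun_sum _ fun i _ => (hz i).const_smul _).const_smul _

theorem Stage.measurable_etaReg (S : Stage E F C) {A : Ω → E →L[ℝ] F} (hA : Measurable A)
    {N : Ω → ℕ} (hN : Measurable N) (k : ℕ) : Measurable fun ω => S.etaReg (A ω) (N ω) k := by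
  unfold Stage.etaReg
  refine Measurable.ite (hA (measurableSet_singleton 0)) measurable_const ?_
  exact (((hA.norm.pow_const 2).const_mul 4).mul
    ((measurable_from_top (f := fun n : ℕ => (n : ℝ))).comp hN)).div_const _

end ScenarioMeasurability

/-! ### The inner loop: error and size of its subgradients. -/

section Problem

variable {E₁ E₂ E₃ F₁ F₂ F₃ C₁ C₂ C₃ : Type*}
  [NormedAddCommGroup E₁] [NormedSpace ℝ E₁] [FiniteDimensional ℝ E₁]
  [MeasurableSpace E₁] [BorelSpace E₁]
  [NormedAddCommGroup E₂] [NormedSpace ℝ E₂] [FiniteDimensional ℝ E₂]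
  [MeasurableSpace E₂] [BorelSpace E₂]
  [NormedAddCommGroup E₃] [NormedSpace ℝ E₃] [FiniteDimensional ℝ E₃]
  [NormedAddCommGroup F₁] [InnerProductSpace ℝ F₁] [FiniteDimensional ℝ F₁]
  [NormedAddCommGroup F₂] [InnerProductSpace ℝ F₂] [FiniteDimensional ℝ F₂]
  [MeasurableSpace F₂] [BorelSpace F₂]
  [NormedAddCommGroup F₃] [InnerProductSpace ℝ F₃] [FiniteDimensional ℝ F₃]
  [MeasurableSpace F₃] [BorelSpace F₃]
  [MeasurableSpace C₁] [MeasurableSpace C₂] [MeasurableSpace C₃]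

namespace Problem

variable (D : Problem E₁ E₂ E₃ F₁ F₂ F₃ C₁ C₂ C₃) (m : Multipliers E₁ E₂ E₃ F₁ F₂ F₃ C₂ C₃)

/-- The inner subgradient with the step sizes `etaReg`, which makes it measurable. -/
def G₃Reg (ε : ℝ) (u : E₂) (ξ : Scenario E₂ E₃ F₃ C₃) : E₂ →L[ℝ] ℝ :=
  ξ.adj (weightedAverage (D.N₃ m ε u ξ) fun k =>
    (D.S₃.iterate ξ.A (ξ.rhs u) ξ.c (D.S₃.etaReg ξ.A 1) (fun _ _ => 0) k).2.1)

/-- The middle loop with the step sizes `etaReg`. -/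
def iter₂Reg (M₃ ε : ℝ) (u : E₁) (ξ : Scenario E₁ E₂ F₂ C₂) (s : ℕ → Scenario E₂ E₃ F₃ C₃) :
    ℕ → E₂ × F₂ × F₂ :=
  D.S₂.iterate ξ.A (ξ.rhs u) ξ.c (D.S₂.etaReg ξ.A (D.N₂ m M₃ ε u ξ))
    (fun j x => D.G₃Reg m ε x (s j))

/-- The middle subgradient with the step sizes `etaReg`. -/
def G₂Reg (M₃ ε : ℝ) (u : E₁) (ξ : Scenario E₁ E₂ F₂ C₂) (s : ℕ → Scenario E₂ E₃ F₃ C₃) :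
    E₁ →L[ℝ] ℝ :=
  ξ.adj (weightedAverage (D.N₂ m M₃ ε u ξ) fun j => (D.iter₂Reg m M₃ ε u ξ s j).2.1)

theorem G₃_eq_reg {ξ : Scenario E₂ E₃ F₃ C₃} (hξ : ξ.A ≠ 0) (ε : ℝ) (u : E₂) :
    D.G₃ m ε u ξ = D.G₃Reg m ε u ξ := by
  rw [G₃, G₃Reg, ybar₃, D.S₃.etaShort_eq_etaReg hξ]

theorem iter₂_eq_reg {ξ : Scenario E₁ E₂ F₂ C₂} (hξ : ξ.A ≠ 0)
    {s : ℕ → Scenario E₂ E₃ F₃ C₃} (hs : ∀ j, (s j).A ≠ 0) (M₃ ε : ℝ) (u : E₁) :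
    D.iter₂ m M₃ ε u ξ s = D.iter₂Reg m M₃ ε u ξ s := by
  rw [iter₂, iter₂Reg, D.S₂.etaLong_eq_etaReg hξ]
  congr
  ext j x : 2
  exact D.G₃_eq_reg m (hs j) ε x

theorem G₂_eq_reg {ξ : Scenario E₁ E₂ F₂ C₂} (hξ : ξ.A ≠ 0)
    {s : ℕ → Scenario E₂ E₃ F₃ C₃} (hs : ∀ j, (s j).A ≠ 0) (M₃ ε : ℝ) (u : E₁) :
    D.G₂ m M₃ ε u ξ s = D.G₂Reg m M₃ ε u ξ s := by
  rw [G₂, G₂Reg, ybar₂, D.iter₂_eq_reg m hξ hs]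

variable {D m}

theorem N₃_pos (ε : ℝ) (u : E₂) (ξ : Scenario E₂ E₃ F₃ C₃) : 0 < D.N₃ m ε u ξ :=
  lt_of_lt_of_le one_pos (le_max_left _ _)

theorem N₂_pos (M₃ ε : ℝ) (u : E₁) (ξ : Scenario E₁ E₂ F₂ C₂) : 0 < D.N₂ m M₃ ε u ξ :=
  lt_of_lt_of_le one_pos (le_max_left _ _)

theorem N₁_pos (M₂ ε : ℝ) : 0 < D.N₁ m M₂ ε := lt_of_lt_of_le one_pos (le_max_left _ _)

theorem measurable_N₃ (hm : Measurable (Function.uncurry m.y₃)) (ε : ℝ) :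
    Measurable fun p : E₂ × Scenario E₂ E₃ F₃ C₃ => D.N₃ m ε p.1 p.2 := by
  unfold N₃
  have h1 : Measurable fun p : E₂ × Scenario E₂ E₃ F₃ C₃ => m.y₃ p.1 p.2 := hm
  have h2 : Measurable fun p : E₂ × Scenario E₂ E₃ F₃ C₃ => p.2.A :=
    Scenario.measurable_A.comp measurable_snd
  exact measurable_const.max (Nat.measurable_ceil.comp
    (((h2.norm.const_mul _).mul (h1.sub_const _).norm).div_const _))

theorem measurable_N₂ (hm : Measurable (Function.uncurry m.y₂)) (M₃ ε : ℝ) :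
    Measurable fun p : E₁ × Scenario E₁ E₂ F₂ C₂ => D.N₂ m M₃ ε p.1 p.2 := by
  unfold N₂
  have h1 : Measurable fun p : E₁ × Scenario E₁ E₂ F₂ C₂ => m.y₂ p.1 p.2 := hm
  have h2 : Measurable fun p : E₁ × Scenario E₁ E₂ F₂ C₂ => p.2.A :=
    Scenario.measurable_A.comp measurable_snd
  exact measurable_const.max (Nat.measurable_ceil.comp
    (((((h2.norm.pow_const 2).const_mul _).mul ((h1.const_sub _).norm.pow_const 2)).add_const
      _).div_const _))

theorem measurable_G₃Reg (hS₃ : D.S₃.IsRegular) (hm : Measurable (Function.uncurry m.y₃)) (ε : ℝ) :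
    Measurable fun p : E₂ × Scenario E₂ E₃ F₃ C₃ => D.G₃Reg m ε p.1 p.2 := by
  let _ : MeasurableSpace E₃ := borel E₃
  have : BorelSpace E₃ := ⟨rfl⟩
  unfold G₃Reg
  refine Scenario.measurable_adj measurable_snd
    (measurable_weightedAverage (fun k => ?_) (measurable_N₃ hm ε))
  exact (hS₃.measurable_iterate (Scenario.measurable_A.comp measurable_snd)
    (Scenario.measurable_rhs measurable_snd measurable_fst)
    (Scenario.measurable_c.comp measurable_snd)
    (fun k => D.S₃.measurable_etaReg (Scenario.measurable_A.comp measurable_snd)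
      measurable_const (k + 1)) (fun p k => hS₃.etaReg_pos _ one_pos k) k
    fun _ _ => measurable_const).snd.fst

theorem measurable_iter₂Reg (hS₂ : D.S₂.IsRegular) (hS₃ : D.S₃.IsRegular)
    (hm₂ : Measurable (Function.uncurry m.y₂))
    (hm₃ : Measurable (Function.uncurry m.y₃)) (M₃ ε : ℝ) (j : ℕ) :
    Measurable fun p : E₁ × Scenario E₁ E₂ F₂ C₂ × (ℕ → Scenario E₂ E₃ F₃ C₃) =>
      D.iter₂Reg m M₃ ε p.1 p.2.1 p.2.2 j := by
  have hξ : Measurable fun p : E₁ × Scenario E₁ E₂ F₂ C₂ × (ℕ → Scenario E₂ E₃ F₃ C₃) => p.2.1 :=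
    measurable_snd.fst
  have hN : Measurable fun p : E₁ × Scenario E₁ E₂ F₂ C₂ × (ℕ → Scenario E₂ E₃ F₃ C₃) =>
      D.N₂ m M₃ ε p.1 p.2.1 := by
    have h := (measurable_N₂ (D := D) hm₂ M₃ ε).comp (measurable_fst.prodMk hξ)
    exact h
  have hA : Measurable fun p : E₁ × Scenario E₁ E₂ F₂ C₂ × (ℕ → Scenario E₂ E₃ F₃ C₃) =>
      p.2.1.A := Scenario.measurable_A.comp hξ
  unfold iter₂Reg
  refine hS₂.measurable_iterate (Ω := E₁ × Scenario E₁ E₂ F₂ C₂ × (ℕ → Scenario E₂ E₃ F₃ C₃))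
    (A := fun p => p.2.1.A) (r := fun p => p.2.1.rhs p.1) (c := fun p => p.2.1.c)
    (η := fun p => D.S₂.etaReg p.2.1.A (D.N₂ m M₃ ε p.1 p.2.1))
    (G := fun p j x => D.G₃Reg m ε x (p.2.2 j)) hA
    (Scenario.measurable_rhs hξ measurable_fst) (Scenario.measurable_c.comp hξ)
    (fun k => D.S₂.measurable_etaReg hA hN (k + 1))
    (fun p k => hS₂.etaReg_pos _ (N₂_pos _ _ _ _) k) j fun k _ => ?_
  have h1 : Measurable fun q : (E₁ × Scenario E₁ E₂ F₂ C₂ × (ℕ → Scenario E₂ E₃ F₃ C₃)) × E₂ =>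
      q.1.2.2 k := (measurable_pi_apply k).comp measurable_fst.snd.snd
  have h2 := (measurable_G₃Reg (D := D) hS₃ hm₃ ε).comp (measurable_snd.prodMk h1)
  exact h2

theorem measurable_G₂Reg (hS₂ : D.S₂.IsRegular) (hS₃ : D.S₃.IsRegular)
    (hm₂ : Measurable (Function.uncurry m.y₂))
    (hm₃ : Measurable (Function.uncurry m.y₃)) (M₃ ε : ℝ) :
    Measurable fun p : E₁ × Scenario E₁ E₂ F₂ C₂ × (ℕ → Scenario E₂ E₃ F₃ C₃) =>
      D.G₂Reg m M₃ ε p.1 p.2.1 p.2.2 := by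
  have hξ : Measurable fun p : E₁ × Scenario E₁ E₂ F₂ C₂ × (ℕ → Scenario E₂ E₃ F₃ C₃) => p.2.1 :=
    measurable_snd.fst
  have hN : Measurable fun p : E₁ × Scenario E₁ E₂ F₂ C₂ × (ℕ → Scenario E₂ E₃ F₃ C₃) =>
      D.N₂ m M₃ ε p.1 p.2.1 := by
    have h := (measurable_N₂ (D := D) hm₂ M₃ ε).comp (measurable_fst.prodMk hξ)
    exact h
  have hy : ∀ k, Measurable fun p : E₁ × Scenario E₁ E₂ F₂ C₂ × (ℕ → Scenario E₂ E₃ F₃ C₃) =>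
      (D.iter₂Reg m M₃ ε p.1 p.2.1 p.2.2 k).2.1 := fun k =>
    (measurable_iter₂Reg (D := D) hS₂ hS₃ hm₂ hm₃ M₃ ε k).snd.fst
  unfold G₂Reg
  exact Scenario.measurable_adj hξ (measurable_weightedAverage hy hN)

/-- The data of stage 3 for which the inner loop is analysed. -/
structure Good₃ (D : Problem E₁ E₂ E₃ F₁ F₂ F₃ C₁ C₂ C₃)
    (m : Multipliers E₁ E₂ E₃ F₁ F₂ F₃ C₂ C₃) (β R : ℝ)
    (ξ : Scenario E₂ E₃ F₃ C₃) : Prop where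
  A_ne : ξ.A ≠ 0
  B_le : ‖ξ.B‖ ≤ β
  multiplier : ∀ u ∈ D.S₂.X, D.S₃.IsMultiplier ξ.A (ξ.rhs u) ξ.c 0 (m.y₃ u ξ)
  bound : ∀ u ∈ D.S₂.X, ‖m.y₃ u ξ‖ ≤ R

theorem Good₃.V₃_lipschitz {β R : ℝ} {ξ : Scenario E₂ E₃ F₃ C₃} (h : Good₃ D m β R ξ)
    {u u' : E₂} (hu : u ∈ D.S₂.X) (hu' : u' ∈ D.S₂.X) :
    |D.V₃ u ξ - D.V₃ u' ξ| ≤ β * R * ‖u - u'‖ :=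
  (h.multiplier u hu).value_lipschitz (h.multiplier u' hu') h.B_le (h.bound u hu) (h.bound u' hu')

/-- The averaged dual output is no farther from the multiplier than `y₀` is, so its norm is at most
`R + (R + ‖y₀‖)`, whatever the accuracy `ε`. -/
theorem Good₃.norm_G₃_le (hS₃ : D.S₃.IsRegular) {β R : ℝ} {ξ : Scenario E₂ E₃ F₃ C₃}
    (h : Good₃ D m β R ξ) (ε : ℝ) {u : E₂} (hu : u ∈ D.S₂.X) :
    ‖D.G₃Reg m ε u ξ‖ ≤ β * (2 * R + ‖D.S₃.y₀‖) := by
  refine ξ.norm_adj_le _ h.B_le ?_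
  have h1 := (hS₃.exact_loop h.A_ne (h.multiplier u hu) (N₃_pos (D := D) (m := m) ε u ξ)).2
  set y := weightedAverage (D.N₃ m ε u ξ) fun k =>
    (D.S₃.iterate ξ.A (ξ.rhs u) ξ.c (D.S₃.etaReg ξ.A 1) (fun _ _ => 0) k).2.1
  have h2 : ‖y‖ ≤ ‖m.y₃ u ξ‖ + ‖m.y₃ u ξ - y‖ := by
    have := norm_sub_le (m.y₃ u ξ) (m.y₃ u ξ - y)
    rwa [sub_sub_cancel] at this
  have h3 := norm_sub_le (m.y₃ u ξ) D.S₃.y₀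
  have h4 := h.bound u hu
  linarith

/-- The dual gap of the exact loop is at most `4 ‖A‖² ‖y* - y₀‖² / (α μ N²)`, and `N₃` is chosen so
that `N² α μ ε ≥ 24 ‖A‖² ‖y* - y₀‖²`. -/
theorem Good₃.G₃_error (hS₃ : D.S₃.IsRegular) {β R : ℝ} {ξ : Scenario E₂ E₃ F₃ C₃}
    (h : Good₃ D m β R ξ) {ε : ℝ} (hε : 0 < ε) {u u' : E₂} (hu : u ∈ D.S₂.X)
    (hu' : u' ∈ D.S₂.X) :
    D.V₃ u ξ - D.V₃ u' ξ - D.G₃Reg m ε u ξ (u - u') ≤ ε / 6 := by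
  have hN := N₃_pos (D := D) (m := m) ε u ξ
  have h1 := (hS₃.exact_loop h.A_ne (h.multiplier u hu) hN).1
  obtain ⟨x, hx, h2⟩ := (h.multiplier u' hu').exists_recourse
  have hy := hS₃.weightedAverage_dual_mem ξ.A (ξ.rhs u) ξ.c (hS₃.etaReg_pos ξ.A one_pos)
    (fun _ _ => 0) hN
  refine (h2 u _ hy).trans ((h1 x hx).trans ?_)
  have hq : 0 < D.S₃.α * D.S₃.μ := mul_pos hS₃.α_pos hS₃.μ_pos
  have hN' : (0 : ℝ) < D.N₃ m ε u ξ := Nat.cast_pos.2 hN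
  have h3 : 2 * √6 * ‖ξ.A‖ * ‖m.y₃ u ξ - D.S₃.y₀‖ / √(D.S₃.α * D.S₃.μ * ε)
      ≤ D.N₃ m ε u ξ := by
    rw [N₃, Nat.cast_max]
    exact (Nat.le_ceil _).trans (le_max_right _ _)
  have hqε : 0 < D.S₃.α * D.S₃.μ * ε := by positivity
  have h4 := pow_le_pow_left₀ (by positivity) h3 2
  rw [div_pow, Real.sq_sqrt hqε.le, div_le_iff₀ hqε] at h4
  have h5 : (2 * √6 * ‖ξ.A‖ * ‖m.y₃ u ξ - D.S₃.y₀‖) ^ 2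
      = 24 * ‖ξ.A‖ ^ 2 * ‖m.y₃ u ξ - D.S₃.y₀‖ ^ 2 := by
    rw [mul_pow, mul_pow, mul_pow, Real.sq_sqrt (by norm_num)]; ring
  rw [h5] at h4
  rw [div_le_iff₀ (by positivity)]
  linarith

end Problem

end Problem

/-! ### Expected dual distance and dual gap of a stochastic loop. -/

section StochasticLoop

variable {E F C Ω Z : Type*} [NormedAddCommGroup E] [NormedSpace ℝ E] [FiniteDimensional ℝ E]
  [MeasurableSpace E] [BorelSpace E]
  [NormedAddCommGroup F] [InnerProductSpace ℝ F] [FiniteDimensional ℝ F]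
  [MeasurableSpace F] [BorelSpace F] [MeasurableSpace C]
  [mΩ : MeasurableSpace Ω] [mZ : MeasurableSpace Z] {Pr : Measure Ω} [IsProbabilityMeasure Pr]
  {Q : Measure Z} [IsProbabilityMeasure Q]

theorem isIID_infinitePi (Q : Measure Z) [IsProbabilityMeasure Q] :
    IsIID (fun k (ω : ℕ → Z) => ω k) (Measure.infinitePi fun _ : ℕ => Q) Q where
  measurable := measurable_pi_apply
  indep := iIndepFun_infinitePi (P := fun _ : ℕ => Q) (X := fun _ z => z)
    fun _ => measurable_id
  law k := Measure.infinitePi_map_eval _ k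

namespace Stage

/-- The expected squared distance of the dual iterates of a stochastic loop to a multiplier. -/
theorem IsRegular.stochastic_dual_dist {S : Stage E F C} (hS : S.IsRegular)
    {A : E →L[ℝ] F} {r : F} {c : C} {η : ℕ → ℝ} {Ce : ℝ} (hCe0 : 0 < Ce)
    (hCe : 4 * ‖A‖ ^ 2 ≤ S.α * S.μ * Ce) (hη : ∀ k : ℕ, ((k : ℝ) + 1) * η (k + 1) = Ce)
    {s : ℕ → Ω → Z} (hs : IsIID s Pr Q) {v : E → ℝ} {L D : ℝ}
    (hv : ∀ x ∈ S.X, ∀ x' ∈ S.X, |v x - v x'| ≤ L * ‖x - x'‖)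
    (hD : ∀ x ∈ S.X, ∀ x' ∈ S.X, ‖x - x'‖ ≤ D)
    {G : E → Z → (E →L[ℝ] ℝ)} {Γ e : ℝ} (hG : IsOracle S Q v G Γ e)
    {ys : F} (hys : S.IsMultiplier A r c v ys) (n : ℕ) :
    Integrable (fun ω => ‖ys - (S.iterate A r c η (fun k x => G x (s k ω)) n).2.1‖ ^ 2) Pr ∧
    ∫ ω, ‖ys - (S.iterate A r c η (fun k x => G x (s k ω)) n).2.1‖ ^ 2 ∂Pr
      ≤ ‖ys - S.y₀‖ ^ 2 + 2 / Ce * (n * S.noise L D Γ + n * (n + 1) / 2 * e) := by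
  have : CompleteSpace F := FiniteDimensional.complete ℝ F
  have : ProperSpace F := FiniteDimensional.proper_real _
  have hηpos := step_pos hCe0 hη
  obtain ⟨xs, hxs, h1⟩ := hS.dual_dist_le hCe0 hCe hη hv hD hys
  obtain ⟨h2, h3⟩ := hS.oracle_sum A r c hηpos hs hv hD hG hxs n
  have hm := (hS.measurable_iid_iterate A r c hηpos hs hG.measurable n).snd.fst
  set B : Ω → ℝ := fun ω => ∑ k ∈ Finset.range n,
      (S.noise L D ‖G (S.iterate A r c η (fun k x => G x (s k ω)) k).1 (s k ω)‖
        + ((k : ℝ) + 1) * subgradError v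
          (G (S.iterate A r c η (fun k x => G x (s k ω)) k).1 (s k ω))
          (S.iterate A r c η (fun k x => G x (s k ω)) k).1 xs)
  have h4 : ∀ ω, ‖ys - (S.iterate A r c η (fun k x => G x (s k ω)) n).2.1‖ ^ 2
      ≤ ‖ys - S.y₀‖ ^ 2 + 2 / Ce * B ω := by
    intro ω
    have h5 := h1 (fun k x => G x (s k ω)) n
    have h6 : Ce / 2 * ‖ys - S.y₀‖ ^ 2 + B ω
        = Ce / 2 * (‖ys - S.y₀‖ ^ 2 + 2 / Ce * B ω) := by field_simp
    exact le_of_mul_le_mul_left (h5.trans_eq h6) (half_pos hCe0)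
  have hint : Integrable (fun ω => ‖ys - S.y₀‖ ^ 2 + 2 / Ce * B ω) Pr :=
    (integrable_const _).add (h2.const_mul _)
  have hint' : Integrable
      (fun ω => ‖ys - (S.iterate A r c η (fun k x => G x (s k ω)) n).2.1‖ ^ 2) Pr := by
    refine hint.mono' ((hm.const_sub ys).norm.pow_const 2).aestronglyMeasurable
      (ae_of_all _ fun ω => ?_)
    rw [Real.norm_of_nonneg (by positivity)]
    exact h4 ω
  refine ⟨hint', (integral_mono hint' hint h4).trans ?_⟩
  rw [integral_add (integrable_const _) (h2.const_mul _), integral_const_mul]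
  simp only [integral_const, probReal_univ, one_smul]
  gcongr

/-- The expected error of the averaged dual output of a stochastic loop. -/
theorem IsRegular.stochastic_dual_gap {S : Stage E F C} (hS : S.IsRegular)
    {A : E →L[ℝ] F} {r : F} {c : C} {η : ℕ → ℝ} {Ce : ℝ} (hCe0 : 0 < Ce)
    (hCe : 4 * ‖A‖ ^ 2 ≤ S.α * S.μ * Ce) (hη : ∀ k : ℕ, ((k : ℝ) + 1) * η (k + 1) = Ce)
    {s : ℕ → Ω → Z} (hs : IsIID s Pr Q) {v : E → ℝ} {L D : ℝ}
    (hv : ∀ x ∈ S.X, ∀ x' ∈ S.X, |v x - v x'| ≤ L * ‖x - x'‖)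
    (hD : ∀ x ∈ S.X, ∀ x' ∈ S.X, ‖x - x'‖ ≤ D)
    {G : E → Z → (E →L[ℝ] ℝ)} {Γ e : ℝ} (hG : IsOracle S Q v G Γ e)
    {ys : F} (hys : S.IsMultiplier A r c v ys) {x : E} (hx : x ∈ S.X) {n : ℕ} (hn : 0 < n)
    {f : Ω → ℝ} (hf : Integrable f Pr)
    (hfle : ∀ ω, f ω ≤ S.value A r c v - S.lagrangian A r c v x
      (weightedAverage n fun k => (S.iterate A r c η (fun k x => G x (s k ω)) k).2.1)) :
    ∫ ω, f ω ∂Pr ≤ (Ce / 2 * ‖ys - S.y₀‖ ^ 2 + n * S.noise L D Γ) / (n * (n + 1) / 2) + e := by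
  have : CompleteSpace F := FiniteDimensional.complete ℝ F
  have hηpos := step_pos hCe0 hη
  obtain ⟨h2, h3⟩ := hS.oracle_sum A r c hηpos hs hv hD hG hx n
  have hn' : (0 : ℝ) < n := Nat.cast_pos.2 hn
  set W : ℝ := (n : ℝ) * (n + 1) / 2 with hW
  have hW0 : 0 < W := by positivity
  -- Working with a minorant `f` of the gap means that only `f` has to be integrable.
  have h4 : ∀ ω, f ω * W ≤ Ce / 2 * ‖ys - S.y₀‖ ^ 2 + ∑ k ∈ Finset.range n,
      (S.noise L D ‖G (S.iterate A r c η (fun k x => G x (s k ω)) k).1 (s k ω)‖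
        + ((k : ℝ) + 1) * subgradError v
          (G (S.iterate A r c η (fun k x => G x (s k ω)) k).1 (s k ω))
          (S.iterate A r c η (fun k x => G x (s k ω)) k).1 x) := fun ω => by
    have h5 := hS.dual_gap_le hCe0 hCe hη (fun k x => G x (s k ω)) hv hD hys hx hn
    refine le_trans ?_ h5
    rw [mul_comm]
    exact mul_le_mul_of_nonneg_left (hfle ω) hW0.le
  have h6 := integral_mono (hf.mul_const W) ((integrable_const _).add h2) h4
  simp only [Pi.add_apply] at h6
  rw [integral_add (integrable_const _) h2, integral_mul_const, integral_const, probReal_univ,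
    one_smul] at h6
  rw [div_add' _ _ _ hW0.ne', le_div_iff₀ hW0]
  linarith

end Stage

theorem lintegral_enorm_sq_le {V : Type*} [NormedAddCommGroup V] {f : Ω → V} {b : Ω → ℝ} {c : ℝ}
    (hb : Integrable b Pr) (hle : ∀ᵐ ω ∂Pr, ‖f ω‖ ^ 2 ≤ b ω) (hc : ∫ ω, b ω ∂Pr ≤ c) :
    ∫⁻ ω, ‖f ω‖ₑ ^ 2 ∂Pr ≤ ENNReal.ofReal c := by
  refine le_trans (lintegral_mono_ae (g := fun ω => ENNReal.ofReal (b ω)) ?_) ?_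
  · filter_upwards [hle] with ω hω
    rw [enorm_sq_eq]
    exact ENNReal.ofReal_le_ofReal hω
  · rw [← ofReal_integral_eq_lintegral_ofReal hb
      (hle.mono fun ω hω => (sq_nonneg _).trans hω)]
    exact ENNReal.ofReal_le_ofReal hc

end StochasticLoop

/-! ### The inner loop as an oracle for `v³`. -/

section Problem

variable {E₁ E₂ E₃ F₁ F₂ F₃ C₁ C₂ C₃ : Type*}
  [NormedAddCommGroup E₁] [NormedSpace ℝ E₁] [FiniteDimensional ℝ E₁]
  [MeasurableSpace E₁] [BorelSpace E₁]
  [NormedAddCommGroup E₂] [NormedSpace ℝ E₂] [FiniteDimensional ℝ E₂]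
  [MeasurableSpace E₂] [BorelSpace E₂]
  [NormedAddCommGroup E₃] [NormedSpace ℝ E₃] [FiniteDimensional ℝ E₃]
  [NormedAddCommGroup F₁] [InnerProductSpace ℝ F₁] [FiniteDimensional ℝ F₁]
  [NormedAddCommGroup F₂] [InnerProductSpace ℝ F₂] [FiniteDimensional ℝ F₂]
  [MeasurableSpace F₂] [BorelSpace F₂]
  [NormedAddCommGroup F₃] [InnerProductSpace ℝ F₃] [FiniteDimensional ℝ F₃]
  [MeasurableSpace F₃] [BorelSpace F₃]
  [MeasurableSpace C₁] [MeasurableSpace C₂] [MeasurableSpace C₃]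

namespace Problem

variable {D : Problem E₁ E₂ E₃ F₁ F₂ F₃ C₁ C₂ C₃} {m : Multipliers E₁ E₂ E₃ F₁ F₂ F₃ C₂ C₃}

/-- The data of stage 2 for which the middle loop is analysed. -/
structure Good₂ (D : Problem E₁ E₂ E₃ F₁ F₂ F₃ C₁ C₂ C₃)
    (m : Multipliers E₁ E₂ E₃ F₁ F₂ F₃ C₂ C₃) (β₂ β₃ a a' R : ℝ)
    (ξ : Scenario E₁ E₂ F₂ C₂) : Prop where
  le_A : a ≤ ‖ξ.A‖
  A_le : ‖ξ.A‖ ≤ a'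
  B_le : ‖ξ.B‖ ≤ β₂
  multiplier : ∀ u ∈ D.S₁.X, D.S₂.IsMultiplier ξ.A (ξ.rhs u) ξ.c (D.v₃ ξ) (m.y₂ u ξ)
  bound : ∀ u ∈ D.S₁.X, ‖m.y₂ u ξ‖ ≤ R
  integrable : ∀ u ∈ D.S₂.X, Integrable (D.V₃ u) (D.κ ξ)
  good₃ : ∀ᵐ ξ₃ ∂(D.κ ξ), Good₃ D m β₃ R ξ₃

variable {β₂ β₃ a a' R : ℝ} {ξ : Scenario E₁ E₂ F₂ C₂}

theorem Good₂.V₂_lipschitz (h : Good₂ D m β₂ β₃ a a' R ξ)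
    {u u' : E₁} (hu : u ∈ D.S₁.X) (hu' : u' ∈ D.S₁.X) :
    |D.V₂ u ξ - D.V₂ u' ξ| ≤ β₂ * R * ‖u - u'‖ :=
  (h.multiplier u hu).value_lipschitz (h.multiplier u' hu') h.B_le (h.bound u hu) (h.bound u' hu')

variable [IsMarkovKernel D.κ]

theorem Good₂.v₃_lipschitz (h : Good₂ D m β₂ β₃ a a' R ξ)
    {u u' : E₂} (hu : u ∈ D.S₂.X) (hu' : u' ∈ D.S₂.X) :
    |D.v₃ ξ u - D.v₃ ξ u'| ≤ β₃ * R * ‖u - u'‖ := by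
  rw [v₃, v₃, ← integral_sub (h.integrable u hu) (h.integrable u' hu')]
  have h1 : ∀ᵐ ξ₃ ∂(D.κ ξ), ‖D.V₃ u ξ₃ - D.V₃ u' ξ₃‖ ≤ β₃ * R * ‖u - u'‖ := by
    filter_upwards [h.good₃] with ξ₃ h₃
    exact h₃.V₃_lipschitz hu hu'
  have h2 := norm_integral_le_of_norm_le_const h1
  rwa [probReal_univ, mul_one] at h2

/-- The bias is the smaller of the accuracy of the inner loop and a bound from Lipschitz constant,
subgradient norm and diameter. The second does not involve `ε`; it keeps the moments of the middle
loop bounded for large `ε`, where the loop length stays at least `1` instead of decaying like `1 /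
ε`. -/
theorem Good₂.oracle₃ (hS₃ : D.S₃.IsRegular)
    (hm₃ : Measurable (Function.uncurry m.y₃)) (h : Good₂ D m β₂ β₃ a a' R ξ) {diam : ℝ}
    (hD : ∀ x ∈ D.S₂.X, ∀ x' ∈ D.S₂.X, ‖x - x'‖ ≤ diam) {ε : ℝ} (hε : 0 < ε) :
    IsOracle D.S₂ (D.κ ξ) (D.v₃ ξ) (fun u ξ₃ => D.G₃Reg m ε u ξ₃) (β₃ * (2 * R + ‖D.S₃.y₀‖))
      (min (ε / 6) ((β₃ * R + β₃ * (2 * R + ‖D.S₃.y₀‖)) * diam)) where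
  measurable := measurable_G₃Reg hS₃ hm₃ ε
  moment u hu := by
    refine lintegral_enorm_sq_le (b := fun _ => (β₃ * (2 * R + ‖D.S₃.y₀‖)) ^ 2)
      (integrable_const _) ?_ (by simp)
    filter_upwards [h.good₃] with ξ₃ h₃
    exact pow_le_pow_left₀ (norm_nonneg _) (h₃.norm_G₃_le hS₃ ε hu) 2
  bias u hu x hx := by
    have hgm : Measurable fun ξ₃ => D.G₃Reg m ε u ξ₃ (u - x) := by
      have h1 := (measurable_G₃Reg hS₃ hm₃ ε).comp (measurable_const (a := u).prodMk measurable_id)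
      exact measurable_clm_apply h1 measurable_const
    have hgi : Integrable (fun ξ₃ => D.G₃Reg m ε u ξ₃ (u - x)) (D.κ ξ) := by
      refine Integrable.mono' (integrable_const (β₃ * (2 * R + ‖D.S₃.y₀‖) * ‖u - x‖))
        hgm.aestronglyMeasurable ?_
      filter_upwards [h.good₃] with ξ₃ h₃
      exact ((D.G₃Reg m ε u ξ₃).le_opNorm _).trans
        (mul_le_mul_of_nonneg_right (h₃.norm_G₃_le hS₃ ε hu) (norm_nonneg _))
    have hi := (h.integrable u hu).sub (h.integrable x hx)
    have e1 : D.v₃ ξ u - D.v₃ ξ x - ∫ ξ₃, D.G₃Reg m ε u ξ₃ (u - x) ∂(D.κ ξ)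
        = ∫ ξ₃, (D.V₃ u ξ₃ - D.V₃ x ξ₃ - D.G₃Reg m ε u ξ₃ (u - x)) ∂(D.κ ξ) := by
      rw [v₃, v₃, ← integral_sub (h.integrable u hu) (h.integrable x hx)]
      exact (integral_sub hi hgi).symm
    have key : ∀ b : ℝ, (∀ᵐ ξ₃ ∂(D.κ ξ),
        D.V₃ u ξ₃ - D.V₃ x ξ₃ - D.G₃Reg m ε u ξ₃ (u - x) ≤ b) →
        D.v₃ ξ u - D.v₃ ξ x - ∫ ξ₃, D.G₃Reg m ε u ξ₃ (u - x) ∂(D.κ ξ) ≤ b := by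
      intro b hb
      rw [e1]
      refine (integral_mono_ae (hi.sub hgi) (integrable_const b) hb).trans (by simp)
    refine le_min (key _ ?_) (key _ ?_)
    · filter_upwards [h.good₃] with ξ₃ h₃
      exact h₃.G₃_error hS₃ hε hu hx
    · filter_upwards [h.good₃] with ξ₃ h₃
      have h1 := (abs_le.1 (h₃.V₃_lipschitz hu hx)).2
      have h2 : -(D.G₃Reg m ε u ξ₃ (u - x)) ≤ β₃ * (2 * R + ‖D.S₃.y₀‖) * ‖u - x‖ :=
        (neg_le_abs _).trans (((D.G₃Reg m ε u ξ₃).le_opNorm _).trans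
          (mul_le_mul_of_nonneg_right (h₃.norm_G₃_le hS₃ ε hu) (norm_nonneg _)))
      have h3 := (norm_nonneg _).trans h₃.B_le
      have h4 := (norm_nonneg _).trans (h₃.bound u hu)
      have h5 := mul_le_mul_of_nonneg_left (hD u hu x hx)
        (by positivity : 0 ≤ β₃ * R + β₃ * (2 * R + ‖D.S₃.y₀‖))
      linarith

end Problem

end Problem

/-! ### The middle loop: error and second moment of its subgradients. -/

section Problem

variable {E₁ E₂ E₃ F₁ F₂ F₃ C₁ C₂ C₃ : Type*}
  [NormedAddCommGroup E₁] [NormedSpace ℝ E₁] [FiniteDimensional ℝ E₁]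
  [MeasurableSpace E₁] [BorelSpace E₁]
  [NormedAddCommGroup E₂] [NormedSpace ℝ E₂] [FiniteDimensional ℝ E₂]
  [MeasurableSpace E₂] [BorelSpace E₂]
  [NormedAddCommGroup E₃] [NormedSpace ℝ E₃] [FiniteDimensional ℝ E₃]
  [NormedAddCommGroup F₁] [InnerProductSpace ℝ F₁] [FiniteDimensional ℝ F₁]
  [NormedAddCommGroup F₂] [InnerProductSpace ℝ F₂] [FiniteDimensional ℝ F₂]
  [MeasurableSpace F₂] [BorelSpace F₂]
  [NormedAddCommGroup F₃] [InnerProductSpace ℝ F₃] [FiniteDimensional ℝ F₃]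
  [MeasurableSpace F₃] [BorelSpace F₃]
  [MeasurableSpace C₁] [MeasurableSpace C₂] [MeasurableSpace C₃]

namespace Problem

variable {D : Problem E₁ E₂ E₃ F₁ F₂ F₃ C₁ C₂ C₃} {m : Multipliers E₁ E₂ E₃ F₁ F₂ F₃ C₂ C₃}

variable {β₂ β₃ a a' R : ℝ} {ξ : Scenario E₁ E₂ F₂ C₂}

/-- The bound for the approximate subgradients of `v³`. -/
def gradBound₃ (D : Problem E₁ E₂ E₃ F₁ F₂ F₃ C₁ C₂ C₃) (β₃ R : ℝ) : ℝ :=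
  β₃ * (2 * R + ‖D.S₃.y₀‖)

/-- The bound for the expected squared distance of the dual iterates of the middle loop to a
multiplier. -/
def distBound₂ (D : Problem E₁ E₂ E₃ F₁ F₂ F₃ C₁ C₂ C₃) (β₃ a a' R diam M₃ : ℝ) : ℝ :=
  (R + ‖D.S₂.y₀‖) ^ 2 + (73 * M₃ ^ 2 + 24 * a' ^ 2 * (R + ‖D.S₂.y₀‖) ^ 2
    + D.S₂.α * D.S₂.μ * ((β₃ * R + D.gradBound₃ β₃ R) * diam)) / (2 * a ^ 2)

/-- The bound for the second moments of the approximate subgradients of `v²`. -/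
def momentBound₂ (D : Problem E₁ E₂ E₃ F₁ F₂ F₃ C₁ C₂ C₃) (β₂ β₃ a a' R diam M₃ : ℝ) : ℝ :=
  β₂ ^ 2 * (2 * R ^ 2 + 2 * D.distBound₂ β₃ a a' R diam M₃)

/-- Accuracy of the middle loop needs this lower bound on its length; the upper bound `N₂_upper`
controls the second moments and the sample count. -/
theorem N₂_lower (hS₂ : D.S₂.IsRegular) {M₃ ε : ℝ} (hε : 0 < ε) (u : E₁) :
    24 * ‖ξ.A‖ ^ 2 * ‖D.S₂.y₀ - m.y₂ u ξ‖ ^ 2 + 72 * M₃ ^ 2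
      ≤ D.N₂ m M₃ ε u ξ * (D.S₂.α * D.S₂.μ * ε) := by
  have hq : 0 < D.S₂.α * D.S₂.μ := mul_pos hS₂.α_pos hS₂.μ_pos
  rw [← div_le_iff₀ (by positivity), N₂, Nat.cast_max]
  exact (Nat.le_ceil _).trans (le_max_right _ _)

theorem max_one_ceil_le {x : ℝ} (hx : 0 ≤ x) : ((max 1 ⌈x⌉₊ : ℕ) : ℝ) ≤ x + 1 := by
  rw [Nat.cast_max, Nat.cast_one]
  exact max_le (by linarith) (Nat.ceil_lt_add_one hx).le

theorem N₂_upper (hS₂ : D.S₂.IsRegular) {M₃ ε : ℝ} (hε : 0 < ε) (u : E₁) :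
    (D.N₂ m M₃ ε u ξ : ℝ) ≤ (24 * ‖ξ.A‖ ^ 2 * ‖D.S₂.y₀ - m.y₂ u ξ‖ ^ 2 + 72 * M₃ ^ 2)
      / (D.S₂.α * D.S₂.μ * ε) + 1 := by
  have hq : 0 < D.S₂.α * D.S₂.μ := mul_pos hS₂.α_pos hS₂.μ_pos
  exact max_one_ceil_le (by positivity)

variable [IsMarkovKernel D.κ]

theorem Good₂.dist_le (h : Good₂ D m β₂ β₃ a a' R ξ) {u : E₁} (hu : u ∈ D.S₁.X) :
    ‖m.y₂ u ξ - D.S₂.y₀‖ ≤ R + ‖D.S₂.y₀‖ :=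
  (norm_sub_le _ _).trans (add_le_add_left (h.bound u hu) _)

theorem Good₂.A_ne (h : Good₂ D m β₂ β₃ a a' R ξ) (ha : 0 < a) : ξ.A ≠ 0 :=
  norm_pos_iff.1 (ha.trans_le h.le_A)

/-- The numbers entering the analysis of the middle loop. -/
theorem middle_dist_arith {A d q n N M e e₀ nz ε a a' d₀ : ℝ} (ha : 0 < a) (haA : a ≤ A)
    (hA : A ≤ a') (hq : 0 < q) (hn0 : 0 ≤ n) (hnN : n ≤ N) (hN1 : 1 ≤ N) (hd : 0 ≤ d)
    (hd₀ : d ≤ d₀) (hε : 0 < ε) (he : 0 ≤ e) (heε : e ≤ ε) (hee : e ≤ e₀) (hnz : q * nz ≤ M ^ 2)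
    (hN : N ≤ (24 * A ^ 2 * d ^ 2 + 72 * M ^ 2) / (q * ε) + 1) :
    d ^ 2 + 2 / (4 * A ^ 2 * N / q) * (n * nz + n * (n + 1) / 2 * e)
      ≤ d₀ ^ 2 + (73 * M ^ 2 + 24 * a' ^ 2 * d₀ ^ 2 + q * e₀) / (2 * a ^ 2) := by
  have hA0 : 0 < A := ha.trans_le haA
  have hN0 : 0 < N := by linarith
  have h1 : d ^ 2 ≤ d₀ ^ 2 := pow_le_pow_left₀ hd hd₀ 2
  have h2 : A ^ 2 ≤ a' ^ 2 := pow_le_pow_left₀ hA0.le hA 2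
  have h3 : a ^ 2 ≤ A ^ 2 := pow_le_pow_left₀ ha.le haA 2
  -- Write `N = (N - 1) + 1`. The part `N - 1` lies below the unrounded length and is paired with `e
  -- ≤ ε`; the unit added by rounding is paired with `e ≤ e₀`.
  have h4 : q * (N * e) ≤ 24 * a' ^ 2 * d₀ ^ 2 + 72 * M ^ 2 + q * e₀ := by
    have h5 : N * (q * ε) ≤ 24 * A ^ 2 * d ^ 2 + 72 * M ^ 2 + q * ε := by
      have := mul_le_mul_of_nonneg_right hN (by positivity : 0 ≤ q * ε)
      rwa [add_mul, div_mul_cancel₀ _ (by positivity), one_mul] at this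
    have h6 : (N - 1) * (q * e) ≤ (N - 1) * (q * ε) :=
      mul_le_mul_of_nonneg_left (mul_le_mul_of_nonneg_left heε hq.le) (by linarith)
    have h7 : A ^ 2 * d ^ 2 ≤ a' ^ 2 * d₀ ^ 2 := mul_le_mul h2 h1 (by positivity) (by positivity)
    have h8 := mul_le_mul_of_nonneg_left hee hq.le
    nlinarith
  -- In the coefficient `73`, the share `72` comes from the bias through the loop length and `1`
  -- from the noise. The factor `N` cancels against the one in the step constant.
  have h9 : q * (n * nz + n * (n + 1) / 2 * e)
      ≤ N * (73 * M ^ 2 + 24 * a' ^ 2 * d₀ ^ 2 + q * e₀) := by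
    have h10 : n * (q * nz) ≤ N * M ^ 2 :=
      (mul_le_mul_of_nonneg_left hnz hn0).trans (mul_le_mul_of_nonneg_right hnN (sq_nonneg M))
    have h11 : n * (n + 1) / 2 * e ≤ N * (N * e) := by
      have h12 : n * (n + 1) / 2 ≤ N * N := by nlinarith
      calc n * (n + 1) / 2 * e ≤ N * N * e := mul_le_mul_of_nonneg_right h12 he
        _ = _ := by ring
    have h13 := mul_le_mul_of_nonneg_left h11 hq.le
    have h14 := mul_le_mul_of_nonneg_left h4 hN0.le
    nlinarith
  have hX0 : 0 ≤ 73 * M ^ 2 + 24 * a' ^ 2 * d₀ ^ 2 + q * e₀ := by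
    have := he.trans hee
    positivity
  refine add_le_add h1 ?_
  have e1 : 2 / (4 * A ^ 2 * N / q) * (n * nz + n * (n + 1) / 2 * e)
      = q * (n * nz + n * (n + 1) / 2 * e) / (2 * A ^ 2 * N) := by
    field_simp
    ring
  rw [e1]
  calc q * (n * nz + n * (n + 1) / 2 * e) / (2 * A ^ 2 * N)
      ≤ N * (73 * M ^ 2 + 24 * a' ^ 2 * d₀ ^ 2 + q * e₀) / (2 * A ^ 2 * N) := by gcongr
    _ = (73 * M ^ 2 + 24 * a' ^ 2 * d₀ ^ 2 + q * e₀) / (2 * A ^ 2) := by field_simp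
    _ ≤ _ := by gcongr

/-- Multiplied by `q`, the numerator is `N (2 A² d² + q nz)`, and the loop length makes the bracket
at most `N q ε / 12`; so the loop contributes `ε / 6`, as much as the bias it inherits. -/
theorem middle_gap_arith {A d q N M e nz ε : ℝ} (hq : 0 < q) (hN1 : 1 ≤ N) (hε : 0 < ε)
    (he : e ≤ ε / 6) (hnz : q * nz ≤ M ^ 2)
    (hN : 24 * A ^ 2 * d ^ 2 + 72 * M ^ 2 ≤ N * (q * ε)) :
    ((4 * A ^ 2 * N / q) / 2 * d ^ 2 + N * nz) / (N * (N + 1) / 2) + e ≤ ε / 3 := by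
  have hN0 : 0 < N := by linarith
  have h1 : ((4 * A ^ 2 * N / q) / 2 * d ^ 2 + N * nz) / (N * (N + 1) / 2) ≤ ε / 6 := by
    rw [div_le_iff₀ (by positivity)]
    refine le_of_mul_le_mul_left (a := q) ?_ hq
    have e1 : q * ((4 * A ^ 2 * N / q) / 2 * d ^ 2 + N * nz)
        = N * (2 * A ^ 2 * d ^ 2 + q * nz) := by field_simp; ring
    have e2 : q * (ε / 6 * (N * (N + 1) / 2)) = N * (q * ε * (N + 1) / 12) := by ring
    rw [e1, e2]
    refine mul_le_mul_of_nonneg_left ?_ hN0.le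
    have : 0 < q * ε := mul_pos hq hε
    nlinarith [sq_nonneg M]
  linarith

/-- Everything is stated for one fixed good `ξ²` and i.i.d. samples of its conditional law. The
moment bounds are free of `ε`, and the bias is a bound at each fixed `u'`, as an oracle requires. -/
theorem Good₂.middle (hS₂ : D.S₂.IsRegular) (hS₃ : D.S₃.IsRegular)
    (hm₂ : Measurable (Function.uncurry m.y₂)) (hm₃ : Measurable (Function.uncurry m.y₃))
    (h : Good₂ D m β₂ β₃ a a' R ξ) (ha : 0 < a) {diam : ℝ}
    (hD : ∀ x ∈ D.S₂.X, ∀ x' ∈ D.S₂.X, ‖x - x'‖ ≤ diam) {ε M₃ : ℝ} (hε : 0 < ε)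
    (hM : D.S₂.α * D.S₂.μ * D.S₂.noise (β₃ * R) diam (D.gradBound₃ β₃ R) ≤ M₃ ^ 2)
    {u : E₁} (hu : u ∈ D.S₁.X) :
    (∀ u' ∈ D.S₁.X, D.V₂ u ξ - D.V₂ u' ξ
      - ∫ s, D.G₂Reg m M₃ ε u ξ s (u - u') ∂(Measure.infinitePi fun _ : ℕ => D.κ ξ) ≤ ε / 3) ∧
    (∫⁻ s, ‖D.G₂Reg m M₃ ε u ξ s‖ₑ ^ 2 ∂(Measure.infinitePi fun _ : ℕ => D.κ ξ)
      ≤ ENNReal.ofReal (D.momentBound₂ β₂ β₃ a a' R diam M₃)) ∧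
    (∀ j, ∫⁻ s, ‖D.G₃Reg m ε (D.iter₂Reg m M₃ ε u ξ s j).1 (s j)‖ₑ ^ 2
        ∂(Measure.infinitePi fun _ : ℕ => D.κ ξ)
      ≤ ENNReal.ofReal (D.gradBound₃ β₃ R ^ 2)) := by
  have : CompleteSpace F₂ := FiniteDimensional.complete ℝ F₂
  have : ProperSpace F₂ := FiniteDimensional.proper_real _
  have : ProperSpace E₁ := FiniteDimensional.proper_real _
  set P := Measure.infinitePi fun _ : ℕ => D.κ ξ with hP
  have hs : IsIID (fun k (ω : ℕ → Scenario E₂ E₃ F₃ C₃) => ω k) P (D.κ ξ) :=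
    isIID_infinitePi (D.κ ξ)
  have hA := h.A_ne ha
  have hN := N₂_pos (D := D) (m := m) M₃ ε u ξ
  have hN1 : (1 : ℝ) ≤ D.N₂ m M₃ ε u ξ := by exact_mod_cast hN
  have hq : 0 < D.S₂.α * D.S₂.μ := mul_pos hS₂.α_pos hS₂.μ_pos
  have hCe0 := hS₂.stepConst_pos hA hN
  have hCe := hS₂.le_stepConst ξ.A hN
  have hη := hS₂.etaReg_mul hA (D.N₂ m M₃ ε u ξ)
  have hηpos := step_pos hCe0 hη
  have hv : ∀ x ∈ D.S₂.X, ∀ x' ∈ D.S₂.X, |D.v₃ ξ x - D.v₃ ξ x'| ≤ β₃ * R * ‖x - x'‖ :=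
    fun x hx x' hx' => h.v₃_lipschitz hx hx'
  have hG := h.oracle₃ hS₃ hm₃ hD hε
  have hys := h.multiplier u hu
  have hdist := hS₂.stochastic_dual_dist hCe0 hCe hη hs hv hD hG hys
  have hlow := N₂_lower (D := D) (m := m) (ξ := ξ) hS₂ (M₃ := M₃) hε u
  have hup := N₂_upper (D := D) (m := m) (ξ := ξ) hS₂ (M₃ := M₃) hε u
  rw [norm_sub_rev] at hlow hup
  set e := min (ε / 6) ((β₃ * R + β₃ * (2 * R + ‖D.S₃.y₀‖)) * diam) with he
  have he0 : 0 ≤ e := by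
    -- No sign is assumed for `β₃` and `R`; one good scenario, which exists under a probability
    -- measure, shows that both are nonnegative.
    obtain ⟨ξ₃, h₃⟩ := h.good₃.exists
    have h1 := (norm_nonneg _).trans h₃.B_le
    have h2 := (norm_nonneg _).trans (h₃.bound _ hS₂.x₀_mem)
    have h3 : 0 ≤ diam := (norm_nonneg _).trans (hD _ hS₂.x₀_mem _ hS₂.x₀_mem)
    exact le_min (by positivity) (by positivity)
  set N := D.N₂ m M₃ ε u ξ
  set ys := m.y₂ u ξ
  have hY : ∀ n ≤ N, ∫ s, ‖ys - (D.iter₂Reg m M₃ ε u ξ s n).2.1‖ ^ 2 ∂P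
      ≤ D.distBound₂ β₃ a a' R diam M₃ := fun n hn =>
    (hdist n).2.trans (middle_dist_arith ha h.le_A h.A_le hq (Nat.cast_nonneg n)
      (Nat.cast_le.2 hn) hN1 (norm_nonneg _) (h.dist_le hu) hε he0
      ((min_le_left _ _).trans (by linarith)) (min_le_right _ _) hM hup)
  have hYi : ∀ n, Integrable (fun s => ‖ys - (D.iter₂Reg m M₃ ε u ξ s n).2.1‖ ^ 2) P :=
    fun n => (hdist n).1
  set W : ℝ := (N : ℝ) * (N + 1) / 2 with hW
  have hW0 : 0 < W := by positivity
  set yb : (ℕ → Scenario E₂ E₃ F₃ C₃) → F₂ := fun s =>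
    weightedAverage N fun j => (D.iter₂Reg m M₃ ε u ξ s j).2.1 with hyb
  -- By Jensen the squared distance of the averaged output is at most this average of squared
  -- distances, each of which has bounded expectation.
  set b : (ℕ → Scenario E₂ E₃ F₃ C₃) → ℝ := fun s => W⁻¹ * ∑ k ∈ Finset.range N,
    ((k : ℝ) + 1) * ‖ys - (D.iter₂Reg m M₃ ε u ξ s (k + 1)).2.1‖ ^ 2 with hb
  have hbi : Integrable b P :=
    (integrable_finsetSum _ fun k _ => (hYi (k + 1)).const_mul _).const_mul _
  have hbint : ∫ s, b s ∂P ≤ D.distBound₂ β₃ a a' R diam M₃ := by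
    rw [hb, integral_const_mul, integral_finsetSum _ fun k _ => (hYi (k + 1)).const_mul _,
      inv_mul_le_iff₀ hW0, hW, ← sum_range_succ_cast, Finset.sum_mul]
    refine Finset.sum_le_sum fun k hk => ?_
    rw [integral_const_mul]
    exact mul_le_mul_of_nonneg_left (hY _ (Finset.mem_range.1 hk)) (by positivity)
  have hbd : ∀ s, ‖ys - yb s‖ ^ 2 ≤ b s := by
    intro s
    have hconv : ConvexOn ℝ univ fun y : F₂ => ‖ys - y‖ ^ 2 := by
      have h1 : ConvexOn ℝ univ fun y : F₂ => dist y ys := convexOn_univ_dist ys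
      have h2 := h1.pow (fun y _ => dist_nonneg) 2
      refine h2.congr fun y _ => ?_
      simp [dist_eq_norm, norm_sub_rev]
    have h1 := mul_convex_weightedAverage_le hconv hN
      (z := fun j => (D.iter₂Reg m M₃ ε u ξ s j).2.1) fun k => mem_univ _
    rw [hb]
    simp only
    rw [le_inv_mul_iff₀ hW0]
    exact h1
  have hGm : Measurable fun s => D.G₂Reg m M₃ ε u ξ s := by
    have h1 := (measurable_G₂Reg (D := D) hS₂ hS₃ hm₂ hm₃ M₃ ε).comp
      (measurable_const (a := u).prodMk (measurable_const (a := ξ).prodMk measurable_id))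
    exact h1
  have hGle : ∀ s, ‖D.G₂Reg m M₃ ε u ξ s‖ ^ 2 ≤ β₂ ^ 2 * (2 * R ^ 2 + 2 * b s) := by
    intro s
    have h1 := ξ.norm_adj_le (yb s) h.B_le le_rfl
    have h2 : ‖yb s‖ ≤ ‖ys‖ + ‖ys - yb s‖ := by
      have := norm_sub_le ys (ys - yb s)
      rwa [sub_sub_cancel] at this
    have h3 := h.bound u hu
    have h4 : ‖yb s‖ ^ 2 ≤ 2 * R ^ 2 + 2 * b s := by
      have h5 := hbd s
      have h6 : ‖yb s‖ ^ 2 ≤ (R + ‖ys - yb s‖) ^ 2 :=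
        pow_le_pow_left₀ (norm_nonneg _) (by linarith) 2
      nlinarith [sq_nonneg (R - ‖ys - yb s‖)]
    calc ‖D.G₂Reg m M₃ ε u ξ s‖ ^ 2 ≤ (β₂ * ‖yb s‖) ^ 2 :=
          pow_le_pow_left₀ (norm_nonneg _) h1 2
      _ = β₂ ^ 2 * ‖yb s‖ ^ 2 := by ring
      _ ≤ _ := mul_le_mul_of_nonneg_left h4 (sq_nonneg _)
  have hGbi : Integrable (fun s => β₂ ^ 2 * (2 * R ^ 2 + 2 * b s)) P :=
    ((integrable_const _).add (hbi.const_mul _)).const_mul _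
  have hmoment : ∫⁻ s, ‖D.G₂Reg m M₃ ε u ξ s‖ₑ ^ 2 ∂P
      ≤ ENNReal.ofReal (D.momentBound₂ β₂ β₃ a a' R diam M₃) := by
    refine lintegral_enorm_sq_le hGbi (ae_of_all _ hGle) ?_
    rw [integral_const_mul, integral_add (integrable_const _) (hbi.const_mul _),
      integral_const_mul 2 b, integral_const, probReal_univ, one_smul, momentBound₂]
    gcongr
  refine ⟨fun u' hu' => ?_, hmoment, fun j => ?_⟩
  · have hG1 : Integrable (fun s => D.G₂Reg m M₃ ε u ξ s) P :=
      integrable_of_sq hGm.aestronglyMeasurable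
        (hGbi.mono' (hGm.norm.pow_const 2).aestronglyMeasurable
          (ae_of_all _ fun s => by rw [Real.norm_of_nonneg (by positivity)]; exact hGle s))
    have hG2 : Integrable (fun s => D.G₂Reg m M₃ ε u ξ s (u - u')) P :=
      (hG1.norm.mul_const ‖u - u'‖).mono'
        (measurable_clm_apply hGm measurable_const).aestronglyMeasurable
        (ae_of_all _ fun s => (D.G₂Reg m M₃ ε u ξ s).le_opNorm _)
    -- Since `x` depends on `u'` and `ξ` but not on `s`, the expected dual gap at this fixed `x`
    -- bounds the bias.
    obtain ⟨x, hx, hrec⟩ := (h.multiplier u' hu').exists_recourse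
    have hgap := hS₂.stochastic_dual_gap hCe0 hCe hη hs hv hD hG hys hx hN
      (f := fun s => D.V₂ u ξ - D.V₂ u' ξ - D.G₂Reg m M₃ ε u ξ s (u - u'))
      ((integrable_const _).sub hG2)
      (fun s => hrec u _ (hS₂.weightedAverage_dual_mem ξ.A (ξ.rhs u) ξ.c hηpos _ hN))
    rw [integral_sub (integrable_const _) hG2, integral_const, probReal_univ, one_smul] at hgap
    exact hgap.trans (middle_gap_arith hq hN1 hε (min_le_left _ _) hM hlow)
  · exact (hS₂.oracle_step ξ.A (ξ.rhs u) ξ.c hηpos hs hv hD hG hS₂.x₀_mem j).1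

end Problem

end Problem

/-! ### The law of a block of conditionally independent samples. -/

section Blocks

variable {α β Ω : Type*} [mα : MeasurableSpace α] [mβ : MeasurableSpace β]
  [mΩ : MeasurableSpace Ω]

theorem isPiSystem_cylinders :
    IsPiSystem (squareCylinders fun _ : ℕ => {s : Set β | MeasurableSet s}) :=
  isPiSystem_squareCylinders (fun _ => MeasurableSpace.isPiSystem_measurableSet)
    fun _ => MeasurableSet.univ

/-- The kernel of independent sequences of law `κ a`. -/
def seqKernel (κ : Kernel α β) [IsMarkovKernel κ] : Kernel α (ℕ → β) where
  toFun a := Measure.infinitePi fun _ : ℕ => κ a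
  measurable' := by
    -- On cylinders the mass is a finite product of measurable functions of the parameter, and
    -- cylinders form a generating π-system.
    refine Measurable.measure_of_isPiSystem_of_isProbabilityMeasure
      generateFrom_squareCylinders.symm isPiSystem_cylinders ?_
    rintro _ ⟨s, t, ht, rfl⟩
    simp_rw [Measure.infinitePi_pi (fun _ : ℕ => κ _) (s := s) (fun i _ => ht i (mem_univ i))]
    exact Finset.measurable_fun_prod _ fun i _ => κ.measurable_coe (ht i (mem_univ i))

theorem seqKernel_apply (κ : Kernel α β) [IsMarkovKernel κ] (a : α) :
    seqKernel κ a = Measure.infinitePi fun _ : ℕ => κ a := rfl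

instance (κ : Kernel α β) [IsMarkovKernel κ] : IsMarkovKernel (seqKernel κ) :=
  ⟨fun a => by rw [seqKernel_apply]; infer_instance⟩

/-- A block law is determined by its values on finite boxes. -/
theorem map_block_eq {Pr : Measure Ω} [IsProbabilityMeasure Pr] {P : Measure α}
    [IsProbabilityMeasure P] {κ : Kernel α β} [IsMarkovKernel κ] {X : Ω → α} {Y : ℕ → Ω → β}
    (hX : Measurable X) (hY : ∀ j, Measurable (Y j))
    (h : ∀ n (U : Set α), MeasurableSet U → ∀ T : ℕ → Set β, (∀ j, MeasurableSet (T j)) →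
      Pr (X ⁻¹' U ∩ ⋂ j ∈ Finset.range n, Y j ⁻¹' T j)
        = ∫⁻ s in U, ∏ j ∈ Finset.range n, κ s (T j) ∂P) :
    Pr.map (fun ω => (X ω, fun j => Y j ω)) = P ⊗ₘ seqKernel κ := by
  have hm : Measurable fun ω => (X ω, fun j => Y j ω) := hX.prodMk (measurable_pi_lambda _ hY)
  have : IsProbabilityMeasure (Pr.map fun ω => (X ω, fun j => Y j ω)) :=
    Measure.isProbabilityMeasure_map hm.aemeasurable
  refine ext_of_generate_finite (image2 (· ×ˢ ·) {s : Set α | MeasurableSet s}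
    (squareCylinders fun _ : ℕ => {s : Set β | MeasurableSet s})) ?_
    (MeasurableSpace.isPiSystem_measurableSet.prod isPiSystem_cylinders) ?_ (by simp)
  · refine (generateFrom_eq_prod MeasurableSpace.generateFrom_measurableSet
      generateFrom_squareCylinders isCountablySpanning_measurableSet
      ⟨fun _ => univ, fun _ => ⟨∅, fun _ => univ, fun _ _ => MeasurableSet.univ, ?_⟩,
        iUnion_const _⟩).symm
    simp
  · rintro _ ⟨U, hU, _, ⟨s, t, ht, rfl⟩, rfl⟩
    have ht' : ∀ i, MeasurableSet (t i) := fun i => ht i (mem_univ i)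
    have hms : MeasurableSet ((s : Set ℕ).pi t) :=
      MeasurableSet.pi s.countable_toSet fun i _ => ht' i
    rw [Measure.map_apply hm (hU.prod hms), Measure.compProd_apply_prod hU hms]
    classical
    obtain ⟨n, hn⟩ := s.exists_nat_subset_range
    -- The given law covers initial segments of indices only, so the box is padded with `univ`,
    -- which contributes factors `1`.
    set T : ℕ → Set β := fun j => if j ∈ s then t j else univ with hT
    have hTm : ∀ j, MeasurableSet (T j) := fun j => by
      simp only [hT]; split_ifs
      exacts [ht' j, MeasurableSet.univ]
    have e1 : (fun ω => (X ω, fun j => Y j ω)) ⁻¹' (U ×ˢ (s : Set ℕ).pi t)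
        = X ⁻¹' U ∩ ⋂ j ∈ Finset.range n, Y j ⁻¹' T j := by
      ext ω
      simp only [mem_preimage, mem_prod, Set.mem_pi, mem_inter_iff, mem_iInter, hT]
      refine and_congr_right fun _ => ⟨fun h j _ => ?_, fun h j hj => ?_⟩
      · split_ifs with hj
        · exact h j hj
        · exact mem_univ _
      · have := h j (hn hj)
        rwa [if_pos (Finset.mem_coe.1 hj)] at this
    rw [e1, h n U hU T hTm]
    refine lintegral_congr fun a => ?_
    rw [seqKernel_apply, Measure.infinitePi_pi _ fun i _ => ht' i]
    rw [← Finset.prod_subset hn (f := fun j => κ a (T j))]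
    · exact Finset.prod_congr rfl fun j hj => by simp [hT, hj]
    · intro j _ hj
      simp [hT, hj]

end Blocks

/-! ### Optimality gap and constraint violation of the primal output. -/

section PrimalLoop

variable {E F C Ω Z : Type*} [NormedAddCommGroup E] [NormedSpace ℝ E] [FiniteDimensional ℝ E]
  [MeasurableSpace E] [BorelSpace E]
  [NormedAddCommGroup F] [InnerProductSpace ℝ F] [FiniteDimensional ℝ F]
  [MeasurableSpace F] [BorelSpace F] [MeasurableSpace C]
  [mΩ : MeasurableSpace Ω] [mZ : MeasurableSpace Z] {Pr : Measure Ω} [IsProbabilityMeasure Pr]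
  {Q : Measure Z} [IsProbabilityMeasure Q]

theorem integrable_continuousOn_comp {X : Set E} (hX : IsCompact X) {f : E → ℝ}
    (hf : ContinuousOn f X) {x : Ω → E} (hx : Measurable x) (hxX : ∀ ω, x ω ∈ X) :
    Integrable (fun ω => f (x ω)) Pr := by
  obtain ⟨M, hM⟩ := hX.exists_bound_of_continuousOn hf
  exact (integrable_const M).mono' (measurable_continuousOn_comp hf hx hxX).aestronglyMeasurable
    (ae_of_all _ fun ω => hM _ (hxX ω))

namespace Stage

/-- The expected optimality gap of the averaged primal output of a stochastic loop. -/
theorem IsRegular.stochastic_primal_gap {S : Stage E F C} (hS : S.IsRegular)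
    {A : E →L[ℝ] F} {r : F} {c : C} {η : ℕ → ℝ} {Ce : ℝ} (hCe0 : 0 < Ce)
    (hCe : 4 * ‖A‖ ^ 2 ≤ S.α * S.μ * Ce) (hη : ∀ k : ℕ, ((k : ℝ) + 1) * η (k + 1) = Ce)
    {s : ℕ → Ω → Z} (hs : IsIID s Pr Q) {v : E → ℝ} {L D : ℝ}
    (hv : ∀ x ∈ S.X, ∀ x' ∈ S.X, |v x - v x'| ≤ L * ‖x - x'‖) (hvc : ConvexOn ℝ S.X v)
    (hD : ∀ x ∈ S.X, ∀ x' ∈ S.X, ‖x - x'‖ ≤ D)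
    {G : E → Z → (E →L[ℝ] ℝ)} {Γ e : ℝ} (hG : IsOracle S Q v G Γ e)
    {xs : E} (hxs : xs ∈ S.feasible A r) {n : ℕ} (hn : 0 < n) :
    Integrable (fun ω => S.h (weightedAverage n fun k =>
        (S.iterate A r c η (fun k x => G x (s k ω)) k).1) c
      + v (weightedAverage n fun k => (S.iterate A r c η (fun k x => G x (s k ω)) k).1)
      - (S.h xs c + v xs)) Pr ∧
    ∫ ω, (S.h (weightedAverage n fun k =>
        (S.iterate A r c η (fun k x => G x (s k ω)) k).1) c
      + v (weightedAverage n fun k => (S.iterate A r c η (fun k x => G x (s k ω)) k).1)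
      - (S.h xs c + v xs)) ∂Pr
      ≤ (Ce / 2 * ‖S.y₀‖ ^ 2 + n * S.noise L D Γ) / (n * (n + 1) / 2) + e := by
  have : CompleteSpace F := FiniteDimensional.complete ℝ F
  have hηpos := step_pos hCe0 hη
  obtain ⟨h2, h3⟩ := hS.oracle_sum A r c hηpos hs hv hD hG hxs.1 n
  have hn' : (0 : ℝ) < n := Nat.cast_pos.2 hn
  set W : ℝ := (n : ℝ) * (n + 1) / 2 with hW
  have hW0 : 0 < W := by positivity
  set xb : Ω → E := fun ω =>
    weightedAverage n fun k => (S.iterate A r c η (fun k x => G x (s k ω)) k).1 with hxb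
  have hxbX : ∀ ω, xb ω ∈ S.X := fun ω =>
    weightedAverage_mem hS.convex hn fun k => hS.iterate_mem _ _ _ _ _ (k + 1)
  have hxbm : Measurable xb := measurable_weightedAverage
    (fun k => (hS.measurable_iid_iterate A r c hηpos hs hG.measurable k).fst) measurable_const
  have hfc : ContinuousOn (fun x => S.h x c + v x) S.X :=
    (hS.h_continuousOn c).add (continuousOn_of_norm_le hv)
  have hint : Integrable (fun ω => S.h (xb ω) c + v (xb ω) - (S.h xs c + v xs)) Pr :=
    (integrable_continuousOn_comp hS.isCompact hfc hxbm hxbX).sub (integrable_const _)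
  refine ⟨hint, ?_⟩
  have h4 : ∀ ω, (S.h (xb ω) c + v (xb ω) - (S.h xs c + v xs)) * W
      ≤ Ce / 2 * ‖S.y₀‖ ^ 2 + ∑ k ∈ Finset.range n,
      (S.noise L D ‖G (S.iterate A r c η (fun k x => G x (s k ω)) k).1 (s k ω)‖
        + ((k : ℝ) + 1) * subgradError v
          (G (S.iterate A r c η (fun k x => G x (s k ω)) k).1 (s k ω))
          (S.iterate A r c η (fun k x => G x (s k ω)) k).1 xs) := fun ω => by
    -- The dual test point `0` reduces the Lagrangian at the iterates to the objective, while at the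
    -- feasible `xs` the Lagrangian never exceeds the objective.
    have h5 := hS.sum_gap_le r c hCe0 hCe hη (fun k x => G x (s k ω)) hv hD hxs.1
      S.zero_mem_dualCone n
    rw [zero_sub, norm_neg] at h5
    have h6 := mul_convex_weightedAverage_le ((hS.convexOn_h c).add hvc) hn
      (z := fun k => (S.iterate A r c η (fun k x => G x (s k ω)) k).1)
      fun k => hS.iterate_mem _ _ _ _ _ (k + 1)
    have h7 : ∑ k ∈ Finset.range n, ((k : ℝ) + 1) *
        (S.h (S.iterate A r c η (fun k x => G x (s k ω)) (k + 1)).1 c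
          + v (S.iterate A r c η (fun k x => G x (s k ω)) (k + 1)).1 - (S.h xs c + v xs))
        ≤ ∑ k ∈ Finset.range n, ((k : ℝ) + 1) *
        (S.lagrangian A r c v (S.iterate A r c η (fun k x => G x (s k ω)) (k + 1)).1 0
          - S.lagrangian A r c v xs
            (S.iterate A r c η (fun k x => G x (s k ω)) (k + 1)).2.1) := by
      refine Finset.sum_le_sum fun k _ => mul_le_mul_of_nonneg_left ?_ (by positivity)
      have h8 := lagrangian_le_of_feasible c v hxs
        (hS.iterate_dual_mem A r c hηpos (fun k x => G x (s k ω)) (k + 1))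
      have h9 : ∀ x, S.lagrangian A r c v x 0 = S.h x c + v x := fun x => by
        simp [lagrangian]
      rw [h9]
      linarith
    simp only [mul_sub, Finset.sum_sub_distrib] at h7
    rw [← Finset.sum_mul, sum_range_succ_cast] at h7
    have h10 : 0 ≤ Ce / 2 * ‖(S.iterate A r c η (fun k x => G x (s k ω)) n).2.1‖ ^ 2 := by
      positivity
    simp only [zero_sub, norm_neg, Pi.add_apply, mul_sub, Finset.sum_sub_distrib] at h5 h6
    rw [sub_mul, mul_comm _ W, mul_comm _ W, hW]
    linarith
  have h6 := integral_mono (hint.mul_const W) ((integrable_const _).add h2) h4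
  simp only [Pi.add_apply] at h6
  rw [integral_add (integrable_const _) h2, integral_mul_const, integral_const, probReal_univ,
    one_smul] at h6
  rw [div_add' _ _ _ hW0.ne', le_div_iff₀ hW0]
  linarith

/-- The expected constraint violation of the averaged primal output of a stochastic loop. -/
theorem IsRegular.stochastic_residual {S : Stage E F C} (hS : S.IsRegular)
    {A : E →L[ℝ] F} {r : F} {c : C} {η : ℕ → ℝ} {Ce : ℝ} (hCe0 : 0 < Ce)
    (hCe : 4 * ‖A‖ ^ 2 ≤ S.α * S.μ * Ce) (hη : ∀ k : ℕ, ((k : ℝ) + 1) * η (k + 1) = Ce)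
    {s : ℕ → Ω → Z} (hs : IsIID s Pr Q) {v : E → ℝ} {L D : ℝ}
    (hv : ∀ x ∈ S.X, ∀ x' ∈ S.X, |v x - v x'| ≤ L * ‖x - x'‖)
    (hD : ∀ x ∈ S.X, ∀ x' ∈ S.X, ‖x - x'‖ ≤ D)
    {G : E → Z → (E →L[ℝ] ℝ)} {Γ e : ℝ} (hG : IsOracle S Q v G Γ e)
    {ys : F} (hys : S.IsMultiplier A r c v ys) {n : ℕ} (hn : 0 < n) :
    ∃ δ : Ω → F, Integrable δ Pr ∧
      (∀ ω, A (weightedAverage n fun k =>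
        (S.iterate A r c η (fun k x => G x (s k ω)) k).1) - r - δ ω ∈ S.K) ∧
      ∫ ω, ‖δ ω‖ ∂Pr ≤ Ce / (n * (n + 1) / 2) * (‖ys - S.y₀‖
        + √(‖ys - S.y₀‖ ^ 2 + 2 / Ce * (n * S.noise L D Γ + n * (n + 1) / 2 * e))) := by
  have : CompleteSpace F := FiniteDimensional.complete ℝ F
  have : ProperSpace F := FiniteDimensional.proper_real _
  have hηpos := step_pos hCe0 hη
  obtain ⟨h1, h2⟩ := hS.stochastic_dual_dist hCe0 hCe hη hs hv hD hG hys n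
  have hn' : (0 : ℝ) < n := Nat.cast_pos.2 hn
  have hm := (hS.measurable_iid_iterate A r c hηpos hs hG.measurable n).snd.fst
  set y : Ω → F := fun ω => (S.iterate A r c η (fun k x => G x (s k ω)) n).2.1 with hy
  have hdm : AEStronglyMeasurable (fun ω => ys - y ω) Pr := (hm.const_sub ys).aestronglyMeasurable
  have h3 := integral_norm_le_sqrt hdm h1 h2
  have h4 : Integrable (fun ω => ys - y ω) Pr := integrable_of_sq hdm h1
  have h5 : Integrable (fun ω => S.y₀ - y ω) Pr := by
    have := (integrable_const (S.y₀ - ys)).add h4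
    refine this.congr (ae_of_all _ fun ω => ?_)
    simp
  set c' : ℝ := Ce / (n * (n + 1) / 2) with hc'
  have hc0 : 0 < c' := by positivity
  refine ⟨fun ω => c' • (S.y₀ - y ω), h5.smul c', fun ω =>
    S.residual_mem_K A r c hCe0 hη (fun k x => G x (s k ω)) hn, ?_⟩
  simp_rw [norm_smul, Real.norm_of_nonneg hc0.le]
  rw [integral_const_mul]
  refine mul_le_mul_of_nonneg_left ?_ hc0.le
  -- The violation is proportional to `y₀ - y_n`; through the multiplier it reduces to the dual
  -- distance, bounded in mean square.
  have h6 : ∀ ω, ‖S.y₀ - y ω‖ ≤ ‖ys - S.y₀‖ + ‖ys - y ω‖ := fun ω => by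
    have : S.y₀ - y ω = -(ys - S.y₀) + (ys - y ω) := by abel
    rw [this]
    exact (norm_add_le _ _).trans_eq (by rw [norm_neg])
  refine (integral_mono h5.norm ((integrable_const _).add h4.norm) h6).trans ?_
  simp only [Pi.add_apply]
  rw [integral_add (integrable_const _) h4.norm, integral_const, probReal_univ, one_smul]
  exact add_le_add_right h3 _

end Stage

end PrimalLoop

theorem integrable_integral_compProd {α β : Type*} [MeasurableSpace α] [MeasurableSpace β]
    {P : Measure α} [SFinite P] {κ : Kernel α β} [IsSFiniteKernel κ] {f : α × β → ℝ}
    (hf : Integrable f (P ⊗ₘ κ)) : Integrable (fun a => ∫ b, f (a, b) ∂(κ a)) P := by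
  have h : Integrable f ((Kernel.const Unit P ⊗ₖ Kernel.prodMkLeft Unit κ) ()) := hf
  simpa using h.integral_compProd

/-! ### The middle loop as an oracle for `v²`. -/

section Problem

variable {E₁ E₂ E₃ F₁ F₂ F₃ C₁ C₂ C₃ : Type*}
  [NormedAddCommGroup E₁] [NormedSpace ℝ E₁] [FiniteDimensional ℝ E₁]
  [MeasurableSpace E₁] [BorelSpace E₁]
  [NormedAddCommGroup E₂] [NormedSpace ℝ E₂] [FiniteDimensional ℝ E₂]
  [MeasurableSpace E₂] [BorelSpace E₂]
  [NormedAddCommGroup E₃] [NormedSpace ℝ E₃] [FiniteDimensional ℝ E₃]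
  [NormedAddCommGroup F₁] [InnerProductSpace ℝ F₁] [FiniteDimensional ℝ F₁]
  [NormedAddCommGroup F₂] [InnerProductSpace ℝ F₂] [FiniteDimensional ℝ F₂]
  [MeasurableSpace F₂] [BorelSpace F₂]
  [NormedAddCommGroup F₃] [InnerProductSpace ℝ F₃] [FiniteDimensional ℝ F₃]
  [MeasurableSpace F₃] [BorelSpace F₃]
  [MeasurableSpace C₁] [MeasurableSpace C₂] [MeasurableSpace C₃]


namespace Problem

variable {D : Problem E₁ E₂ E₃ F₁ F₂ F₃ C₁ C₂ C₃} {m : Multipliers E₁ E₂ E₃ F₁ F₂ F₃ C₂ C₃}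

variable {β₂ β₃ a a' R : ℝ}

theorem _root_.DSA.Multipliers.IsOptimal.ae_good₂ (hm : m.IsOptimal D R)
    (hv₃ : ∀ᵐ ξ₂ ∂D.P₂, ∀ u ∈ D.S₂.X, Integrable (D.V₃ u) (D.κ ξ₂))
    (hB₂ : ∀ᵐ ξ₂ ∂D.P₂, ‖ξ₂.B‖ ≤ β₂)
    (hB₃ : ∀ᵐ ξ₂ ∂D.P₂, ∀ᵐ ξ₃ ∂(D.κ ξ₂), ‖ξ₃.B‖ ≤ β₃)
    (hA₂ : ∀ᵐ ξ₂ ∂D.P₂, a ≤ ‖ξ₂.A‖ ∧ ‖ξ₂.A‖ ≤ a')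
    (hA₃ : ∀ᵐ ξ₂ ∂D.P₂, ∀ᵐ ξ₃ ∂(D.κ ξ₂), ξ₃.A ≠ 0) :
    ∀ᵐ ξ ∂D.P₂, Good₂ D m β₂ β₃ a a' R ξ := by
  filter_upwards [hv₃, hB₂, hB₃, hA₂, hA₃, hm.optimal₂, hm.optimal₃] with ξ h1 h2 h3 h4 h5 h6 h7
  refine ⟨h4.1, h4.2, h2, fun u hu => (h6 u hu).1, fun u hu => (h6 u hu).2, h1, ?_⟩
  filter_upwards [h3, h5, h7] with ξ₃ g1 g2 g3
  exact ⟨g2, g1, fun u hu => (g3 u hu).1, fun u hu => (g3 u hu).2⟩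

theorem abs_v₂_sub_le [IsProbabilityMeasure D.P₂]
    (hv₂ : ∀ u ∈ D.S₁.X, Integrable (D.V₂ u) D.P₂)
    (h : ∀ᵐ ξ ∂D.P₂, Good₂ D m β₂ β₃ a a' R ξ) {u u' : E₁} (hu : u ∈ D.S₁.X)
    (hu' : u' ∈ D.S₁.X) : |D.v₂ u - D.v₂ u'| ≤ β₂ * R * ‖u - u'‖ := by
  rw [v₂, v₂, ← integral_sub (hv₂ u hu) (hv₂ u' hu')]
  have h1 : ∀ᵐ ξ ∂D.P₂, ‖D.V₂ u ξ - D.V₂ u' ξ‖ ≤ β₂ * R * ‖u - u'‖ := by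
    filter_upwards [h] with ξ hξ
    exact hξ.V₂_lipschitz hu hu'
  have h2 := norm_integral_le_of_norm_le_const h1
  rwa [probReal_univ, mul_one] at h2

/-- The multipliers provide a supporting functional at each point, so no joint convexity argument is
required. -/
theorem Good₂.convexOn_V₂ {ξ : Scenario E₁ E₂ F₂ C₂} (h : Good₂ D m β₂ β₃ a a' R ξ)
    (hX : Convex ℝ D.S₁.X) : ConvexOn ℝ D.S₁.X fun u => D.V₂ u ξ := by
  refine convexOn_of_subgradient hX fun u hu => ⟨ξ.adj (m.y₂ u ξ), fun u' hu' => ?_⟩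
  have h1 := (h.multiplier u hu).value_sub_le (h.multiplier u' hu')
  have h2 : ξ.adj (m.y₂ u ξ) (u' - u) = -ξ.adj (m.y₂ u ξ) (u - u') := by
    rw [← map_neg, neg_sub]
  rw [h2, V₂, V₂]
  linarith

theorem convexOn_v₂ (hX : Convex ℝ D.S₁.X)
    (hv₂ : ∀ u ∈ D.S₁.X, Integrable (D.V₂ u) D.P₂)
    (h : ∀ᵐ ξ ∂D.P₂, Good₂ D m β₂ β₃ a a' R ξ) : ConvexOn ℝ D.S₁.X D.v₂ := by
  refine ⟨hX, fun u hu u' hu' s t hs ht hst => ?_⟩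
  have hw := hX hu hu' hs ht hst
  rw [v₂, v₂, v₂, smul_eq_mul, smul_eq_mul, ← integral_const_mul, ← integral_const_mul,
    ← integral_add ((hv₂ u hu).const_mul s) ((hv₂ u' hu').const_mul t)]
  refine integral_mono_ae (hv₂ _ hw) (((hv₂ u hu).const_mul s).add ((hv₂ u' hu').const_mul t)) ?_
  filter_upwards [h] with ξ hξ
  exact (hξ.convexOn_V₂ hX).2 hu hu' hs ht hst

variable [IsMarkovKernel D.κ]

/-- The law of a block of samples, consisting of a sample of `ξ²` and of conditionally independent
samples of `ξ³`. -/
def blockLaw (D : Problem E₁ E₂ E₃ F₁ F₂ F₃ C₁ C₂ C₃) [IsMarkovKernel D.κ] :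
    Measure (Scenario E₁ E₂ F₂ C₂ × (ℕ → Scenario E₂ E₃ F₃ C₃)) :=
  D.P₂ ⊗ₘ seqKernel D.κ

variable [IsProbabilityMeasure D.P₂]

instance : IsProbabilityMeasure D.blockLaw := by unfold blockLaw; infer_instance

section Sampling

variable {Ω : Type*} [MeasurableSpace Ω] {Pr : Measure Ω} [IsProbabilityMeasure Pr]
  {ξ₂ : ℕ → Ω → Scenario E₁ E₂ F₂ C₂} {ξ₃ : ℕ → ℕ → Ω → Scenario E₂ E₃ F₃ C₃}

theorem IsSampling.isIID (h : D.IsSampling Pr ξ₂ ξ₃) :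
    IsIID (fun i ω => (ξ₂ i ω, fun j => ξ₃ i j ω)) Pr D.blockLaw where
  measurable i := (h.measurable₂ i).prodMk (measurable_pi_lambda _ (h.measurable₃ i))
  indep := h.indep
  law i := map_block_eq (h.measurable₂ i) (h.measurable₃ i) (h.law i)

end Sampling

theorem ae_blockLaw_fst {p : Scenario E₁ E₂ F₂ C₂ → Prop} (h : ∀ᵐ ξ ∂D.P₂, p ξ) :
    ∀ᵐ z ∂D.blockLaw, p z.1 := by
  have h1 : D.blockLaw.map Prod.fst = D.P₂ := Measure.fst_compProd _ _
  rw [← h1] at h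
  exact ae_of_ae_map measurable_fst.aemeasurable h

theorem ae_blockLaw_ne (ha : 0 < a) (h : ∀ᵐ ξ ∂D.P₂, Good₂ D m β₂ β₃ a a' R ξ) :
    ∀ᵐ z ∂D.blockLaw, z.1.A ≠ 0 ∧ ∀ j, (z.2 j).A ≠ 0 := by
  refine (ae_blockLaw_fst (h.mono fun ξ hξ => hξ.A_ne ha)).and ?_
  refine Measure.ae_compProd_of_ae_ae ?_ ?_
  · simp only [Set.ofPred_forall]
    refine MeasurableSet.iInter fun j => ?_
    have hj : Measurable fun z : Scenario E₁ E₂ F₂ C₂ × (ℕ → Scenario E₂ E₃ F₃ C₃) => (z.2 j).A :=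
      Scenario.measurable_A.comp ((measurable_pi_apply j).comp measurable_snd)
    exact hj (measurableSet_singleton 0).compl
  · filter_upwards [h] with ξ hξ
    rw [ae_all_iff]
    intro j
    have h2 : ∀ᵐ ξ₃ ∂((Measure.infinitePi fun _ : ℕ => D.κ ξ).map fun s => s j),
        Scenario.A ξ₃ ≠ 0 := by
      have h3 : (Measure.infinitePi fun _ : ℕ => D.κ ξ).map (fun s => s j) = D.κ ξ :=
        Measure.infinitePi_map_eval _ j
      rw [h3]
      exact hξ.good₃.mono fun ξ₃ h₃ => h₃.A_ne
    exact ae_of_ae_map (measurable_pi_apply j).aemeasurable h2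

theorem measurable_block_G₂Reg (hS₂ : D.S₂.IsRegular) (hS₃ : D.S₃.IsRegular)
    (hm : m.IsOptimal D R) (M₃ ε : ℝ) (u : E₁) :
    Measurable fun z : Scenario E₁ E₂ F₂ C₂ × (ℕ → Scenario E₂ E₃ F₃ C₃) =>
      D.G₂Reg m M₃ ε u z.1 z.2 := by
  have h1 := (measurable_G₂Reg (D := D) hS₂ hS₃ hm.measurable₂ hm.measurable₃ M₃ ε).comp
    (measurable_const (a := u).prodMk measurable_id)
  exact h1

theorem measurable_block_G₃Reg (hS₂ : D.S₂.IsRegular) (hS₃ : D.S₃.IsRegular)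
    (hm : m.IsOptimal D R) (M₃ ε : ℝ) (j : ℕ) :
    Measurable fun p : E₁ × Scenario E₁ E₂ F₂ C₂ × (ℕ → Scenario E₂ E₃ F₃ C₃) =>
      D.G₃Reg m ε (D.iter₂Reg m M₃ ε p.1 p.2.1 p.2.2 j).1 (p.2.2 j) := by
  have h1 := (measurable_iter₂Reg (D := D) hS₂ hS₃ hm.measurable₂ hm.measurable₃ M₃ ε j).fst
  have h2 : Measurable fun p : E₁ × Scenario E₁ E₂ F₂ C₂ × (ℕ → Scenario E₂ E₃ F₃ C₃) =>
      p.2.2 j := (measurable_pi_apply j).comp measurable_snd.snd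
  have h3 := (measurable_G₃Reg (D := D) hS₃ hm.measurable₃ ε).comp (h1.prodMk h2)
  exact h3

theorem lintegral_G₂Reg_le (hS₂ : D.S₂.IsRegular) (hS₃ : D.S₃.IsRegular)
    (hm : m.IsOptimal D R) (h : ∀ᵐ ξ ∂D.P₂, Good₂ D m β₂ β₃ a a' R ξ) (ha : 0 < a) {diam : ℝ}
    (hD : ∀ x ∈ D.S₂.X, ∀ x' ∈ D.S₂.X, ‖x - x'‖ ≤ diam) {ε M₃ : ℝ} (hε : 0 < ε)
    (hM : D.S₂.α * D.S₂.μ * D.S₂.noise (β₃ * R) diam (D.gradBound₃ β₃ R) ≤ M₃ ^ 2)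
    {u : E₁} (hu : u ∈ D.S₁.X) :
    ∫⁻ z, ‖D.G₂Reg m M₃ ε u z.1 z.2‖ₑ ^ 2 ∂D.blockLaw
      ≤ ENNReal.ofReal (√(D.momentBound₂ β₂ β₃ a a' R diam M₃) ^ 2) := by
  have : ProperSpace E₁ := FiniteDimensional.proper_real _
  -- An oracle is stated with a squared bound `Γ ^ 2`; this direction holds whatever the sign of the
  -- constant.
  have h0 : D.momentBound₂ β₂ β₃ a a' R diam M₃
      ≤ √(D.momentBound₂ β₂ β₃ a a' R diam M₃) ^ 2 := by
    rcases le_total 0 (D.momentBound₂ β₂ β₃ a a' R diam M₃) with h1 | h1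
    · exact (Real.sq_sqrt h1).ge
    · exact h1.trans (sq_nonneg _)
  have h1 : Measurable fun z : Scenario E₁ E₂ F₂ C₂ × (ℕ → Scenario E₂ E₃ F₃ C₃) =>
      ‖D.G₂Reg m M₃ ε u z.1 z.2‖ₑ ^ 2 :=
    (measurable_block_G₂Reg hS₂ hS₃ hm M₃ ε u).enorm.pow_const 2
  refine le_trans ?_ (ENNReal.ofReal_le_ofReal h0)
  rw [blockLaw, Measure.lintegral_compProd h1]
  refine (lintegral_mono_ae (g := fun _ =>
    ENNReal.ofReal (D.momentBound₂ β₂ β₃ a a' R diam M₃)) ?_).trans (by simp)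
  filter_upwards [h] with ξ hξ
  exact (hξ.middle hS₂ hS₃ hm.measurable₂ hm.measurable₃ ha hD hε hM hu).2.1

theorem lintegral_G₃Reg_le (hS₂ : D.S₂.IsRegular) (hS₃ : D.S₃.IsRegular)
    (hm : m.IsOptimal D R) (h : ∀ᵐ ξ ∂D.P₂, Good₂ D m β₂ β₃ a a' R ξ) (ha : 0 < a) {diam : ℝ}
    (hD : ∀ x ∈ D.S₂.X, ∀ x' ∈ D.S₂.X, ‖x - x'‖ ≤ diam) {ε M₃ : ℝ} (hε : 0 < ε)
    (hM : D.S₂.α * D.S₂.μ * D.S₂.noise (β₃ * R) diam (D.gradBound₃ β₃ R) ≤ M₃ ^ 2)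
    {u : E₁} (hu : u ∈ D.S₁.X) (j : ℕ) :
    ∫⁻ z, ‖D.G₃Reg m ε (D.iter₂Reg m M₃ ε u z.1 z.2 j).1 (z.2 j)‖ₑ ^ 2 ∂D.blockLaw
      ≤ ENNReal.ofReal (D.gradBound₃ β₃ R ^ 2) := by
  have : ProperSpace E₂ := FiniteDimensional.proper_real _
  have h0 := measurable_block_G₃Reg hS₂ hS₃ hm M₃ ε j
  have h1 : Measurable fun z : Scenario E₁ E₂ F₂ C₂ × (ℕ → Scenario E₂ E₃ F₃ C₃) =>
      ‖D.G₃Reg m ε (D.iter₂Reg m M₃ ε u z.1 z.2 j).1 (z.2 j)‖ₑ ^ 2 :=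
    (h0.comp (measurable_const (a := u).prodMk measurable_id)).enorm.pow_const 2
  rw [blockLaw, Measure.lintegral_compProd h1]
  refine (lintegral_mono_ae (g := fun _ =>
    ENNReal.ofReal (D.gradBound₃ β₃ R ^ 2)) ?_).trans (by simp)
  filter_upwards [h] with ξ hξ
  exact (hξ.middle hS₂ hS₃ hm.measurable₂ hm.measurable₃ ha hD hε hM hu).2.2 j

/-- The estimates for a fixed good `ξ²` are integrated over its law. The bias is `ε / 3` and the
moment bound does not depend on `ε`. -/
theorem oracle₂ (hS₂ : D.S₂.IsRegular) (hS₃ : D.S₃.IsRegular)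
    (hm : m.IsOptimal D R) (h : ∀ᵐ ξ ∂D.P₂, Good₂ D m β₂ β₃ a a' R ξ) (ha : 0 < a) {diam : ℝ}
    (hD : ∀ x ∈ D.S₂.X, ∀ x' ∈ D.S₂.X, ‖x - x'‖ ≤ diam) {ε M₃ : ℝ} (hε : 0 < ε)
    (hM : D.S₂.α * D.S₂.μ * D.S₂.noise (β₃ * R) diam (D.gradBound₃ β₃ R) ≤ M₃ ^ 2)
    (hv₂ : ∀ u ∈ D.S₁.X, Integrable (D.V₂ u) D.P₂) :
    IsOracle D.S₁ D.blockLaw D.v₂ (fun u z => D.G₂Reg m M₃ ε u z.1 z.2)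
      (√(D.momentBound₂ β₂ β₃ a a' R diam M₃)) (ε / 3) where
  measurable := measurable_G₂Reg hS₂ hS₃ hm.measurable₂ hm.measurable₃ M₃ ε
  moment u hu := lintegral_G₂Reg_le hS₂ hS₃ hm h ha hD hε hM hu
  bias u hu x hx := by
    have : ProperSpace E₁ := FiniteDimensional.proper_real _
    have hGm := measurable_block_G₂Reg (D := D) hS₂ hS₃ hm M₃ ε u
    have hG1 := integrable_of_sq hGm.aestronglyMeasurable (integrable_sq_of_lintegral_le
      hGm.aestronglyMeasurable (sq_nonneg _)
      (lintegral_G₂Reg_le hS₂ hS₃ hm h ha hD hε hM hu)).1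
    have hG2 : Integrable (fun z : Scenario E₁ E₂ F₂ C₂ × (ℕ → Scenario E₂ E₃ F₃ C₃) =>
        D.G₂Reg m M₃ ε u z.1 z.2 (u - x)) D.blockLaw :=
      (hG1.norm.mul_const ‖u - x‖).mono'
        (measurable_clm_apply hGm measurable_const).aestronglyMeasurable
        (ae_of_all _ fun z => (D.G₂Reg m M₃ ε u z.1 z.2).le_opNorm _)
    rw [blockLaw] at hG2 ⊢
    have hG3 : Integrable (fun ξ => ∫ s, D.G₂Reg m M₃ ε u ξ s (u - x) ∂(seqKernel D.κ ξ)) D.P₂ :=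
      integrable_integral_compProd hG2
    have hi := (hv₂ u hu).sub (hv₂ x hx)
    rw [Measure.integral_compProd hG2, v₂, v₂, ← integral_sub (hv₂ u hu) (hv₂ x hx)]
    refine (integral_sub hi hG3).symm.trans_le ?_
    refine (integral_mono_ae (hi.sub hG3) (integrable_const (ε / 3)) ?_).trans (by simp)
    filter_upwards [h] with ξ hξ
    exact (hξ.middle hS₂ hS₃ hm.measurable₂ hm.measurable₃ ha hD hε hM hu).1 x hx

end Problem

end Problem

/-! ### Arithmetic of the outer iteration limit. -/

section Arithmetic

/-- The two summands of the limit give `48 A² y² ≤ N² q ε` and `144 M² ≤ N q ε`, so the loop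
contributes at most `2 ε / 3`. -/
theorem outer_gap_arith {A y q N M nz ε : ℝ} (hA : 0 ≤ A) (hy : 0 ≤ y) (hq : 0 < q) (hN1 : 1 ≤ N)
    (hε : 0 < ε) (hnz : q * nz ≤ M ^ 2)
    (hN : 4 * √3 * A * y / √(q * ε) + 4 * (6 * M) ^ 2 / (q * ε) ≤ N) :
    ((4 * A ^ 2 * (1 : ℕ) / q) / 2 * y ^ 2 + N * nz) / (N * (N + 1) / 2) + ε / 3 ≤ ε := by
  have hN0 : 0 < N := by linarith
  have hqε : 0 < q * ε := mul_pos hq hε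
  have h1 : 4 * √3 * A * y / √(q * ε) ≤ N :=
    (le_add_of_nonneg_right (by positivity)).trans hN
  have h2 : 4 * (6 * M) ^ 2 / (q * ε) ≤ N := (le_add_of_nonneg_left (by positivity)).trans hN
  have h3 := pow_le_pow_left₀ (by positivity) h1 2
  rw [div_pow, Real.sq_sqrt hqε.le, div_le_iff₀ hqε, mul_pow, mul_pow, mul_pow,
    Real.sq_sqrt (by norm_num)] at h3
  rw [div_le_iff₀ hqε] at h2
  have h4 : ((4 * A ^ 2 * (1 : ℕ) / q) / 2 * y ^ 2 + N * nz) / (N * (N + 1) / 2)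
      ≤ 2 * ε / 3 := by
    rw [div_le_iff₀ (by positivity)]
    refine le_of_mul_le_mul_left (a := q) ?_ hq
    have e1 : q * ((4 * A ^ 2 * (1 : ℕ) / q) / 2 * y ^ 2 + N * nz)
        = 2 * A ^ 2 * y ^ 2 + N * (q * nz) := by
      push_cast
      field_simp
      ring
    rw [e1]
    have h5 := mul_le_mul_of_nonneg_left hnz hN0.le
    have h6 := mul_le_mul_of_nonneg_left h2 hN0.le
    have h7 : 0 < N * (q * ε) := by positivity
    nlinarith
  linarith

/-- The noise enters as `√N M / A` and is compared with `N² q ε / A²`, so `N ^ (3 / 2)` must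
dominate `A M / (q ε)`; this is the origin of the exponent `2 / 3`. -/
theorem outer_residual_arith {A d q N M nz ε : ℝ} (hA : 0 < A) (hd : 0 ≤ d) (hq : 0 < q)
    (hN1 : 1 ≤ N) (hM : 0 ≤ M) (hε : 0 < ε) (hnz : q * nz ≤ M ^ 2)
    (hN : 4 * √3 * A * (√d + √2) / √(q * ε)
      + (24 * √6 * A * M / (q * ε)) ^ (2 / 3 : ℝ) ≤ N) :
    (4 * A ^ 2 * (1 : ℕ) / q) / (N * (N + 1) / 2) * (d
      + √(d ^ 2 + 2 / (4 * A ^ 2 * (1 : ℕ) / q) * (N * nz + N * (N + 1) / 2 * (ε / 3)))) ≤ ε := by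
  have hN0 : 0 < N := by linarith
  have hqε : 0 < q * ε := mul_pos hq hε
  have h1 : 4 * √3 * A * (√d + √2) / √(q * ε) ≤ N :=
    (le_add_of_nonneg_right (by positivity)).trans hN
  have h2 : (24 * √6 * A * M / (q * ε)) ^ (2 / 3 : ℝ) ≤ N :=
    (le_add_of_nonneg_left (by positivity)).trans hN
  have h3 := pow_le_pow_left₀ (by positivity) h1 2
  rw [div_pow, Real.sq_sqrt hqε.le, div_le_iff₀ hqε, mul_pow, mul_pow, mul_pow,
    Real.sq_sqrt (by norm_num)] at h3
  have h4 : 48 * A ^ 2 * (d + 2) ≤ N ^ 2 * (q * ε) := by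
    have h5 : d + 2 ≤ (√d + √2) ^ 2 := by
      rw [add_sq, Real.sq_sqrt hd, Real.sq_sqrt (by norm_num)]
      have : 0 ≤ 2 * √d * √2 := by positivity
      linarith
    have h6 := mul_le_mul_of_nonneg_left h5 (by positivity : 0 ≤ 48 * A ^ 2)
    linarith
  have h5 : 3456 * (A ^ 2 * M ^ 2) ≤ N ^ 3 * (q * ε) ^ 2 := by
    have h6 := pow_le_pow_left₀ (by positivity) h2 3
    rw [← Real.rpow_mul_natCast (by positivity)] at h6
    norm_num at h6
    rw [div_pow, div_le_iff₀ (by positivity), mul_pow, mul_pow, mul_pow,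
      Real.sq_sqrt (by norm_num)] at h6
    linarith
  -- `X` is the value of the bracket at which the bound equals `ε`. The bias contributes `2 / 3 * X`
  -- under the root and the noise at most `2 / 3 * X ^ 2`, so `X ≥ 6 d + 2` would suffice.
  set X : ℝ := N * (N + 1) * (q * ε) / (8 * A ^ 2) with hX
  have h6 : 6 * d + 12 ≤ X := by
    rw [hX, le_div_iff₀ (by positivity)]
    have : 0 < N * (q * ε) := by positivity
    nlinarith
  have e1 : (4 * A ^ 2 * (1 : ℕ) / q) / (N * (N + 1) / 2) * X = ε := by
    rw [hX]
    push_cast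
    field_simp
    ring
  have h7 : d + √(d ^ 2 + 2 / (4 * A ^ 2 * (1 : ℕ) / q)
      * (N * nz + N * (N + 1) / 2 * (ε / 3))) ≤ X := by
    have h8 : √(d ^ 2 + 2 / (4 * A ^ 2 * (1 : ℕ) / q)
      * (N * nz + N * (N + 1) / 2 * (ε / 3))) ≤ X - d := by
      refine Real.sqrt_le_iff.2 ⟨by linarith, ?_⟩
      have e2 : 2 / (4 * A ^ 2 * (1 : ℕ) / q) * (N * nz + N * (N + 1) / 2 * (ε / 3))
          = N * (q * nz) / (2 * A ^ 2) + 2 / 3 * X := by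
        rw [hX]
        push_cast
        field_simp
        ring
      rw [e2]
      have h9 : N * (q * nz) / (2 * A ^ 2) ≤ 2 / 3 * X ^ 2 := by
        have h10 : N * (q * nz) / (2 * A ^ 2) ≤ N * M ^ 2 / (2 * A ^ 2) := by gcongr
        refine h10.trans ?_
        have h11 : N ^ 2 * (q * ε) / (8 * A ^ 2) ≤ X := by
          rw [hX]
          gcongr
          nlinarith
        have h12 := pow_le_pow_left₀ (by positivity) h11 2
        have h13 : N * M ^ 2 / (2 * A ^ 2) ≤ 2 / 3 * (N ^ 2 * (q * ε) / (8 * A ^ 2)) ^ 2 := by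
          rw [div_le_iff₀ (by positivity)]
          have e3 : 2 / 3 * (N ^ 2 * (q * ε) / (8 * A ^ 2)) ^ 2 * (2 * A ^ 2)
              = N * (N ^ 3 * (q * ε) ^ 2) / (48 * A ^ 2) := by
            field_simp
            ring
          rw [e3, le_div_iff₀ (by positivity)]
          have h14 := mul_le_mul_of_nonneg_left h5 hN0.le
          have h15 : 0 ≤ N * (A ^ 2 * M ^ 2) := by positivity
          linarith
        linarith
      have h10 : 0 ≤ X := by linarith
      nlinarith [mul_nonneg h10 (by linarith : 0 ≤ X - 6 * d - 12)]
    linarith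
  calc _ ≤ (4 * A ^ 2 * (1 : ℕ) / q) / (N * (N + 1) / 2) * X :=
        mul_le_mul_of_nonneg_left h7 (by positivity)
    _ = ε := e1

theorem div_sqrt_mul_le {k q ε : ℝ} (hk : 0 ≤ k) (hq : 0 < q) (hε : 0 < ε) (hε1 : ε ≤ 1) :
    k / √(q * ε) ≤ k / √q / ε := by
  rw [Real.sqrt_mul hq.le, div_div]
  have h1 : ε ≤ √ε := Real.le_sqrt_of_sq_le (by nlinarith)
  have h2 : 0 < √q := Real.sqrt_pos.2 hq
  gcongr

theorem rpow_two_thirds_le {x : ℝ} (hx : 0 ≤ x) : x ^ (2 / 3 : ℝ) ≤ 1 + x := by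
  rcases le_total x 1 with h | h
  · exact (Real.rpow_le_one hx h (by norm_num)).trans (by linarith)
  · have := Real.rpow_le_rpow_of_exponent_le h (by norm_num : (2 / 3 : ℝ) ≤ 1)
    rw [Real.rpow_one] at this
    linarith

end Arithmetic

/-! ### Growth of the iteration limits as `ε` tends to zero. -/

section Problem

variable {E₁ E₂ E₃ F₁ F₂ F₃ C₁ C₂ C₃ : Type*}
  [NormedAddCommGroup E₁] [NormedSpace ℝ E₁] [FiniteDimensional ℝ E₁]
  [MeasurableSpace E₁] [BorelSpace E₁]
  [NormedAddCommGroup E₂] [NormedSpace ℝ E₂] [FiniteDimensional ℝ E₂]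
  [MeasurableSpace E₂] [BorelSpace E₂]
  [NormedAddCommGroup E₃] [NormedSpace ℝ E₃] [FiniteDimensional ℝ E₃]
  [NormedAddCommGroup F₁] [InnerProductSpace ℝ F₁] [FiniteDimensional ℝ F₁]
  [NormedAddCommGroup F₂] [InnerProductSpace ℝ F₂] [FiniteDimensional ℝ F₂]
  [MeasurableSpace F₂] [BorelSpace F₂]
  [NormedAddCommGroup F₃] [InnerProductSpace ℝ F₃] [FiniteDimensional ℝ F₃]
  [MeasurableSpace F₃] [BorelSpace F₃]
  [MeasurableSpace C₁] [MeasurableSpace C₂] [MeasurableSpace C₃]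


namespace Problem

variable {D : Problem E₁ E₂ E₃ F₁ F₂ F₃ C₁ C₂ C₃} {m : Multipliers E₁ E₂ E₃ F₁ F₂ F₃ C₂ C₃}

/-- For `ε ≤ 1` the orders `ε ^ (-1/2)` and `ε ^ (-2/3)` are dominated by `1 / ε`, as is the unit
lost by rounding. -/
theorem exists_N₁_le (hS₁ : D.S₁.IsRegular) {M₂ : ℝ} (hM₂ : 0 ≤ M₂) :
    ∃ C : ℝ, 0 ≤ C ∧ ∀ ε : ℝ, 0 < ε → ε ≤ 1 → (D.N₁ m M₂ ε : ℝ) ≤ C / ε := by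
  have hq : 0 < D.S₁.α * D.S₁.μ := mul_pos hS₁.α_pos hS₁.μ_pos
  set q := D.S₁.α * D.S₁.μ with hqdef
  refine ⟨4 * √3 * ‖D.A₁‖ * ‖D.S₁.y₀‖ / √q + 4 * (6 * M₂) ^ 2 / q
    + (4 * √3 * ‖D.A₁‖ * (√‖m.y₁ - D.S₁.y₀‖ + √2) / √q
      + (1 + 24 * √6 * ‖D.A₁‖ * M₂ / q)) + 1, by positivity, fun ε hε hε1 => ?_⟩
  have h1 := div_sqrt_mul_le (k := 4 * √3 * ‖D.A₁‖ * ‖D.S₁.y₀‖) (by positivity) hq hε hε1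
  have h2 := div_sqrt_mul_le (k := 4 * √3 * ‖D.A₁‖ * (√‖m.y₁ - D.S₁.y₀‖ + √2))
    (by positivity) hq hε hε1
  have h3 : (24 * √6 * ‖D.A₁‖ * M₂ / (q * ε)) ^ (2 / 3 : ℝ)
      ≤ 1 / ε + 24 * √6 * ‖D.A₁‖ * M₂ / q / ε := by
    rw [div_div]
    refine (rpow_two_thirds_le (by positivity)).trans (add_le_add_left ?_ _)
    exact (one_le_div hε).2 hε1
  have h4 : 1 ≤ 1 / ε := (one_le_div hε).2 hε1
  have h5 : 4 * (6 * M₂) ^ 2 / (q * ε) = 4 * (6 * M₂) ^ 2 / q / ε := (div_div _ _ _).symm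
  rw [N₁, ← hqdef]
  refine (max_one_ceil_le (le_max_of_le_left (by positivity))).trans ?_
  simp only [add_div]
  have h6 : 0 ≤ 4 * √3 * ‖D.A₁‖ * ‖D.S₁.y₀‖ / √q / ε := by positivity
  have h7 : 0 ≤ 4 * (6 * M₂) ^ 2 / q / ε := by positivity
  have h8 : 0 ≤ 4 * √3 * ‖D.A₁‖ * (√‖m.y₁ - D.S₁.y₀‖ + √2) / √q / ε := by positivity
  have h9 : 0 ≤ 24 * √6 * ‖D.A₁‖ * M₂ / q / ε := by positivity
  refine add_le_add (max_le ?_ ?_) h4 <;> linarith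

theorem exists_N₂_le (hS₂ : D.S₂.IsRegular) (a' R M₃ : ℝ) :
    ∃ C : ℝ, 0 ≤ C ∧ ∀ ε : ℝ, 0 < ε → ε ≤ 1 → ∀ (u : E₁) (ξ : Scenario E₁ E₂ F₂ C₂),
      ‖ξ.A‖ ≤ a' → ‖m.y₂ u ξ‖ ≤ R → (D.N₂ m M₃ ε u ξ : ℝ) ≤ C / ε := by
  have hq : 0 < D.S₂.α * D.S₂.μ := mul_pos hS₂.α_pos hS₂.μ_pos
  refine ⟨(24 * a' ^ 2 * (‖D.S₂.y₀‖ + R) ^ 2 + 72 * M₃ ^ 2) / (D.S₂.α * D.S₂.μ) + 1,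
    by positivity, fun ε hε hε1 u ξ hA hy => ?_⟩
  refine (N₂_upper hS₂ hε u).trans ?_
  rw [add_div _ 1 ε, div_div]
  refine add_le_add ?_ ((one_le_div hε).2 hε1)
  have h1 : ‖D.S₂.y₀ - m.y₂ u ξ‖ ≤ ‖D.S₂.y₀‖ + R :=
    (norm_sub_le _ _).trans (add_le_add_right hy _)
  gcongr

theorem N₁_lower (M₂ ε : ℝ) :
    4 * √3 * ‖D.A₁‖ * ‖D.S₁.y₀‖ / √(D.S₁.α * D.S₁.μ * ε)
      + 4 * (6 * M₂) ^ 2 / (D.S₁.α * D.S₁.μ * ε) ≤ D.N₁ m M₂ ε ∧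
    4 * √3 * ‖D.A₁‖ * (√‖m.y₁ - D.S₁.y₀‖ + √2) / √(D.S₁.α * D.S₁.μ * ε)
      + (24 * √6 * ‖D.A₁‖ * M₂ / (D.S₁.α * D.S₁.μ * ε)) ^ (2 / 3 : ℝ) ≤ D.N₁ m M₂ ε := by
  rw [← max_le_iff, N₁, Nat.cast_max]
  exact (Nat.le_ceil _).trans (le_max_right _ _)

end Problem

end Problem

/-- The scaled noise equals `8 L² + 8 γ² + (α μ)² diam²`, so one threshold for `M` secures the
Lipschitz constant, the second moment and the accuracy together. -/
theorem Stage.IsRegular.le_of_noise_le {E F C : Type*} [NormedAddCommGroup E] [NormedSpace ℝ E]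
    [NormedAddCommGroup F] [InnerProductSpace ℝ F] [MeasurableSpace C] {S : Stage E F C}
    (hS : S.IsRegular) {L diam γ M : ℝ}
    (hM : √(S.α * S.μ * S.noise L diam γ) ≤ M) :
    S.α * S.μ * S.noise L diam γ ≤ M ^ 2 ∧ L ≤ M ∧ γ ^ 2 ≤ M ^ 2 := by
  have hq : 0 < S.α * S.μ := mul_pos hS.α_pos hS.μ_pos
  have hM0 := (Real.sqrt_nonneg _).trans hM
  have h1 := (Real.sqrt_le_left hM0).1 hM
  have h2 : S.α * S.μ * S.noise L diam γ
      = 8 * L ^ 2 + 8 * γ ^ 2 + (S.α * S.μ) ^ 2 * diam ^ 2 := by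
    rw [Stage.noise, mul_add, mul_div_cancel₀ _ hq.ne']
    ring
  have h3 : 0 ≤ (S.α * S.μ) ^ 2 * diam ^ 2 := by positivity
  refine ⟨h1, le_of_sq_le_sq ?_ hM0, ?_⟩ <;> nlinarith [sq_nonneg L, sq_nonneg γ]

theorem exists_diam {E : Type*} [NormedAddCommGroup E] {X : Set E} (hX : IsCompact X) :
    ∃ d : ℝ, ∀ x ∈ X, ∀ x' ∈ X, ‖x - x'‖ ≤ d := by
  obtain ⟨d, hd⟩ := Metric.isBounded_iff.1 hX.isBounded
  exact ⟨d, fun x hx x' hx' => (dist_eq_norm x x').symm.trans_le (hd hx hx')⟩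

/-! ### The outer loop. -/

section Problem

variable {E₁ E₂ E₃ F₁ F₂ F₃ C₁ C₂ C₃ : Type*}
  [NormedAddCommGroup E₁] [NormedSpace ℝ E₁] [FiniteDimensional ℝ E₁]
  [MeasurableSpace E₁] [BorelSpace E₁]
  [NormedAddCommGroup E₂] [NormedSpace ℝ E₂] [FiniteDimensional ℝ E₂]
  [MeasurableSpace E₂] [BorelSpace E₂]
  [NormedAddCommGroup E₃] [NormedSpace ℝ E₃] [FiniteDimensional ℝ E₃]
  [NormedAddCommGroup F₁] [InnerProductSpace ℝ F₁] [FiniteDimensional ℝ F₁]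
  [NormedAddCommGroup F₂] [InnerProductSpace ℝ F₂] [FiniteDimensional ℝ F₂]
  [MeasurableSpace F₂] [BorelSpace F₂]
  [NormedAddCommGroup F₃] [InnerProductSpace ℝ F₃] [FiniteDimensional ℝ F₃]
  [MeasurableSpace F₃] [BorelSpace F₃]
  [MeasurableSpace C₁] [MeasurableSpace C₂] [MeasurableSpace C₃]


namespace Problem

variable {D : Problem E₁ E₂ E₃ F₁ F₂ F₃ C₁ C₂ C₃} {m : Multipliers E₁ E₂ E₃ F₁ F₂ F₃ C₂ C₃}

variable (D m) in
/-- The outer loop with the step sizes `etaReg` in the inner and middle loops. -/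
def iter₁Reg (M₃ ε : ℝ) (s : ℕ → Scenario E₁ E₂ F₂ C₂ × (ℕ → Scenario E₂ E₃ F₃ C₃)) :
    ℕ → E₁ × F₁ × F₁ :=
  D.S₁.iterate D.A₁ D.b₁ D.c₁ (D.S₁.etaReg D.A₁ 1)
    (fun i x => D.G₂Reg m M₃ ε x (s i).1 (s i).2)

theorem iter₁_eq_reg (hA₁ : D.A₁ ≠ 0) {ξ₂ : ℕ → Scenario E₁ E₂ F₂ C₂}
    {ξ₃ : ℕ → ℕ → Scenario E₂ E₃ F₃ C₃} (h₂ : ∀ i, (ξ₂ i).A ≠ 0) (h₃ : ∀ i j, (ξ₃ i j).A ≠ 0)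
    (M₃ ε : ℝ) : D.iter₁ m M₃ ε ξ₂ ξ₃ = D.iter₁Reg m M₃ ε fun i => (ξ₂ i, ξ₃ i) := by
  rw [iter₁, iter₁Reg, D.S₁.etaShort_eq_etaReg hA₁]
  congr
  ext i x : 2
  exact D.G₂_eq_reg m (h₂ i) (h₃ i) M₃ ε x

variable {β₂ β₃ a a' R : ℝ}
variable [IsMarkovKernel D.κ] [IsProbabilityMeasure D.P₂]
variable {Ω : Type*} [MeasurableSpace Ω] {Pr : Measure Ω} [IsProbabilityMeasure Pr]
  {ξ₂ : ℕ → Ω → Scenario E₁ E₂ F₂ C₂} {ξ₃ : ℕ → ℕ → Ω → Scenario E₂ E₃ F₃ C₃}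

/-- Transfers results from the measurable regularized process to the actual algorithm: almost surely
no sampled operator vanishes, simultaneously for all indices. -/
theorem IsSampling.ae_iter₁_eq_reg (hs : D.IsSampling Pr ξ₂ ξ₃) (ha : 0 < a)
    (h : ∀ᵐ ξ ∂D.P₂, Good₂ D m β₂ β₃ a a' R ξ) (hA₁ : D.A₁ ≠ 0) (M₃ ε : ℝ) :
    ∀ᵐ ω ∂Pr, (∀ i, (ξ₂ i ω).A ≠ 0) ∧ (∀ i j, (ξ₃ i j ω).A ≠ 0) ∧
      D.iter₁ m M₃ ε (fun i => ξ₂ i ω) (fun i j => ξ₃ i j ω)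
        = D.iter₁Reg m M₃ ε fun i => (ξ₂ i ω, fun j => ξ₃ i j ω) := by
  have h1 : ∀ᵐ ω ∂Pr, ∀ i, (ξ₂ i ω).A ≠ 0 ∧ ∀ j, (ξ₃ i j ω).A ≠ 0 := by
    rw [ae_all_iff]
    intro i
    have h2 := ae_blockLaw_ne ha h
    rw [← hs.isIID.law i] at h2
    exact ae_of_ae_map (hs.isIID.measurable i).aemeasurable h2
  filter_upwards [h1] with ω hω
  exact ⟨fun i => (hω i).1, fun i => (hω i).2,
    iter₁_eq_reg hA₁ (fun i => (hω i).1) (fun i => (hω i).2) M₃ ε⟩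

/-- The iterates of the outer loop as a stochastic process, and the independence of the next block
of samples. -/
theorem IsSampling.measurable_iter₁Reg [MeasurableSpace F₁] [BorelSpace F₁]
    (hs : D.IsSampling Pr ξ₂ ξ₃) (hS₁ : D.S₁.IsRegular)
    (hS₂ : D.S₂.IsRegular) (hS₃ : D.S₃.IsRegular) (hm : m.IsOptimal D R) (M₃ ε : ℝ) (i : ℕ) :
    Measurable (fun ω => (D.iter₁Reg m M₃ ε (fun i => (ξ₂ i ω, fun j => ξ₃ i j ω)) i).1) ∧
    IndepFun (fun ω => (D.iter₁Reg m M₃ ε (fun i => (ξ₂ i ω, fun j => ξ₃ i j ω)) i).1)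
      (fun ω => (ξ₂ i ω, fun j => ξ₃ i j ω)) Pr :=
  have hG := measurable_G₂Reg (D := D) hS₂ hS₃ hm.measurable₂ hm.measurable₃ M₃ ε
  ⟨(hS₁.measurable_iid_iterate D.A₁ D.b₁ D.c₁ (hS₁.etaReg_pos D.A₁ one_pos) hs.isIID
      (G := fun u z => D.G₂Reg m M₃ ε u z.1 z.2) hG i).fst,
    hS₁.indep_iterate D.A₁ D.b₁ D.c₁ (hS₁.etaReg_pos D.A₁ one_pos) hs.isIID
      (G := fun u z => D.G₂Reg m M₃ ε u z.1 z.2) hG i⟩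

theorem iter₁Reg_mem (hS₁ : D.S₁.IsRegular) (M₃ ε : ℝ)
    (s : ℕ → Scenario E₁ E₂ F₂ C₂ × (ℕ → Scenario E₂ E₃ F₃ C₃)) (i : ℕ) :
    (D.iter₁Reg m M₃ ε s i).1 ∈ D.S₁.X :=
  hS₁.iterate_mem _ _ _ _ _ i

theorem xbar₁_mem (hS₁ : D.S₁.IsRegular) (M₂ M₃ ε : ℝ) (s₂ : ℕ → Scenario E₁ E₂ F₂ C₂)
    (s₃ : ℕ → ℕ → Scenario E₂ E₃ F₃ C₃) : D.xbar₁ m M₂ M₃ ε s₂ s₃ ∈ D.S₁.X :=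
  weightedAverage_mem hS₁.convex (N₁_pos M₂ ε) fun i => hS₁.iterate_mem _ _ _ _ _ (i + 1)

/-- The outer iterate is independent of the block that produces the subgradient, so the moment bound
at a fixed `u` carries over. -/
theorem IsSampling.lintegral_G₂_le (hs : D.IsSampling Pr ξ₂ ξ₃) (hS₁ : D.S₁.IsRegular)
    (hS₂ : D.S₂.IsRegular) (hS₃ : D.S₃.IsRegular) (hm : m.IsOptimal D R)
    (h : ∀ᵐ ξ ∂D.P₂, Good₂ D m β₂ β₃ a a' R ξ) (ha : 0 < a) (hA₁ : D.A₁ ≠ 0) {diam : ℝ}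
    (hD : ∀ x ∈ D.S₂.X, ∀ x' ∈ D.S₂.X, ‖x - x'‖ ≤ diam) {ε M₃ : ℝ} (hε : 0 < ε)
    (hM : D.S₂.α * D.S₂.μ * D.S₂.noise (β₃ * R) diam (D.gradBound₃ β₃ R) ≤ M₃ ^ 2) (i : ℕ) :
    ∫⁻ ω, ‖D.G₂ m M₃ ε (D.iter₁ m M₃ ε (fun i => ξ₂ i ω) (fun i j => ξ₃ i j ω) i).1
        (ξ₂ i ω) (fun j => ξ₃ i j ω)‖ₑ ^ 2 ∂Pr
      ≤ ENNReal.ofReal (√(D.momentBound₂ β₂ β₃ a a' R diam M₃) ^ 2) := by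
  let _ : MeasurableSpace F₁ := borel F₁
  have : BorelSpace F₁ := ⟨rfl⟩
  have : ProperSpace E₁ := FiniteDimensional.proper_real _
  obtain ⟨h1, h2⟩ := hs.measurable_iter₁Reg hS₁ hS₂ hS₃ hm M₃ ε i
  have hG := measurable_G₂Reg (D := D) hS₂ hS₃ hm.measurable₂ hm.measurable₃ M₃ ε
  have h3 := lintegral_indep_le h1 (hs.isIID.measurable i) h2 (hs.isIID.law i)
    (fun ω => iter₁Reg_mem hS₁ M₃ ε _ i)
    (Φ := fun q => ‖D.G₂Reg m M₃ ε q.1 q.2.1 q.2.2‖ₑ ^ 2) (hG.enorm.pow_const 2)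
    fun u hu => lintegral_G₂Reg_le hS₂ hS₃ hm h ha hD hε hM hu
  refine (lintegral_congr_ae ?_).trans_le h3
  filter_upwards [hs.ae_iter₁_eq_reg ha h hA₁ M₃ ε] with ω hω
  rw [hω.2.2, D.G₂_eq_reg m (hω.1 i) (hω.2.1 i)]

theorem IsSampling.lintegral_G₃_le (hs : D.IsSampling Pr ξ₂ ξ₃) (hS₁ : D.S₁.IsRegular)
    (hS₂ : D.S₂.IsRegular) (hS₃ : D.S₃.IsRegular) (hm : m.IsOptimal D R)
    (h : ∀ᵐ ξ ∂D.P₂, Good₂ D m β₂ β₃ a a' R ξ) (ha : 0 < a) (hA₁ : D.A₁ ≠ 0) {diam : ℝ}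
    (hD : ∀ x ∈ D.S₂.X, ∀ x' ∈ D.S₂.X, ‖x - x'‖ ≤ diam) {ε M₃ : ℝ} (hε : 0 < ε)
    (hM : D.S₂.α * D.S₂.μ * D.S₂.noise (β₃ * R) diam (D.gradBound₃ β₃ R) ≤ M₃ ^ 2) (i j : ℕ) :
    ∫⁻ ω, ‖D.G₃ m ε (D.iter₂ m M₃ ε
        (D.iter₁ m M₃ ε (fun i => ξ₂ i ω) (fun i j => ξ₃ i j ω) i).1
        (ξ₂ i ω) (fun j => ξ₃ i j ω) j).1 (ξ₃ i j ω)‖ₑ ^ 2 ∂Pr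
      ≤ ENNReal.ofReal (D.gradBound₃ β₃ R ^ 2) := by
  let _ : MeasurableSpace F₁ := borel F₁
  have : BorelSpace F₁ := ⟨rfl⟩
  have : ProperSpace E₂ := FiniteDimensional.proper_real _
  obtain ⟨h1, h2⟩ := hs.measurable_iter₁Reg hS₁ hS₂ hS₃ hm M₃ ε i
  have hG := measurable_block_G₃Reg (D := D) hS₂ hS₃ hm M₃ ε j
  have h3 := lintegral_indep_le h1 (hs.isIID.measurable i) h2 (hs.isIID.law i)
    (fun ω => iter₁Reg_mem hS₁ M₃ ε _ i)
    (Φ := fun q => ‖D.G₃Reg m ε (D.iter₂Reg m M₃ ε q.1 q.2.1 q.2.2 j).1 (q.2.2 j)‖ₑ ^ 2)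
    (hG.enorm.pow_const 2)
    fun u hu => lintegral_G₃Reg_le hS₂ hS₃ hm h ha hD hε hM hu j
  refine (lintegral_congr_ae ?_).trans_le h3
  filter_upwards [hs.ae_iter₁_eq_reg ha h hA₁ M₃ ε] with ω hω
  rw [hω.2.2, D.iter₂_eq_reg m (hω.1 i) (hω.2.1 i), D.G₃_eq_reg m (hω.2.1 i j)]

theorem IsSampling.ae_count₃_le (hs : D.IsSampling Pr ξ₂ ξ₃) (hS₁ : D.S₁.IsRegular)
    (hS₂ : D.S₂.IsRegular) (hS₃ : D.S₃.IsRegular) (hm : m.IsOptimal D R)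
    (h : ∀ᵐ ξ ∂D.P₂, Good₂ D m β₂ β₃ a a' R ξ) (ha : 0 < a) (hA₁ : D.A₁ ≠ 0) {ε M₃ c : ℝ}
    (hc : ∀ (u : E₁) (ξ : Scenario E₁ E₂ F₂ C₂), ‖ξ.A‖ ≤ a' → ‖m.y₂ u ξ‖ ≤ R →
      (D.N₂ m M₃ ε u ξ : ℝ) ≤ c) :
    ∀ᵐ ω ∂Pr, ∀ i,
      (D.count₃ m M₃ ε (fun i => ξ₂ i ω) (fun i j => ξ₃ i j ω) i : ℝ) ≤ c := by
  let _ : MeasurableSpace F₁ := borel F₁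
  have : BorelSpace F₁ := ⟨rfl⟩
  have hN : Measurable fun q : E₁ × Scenario E₁ E₂ F₂ C₂ × (ℕ → Scenario E₂ E₃ F₃ C₃) =>
      (D.N₂ m M₃ ε q.1 q.2.1 : ℝ) := by
    have h0 := (measurable_N₂ (D := D) hm.measurable₂ M₃ ε).comp
      (measurable_fst.prodMk (measurable_snd.fst :
        Measurable fun q : E₁ × Scenario E₁ E₂ F₂ C₂ × (ℕ → Scenario E₂ E₃ F₃ C₃) => q.2.1))
    exact (measurable_from_top (f := fun n : ℕ => (n : ℝ))).comp h0
  have h4 : ∀ᵐ ω ∂Pr, ∀ i, (D.N₂ m M₃ ε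
      (D.iter₁Reg m M₃ ε (fun i => (ξ₂ i ω, fun j => ξ₃ i j ω)) i).1 (ξ₂ i ω) : ℝ) ≤ c := by
    rw [ae_all_iff]
    intro i
    obtain ⟨h1, h2⟩ := hs.measurable_iter₁Reg hS₁ hS₂ hS₃ hm M₃ ε i
    exact ae_indep h1 (hs.isIID.measurable i) h2 (hs.isIID.law i)
      (fun ω => iter₁Reg_mem hS₁ M₃ ε _ i)
      (p := fun q => (D.N₂ m M₃ ε q.1 q.2.1 : ℝ) ≤ c) (measurableSet_le hN measurable_const)
      fun u hu => ae_blockLaw_fst (h.mono fun ξ hξ => hc u ξ hξ.A_le (hξ.bound u hu))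
  filter_upwards [h4, hs.ae_iter₁_eq_reg ha h hA₁ M₃ ε] with ω hω hω'
  intro i
  rw [count₃, hω'.2.2]
  exact hω i


theorem IsSampling.outer (hs : D.IsSampling Pr ξ₂ ξ₃) (hS₁ : D.S₁.IsRegular)
    (hS₂ : D.S₂.IsRegular) (hS₃ : D.S₃.IsRegular) (hm : m.IsOptimal D R)
    (hv₂ : ∀ u ∈ D.S₁.X, Integrable (D.V₂ u) D.P₂)
    (h : ∀ᵐ ξ ∂D.P₂, Good₂ D m β₂ β₃ a a' R ξ) (ha : 0 < a) (hA₁ : D.A₁ ≠ 0) {diam diam₁ : ℝ}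
    (hD₁ : ∀ x ∈ D.S₁.X, ∀ x' ∈ D.S₁.X, ‖x - x'‖ ≤ diam₁)
    (hD : ∀ x ∈ D.S₂.X, ∀ x' ∈ D.S₂.X, ‖x - x'‖ ≤ diam) {ε M₂ M₃ : ℝ} (hε : 0 < ε)
    (hM : D.S₂.α * D.S₂.μ * D.S₂.noise (β₃ * R) diam (D.gradBound₃ β₃ R) ≤ M₃ ^ 2)
    (hM₂0 : 0 ≤ M₂)
    (hM₂ : D.S₁.α * D.S₁.μ * D.S₁.noise (β₂ * R) diam₁
      √(D.momentBound₂ β₂ β₃ a a' R diam M₃) ≤ M₂ ^ 2) :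
    (∃ xs, D.IsSolution xs ∧
      Integrable (fun ω => D.obj
        (D.xbar₁ m M₂ M₃ ε (fun i => ξ₂ i ω) (fun i j => ξ₃ i j ω)) - D.obj xs) Pr ∧
      ∫ ω, (D.obj (D.xbar₁ m M₂ M₃ ε (fun i => ξ₂ i ω) (fun i j => ξ₃ i j ω))
        - D.obj xs) ∂Pr ≤ ε) ∧
    ∃ δ : Ω → F₁, Integrable δ Pr ∧
      (∀ᵐ ω ∂Pr, D.A₁ (D.xbar₁ m M₂ M₃ ε (fun i => ξ₂ i ω) (fun i j => ξ₃ i j ω))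
        - D.b₁ - δ ω ∈ D.S₁.K) ∧
      ∫ ω, ‖δ ω‖ ∂Pr ≤ ε := by
  let _ : MeasurableSpace F₁ := borel F₁
  have : BorelSpace F₁ := ⟨rfl⟩
  have : CompleteSpace F₁ := FiniteDimensional.complete ℝ F₁
  have hq : 0 < D.S₁.α * D.S₁.μ := mul_pos hS₁.α_pos hS₁.μ_pos
  have hN := N₁_pos (D := D) (m := m) M₂ ε
  have hN1 : (1 : ℝ) ≤ D.N₁ m M₂ ε := by exact_mod_cast hN
  obtain ⟨hlow₁, hlow₂⟩ := N₁_lower (D := D) (m := m) M₂ ε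
  have hCe0 := hS₁.stepConst_pos hA₁ one_pos
  have hCe := hS₁.le_stepConst D.A₁ one_pos
  have hη := hS₁.etaReg_mul hA₁ 1
  have hL : ∀ x ∈ D.S₁.X, ∀ x' ∈ D.S₁.X, |D.v₂ x - D.v₂ x'| ≤ β₂ * R * ‖x - x'‖ :=
    fun x hx x' hx' => abs_v₂_sub_le hv₂ h hx hx'
  have hG := oracle₂ hS₂ hS₃ hm h ha hD hε hM hv₂
  set xr : Ω → E₁ := fun ω => weightedAverage (D.N₁ m M₂ ε) fun i =>
    (D.iter₁Reg m M₃ ε (fun i => (ξ₂ i ω, fun j => ξ₃ i j ω)) i).1 with hxr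
  have hae : ∀ᵐ ω ∂Pr, D.xbar₁ m M₂ M₃ ε (fun i => ξ₂ i ω) (fun i j => ξ₃ i j ω) = xr ω := by
    filter_upwards [hs.ae_iter₁_eq_reg ha h hA₁ M₃ ε] with ω hω
    rw [xbar₁, hω.2.2]
  constructor
  -- The optimal solution is the primal part of the first-stage saddle point.
  · obtain ⟨xs, hxs, -, hopt, -⟩ := hm.optimal₁.exists_solution
    refine ⟨xs, ⟨hxs, hopt⟩, ?_⟩
    obtain ⟨h1, h2⟩ := hS₁.stochastic_primal_gap hCe0 hCe hη hs.isIID hL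
      (convexOn_v₂ hS₁.convex hv₂ h) hD₁ hG hxs hN (c := D.c₁)
    have h3 : (fun ω => D.obj (D.xbar₁ m M₂ M₃ ε (fun i => ξ₂ i ω) (fun i j => ξ₃ i j ω))
        - D.obj xs) =ᵐ[Pr] fun ω => D.obj (xr ω) - D.obj xs := by
      filter_upwards [hae] with ω hω
      rw [hω]
    refine ⟨Integrable.congr h1 h3.symm, ?_⟩
    rw [integral_congr_ae h3]
    exact h2.trans (outer_gap_arith (norm_nonneg _) (norm_nonneg _) hq hN1 hε hM₂ hlow₁)
  · obtain ⟨δ, h1, h2, h3⟩ := hS₁.stochastic_residual hCe0 hCe hη hs.isIID hL hD₁ hG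
      hm.optimal₁ hN
    refine ⟨δ, h1, ?_, h3.trans (outer_residual_arith (norm_pos_iff.2 hA₁) (norm_nonneg _) hq
      hN1 hM₂0 hε hM₂ hlow₂)⟩
    filter_upwards [hae] with ω hω
    rw [hω]
    exact h2 ω

end Problem

end Problem

end DSA

end

/-! ### Choice of the constants and conclusion. -/

theorem mainTheorem2 {E₁ E₂ E₃ F₁ F₂ F₃ C₁ C₂ C₃ : Type*}
    [NormedAddCommGroup E₁] [NormedSpace ℝ E₁] [FiniteDimensional ℝ E₁]
    [MeasurableSpace E₁] [BorelSpace E₁]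
    [NormedAddCommGroup E₂] [NormedSpace ℝ E₂] [FiniteDimensional ℝ E₂]
    [MeasurableSpace E₂] [BorelSpace E₂]
    [NormedAddCommGroup E₃] [NormedSpace ℝ E₃] [FiniteDimensional ℝ E₃]
    [NormedAddCommGroup F₁] [InnerProductSpace ℝ F₁] [FiniteDimensional ℝ F₁]
    [NormedAddCommGroup F₂] [InnerProductSpace ℝ F₂] [FiniteDimensional ℝ F₂]
    [MeasurableSpace F₂] [BorelSpace F₂]
    [NormedAddCommGroup F₃] [InnerProductSpace ℝ F₃] [FiniteDimensional ℝ F₃]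
    [MeasurableSpace F₃] [BorelSpace F₃]
    [MeasurableSpace C₁] [MeasurableSpace C₂] [MeasurableSpace C₃]
    (D : DSA.Problem E₁ E₂ E₃ F₁ F₂ F₃ C₁ C₂ C₃)
    [IsProbabilityMeasure D.P₂] [IsMarkovKernel D.κ]
    (hS₁ : D.S₁.IsRegular) (hS₂ : D.S₂.IsRegular) (hS₃ : D.S₃.IsRegular)
    -- the expected value functions are well defined and finite
    (hv₃ : ∀ᵐ ξ₂ ∂D.P₂, ∀ u ∈ D.S₂.X, Integrable (D.V₃ u) (D.κ ξ₂))
    (hv₂ : ∀ u ∈ D.S₁.X, Integrable (D.V₂ u) D.P₂)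
    -- boundedness of the operators
    (β₂ β₃ a a' : ℝ) (ha : 0 < a)
    (hB₂ : ∀ᵐ ξ₂ ∂D.P₂, ‖ξ₂.B‖ ≤ β₂)
    (hB₃ : ∀ᵐ ξ₂ ∂D.P₂, ∀ᵐ ξ₃ ∂(D.κ ξ₂), ‖ξ₃.B‖ ≤ β₃)
    (hA₁ : D.A₁ ≠ 0)
    (hA₂ : ∀ᵐ ξ₂ ∂D.P₂, a ≤ ‖ξ₂.A‖ ∧ ‖ξ₂.A‖ ≤ a')
    (hA₃ : ∀ᵐ ξ₂ ∂D.P₂, ∀ᵐ ξ₃ ∂(D.κ ξ₂), ξ₃.A ≠ 0)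
    -- strong Lagrange duality, with bounded multipliers in the stages 2 and 3
    (R : ℝ) (m : DSA.Multipliers E₁ E₂ E₃ F₁ F₂ F₃ C₂ C₃) (hm : m.IsOptimal D R) :
    ∃ M₃₀ : ℝ, 0 ≤ M₃₀ ∧ ∀ M₃ ≥ M₃₀,
      (∀ᵐ ξ₂ ∂D.P₂, ∀ u ∈ D.S₂.X, ∀ u' ∈ D.S₂.X,
        |D.v₃ ξ₂ u - D.v₃ ξ₂ u'| ≤ M₃ * ‖u - u'‖) ∧
      ∃ M₂₀ : ℝ, 0 ≤ M₂₀ ∧ ∀ M₂ ≥ M₂₀,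
        (∀ u ∈ D.S₁.X, ∀ u' ∈ D.S₁.X, |D.v₂ u - D.v₂ u'| ≤ M₂ * ‖u - u'‖) ∧
        ∃ C : ℝ, ∀ ε : ℝ, 0 < ε →
          -- the number of samples of `ξ²` is `O(1/ε)`
          (ε ≤ 1 → (D.N₁ m M₂ ε : ℝ) ≤ C / ε) ∧
          ∀ (Ω : Type*) [MeasurableSpace Ω] (Pr : Measure Ω) [IsProbabilityMeasure Pr]
            (ξ₂ : ℕ → Ω → DSA.Scenario E₁ E₂ F₂ C₂)
            (ξ₃ : ℕ → ℕ → Ω → DSA.Scenario E₂ E₃ F₃ C₃),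
            D.IsSampling Pr ξ₂ ξ₃ →
            -- the number of samples of `ξ³` is `O(1/ε²)`
            (ε ≤ 1 → ∀ᵐ ω ∂Pr,
              (∑ i ∈ Finset.range (D.N₁ m M₂ ε),
                (D.count₃ m M₃ ε (fun i => ξ₂ i ω) (fun i j => ξ₃ i j ω) i : ℝ)) ≤ C / ε ^ 2) ∧
            -- second moments of the approximate subgradients of `v³` and `v²`
            (∀ i j, ∫⁻ ω, ‖D.G₃ m ε
                (D.iter₂ m M₃ ε (D.iter₁ m M₃ ε (fun i => ξ₂ i ω) (fun i j => ξ₃ i j ω) i).1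
                  (ξ₂ i ω) (fun j => ξ₃ i j ω) j).1 (ξ₃ i j ω)‖ₑ ^ 2 ∂Pr
              ≤ ENNReal.ofReal (M₃ ^ 2)) ∧
            (∀ i, ∫⁻ ω, ‖D.G₂ m M₃ ε
                (D.iter₁ m M₃ ε (fun i => ξ₂ i ω) (fun i j => ξ₃ i j ω) i).1
                (ξ₂ i ω) (fun j => ξ₃ i j ω)‖ₑ ^ 2 ∂Pr
              ≤ ENNReal.ofReal (M₂ ^ 2)) ∧
            -- the output is an `ε`-optimal, `ε`-feasible solution in expectation
            (∀ᵐ ω ∂Pr, D.xbar₁ m M₂ M₃ ε (fun i => ξ₂ i ω) (fun i j => ξ₃ i j ω) ∈ D.S₁.X) ∧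
            (∃ xs, D.IsSolution xs ∧
              Integrable (fun ω => D.obj
                (D.xbar₁ m M₂ M₃ ε (fun i => ξ₂ i ω) (fun i j => ξ₃ i j ω)) - D.obj xs) Pr ∧
              ∫ ω, (D.obj (D.xbar₁ m M₂ M₃ ε (fun i => ξ₂ i ω) (fun i j => ξ₃ i j ω))
                - D.obj xs) ∂Pr ≤ ε) ∧
            ∃ δ : Ω → F₁, Integrable δ Pr ∧
              (∀ᵐ ω ∂Pr, D.A₁ (D.xbar₁ m M₂ M₃ ε (fun i => ξ₂ i ω) (fun i j => ξ₃ i j ω))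
                - D.b₁ - δ ω ∈ D.S₁.K) ∧
              ∫ ω, ‖δ ω‖ ∂Pr ≤ ε := by
  obtain ⟨diam₁, hD₁⟩ := DSA.exists_diam hS₁.isCompact
  obtain ⟨diam, hD⟩ := DSA.exists_diam hS₂.isCompact
  have h := hm.ae_good₂ hv₃ hB₂ hB₃ hA₂ hA₃
  -- The thresholds are the scaled noise levels of the middle and, below, the outer loop. The second
  -- involves `M₃` through the middle loop's moment bound, hence the order of the quantifiers.
  refine ⟨√(D.S₂.α * D.S₂.μ * D.S₂.noise (β₃ * R) diam (D.gradBound₃ β₃ R)),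
    Real.sqrt_nonneg _, fun M₃ hM₃ => ?_⟩
  obtain ⟨hM, hLM, hΓM⟩ := hS₂.le_of_noise_le hM₃
  refine ⟨?_, √(D.S₁.α * D.S₁.μ * D.S₁.noise (β₂ * R) diam₁
      √(D.momentBound₂ β₂ β₃ a a' R diam M₃)), Real.sqrt_nonneg _, fun M₂ hM₂ => ?_⟩
  · filter_upwards [h] with ξ hξ u hu u' hu'
    exact (hξ.v₃_lipschitz hu hu').trans (mul_le_mul_of_nonneg_right hLM (norm_nonneg _))
  obtain ⟨hMM, hLM₂, hΓM₂⟩ := hS₁.le_of_noise_le hM₂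
  have hM₂0 : 0 ≤ M₂ := (Real.sqrt_nonneg _).trans hM₂
  obtain ⟨c₁, hc₁0, hc₁⟩ := DSA.Problem.exists_N₁_le (D := D) (m := m) hS₁ hM₂0
  obtain ⟨c₂, hc₂0, hc₂⟩ := DSA.Problem.exists_N₂_le (D := D) (m := m) hS₂ a' R M₃
  -- A single constant serves both counts: `c₁` bounds the outer steps, and `c₁ * c₂` the outer
  -- steps times the middle steps in each.
  refine ⟨fun u hu u' hu' => (DSA.Problem.abs_v₂_sub_le hv₂ h hu hu').trans
    (mul_le_mul_of_nonneg_right hLM₂ (norm_nonneg _)), c₁ + c₁ * c₂, fun ε hε =>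
    ⟨fun hε1 => (hc₁ ε hε hε1).trans ?_, fun Ω _ Pr _ ξ₂ ξ₃ hs =>
      ⟨fun hε1 => ?_, fun i j => ?_, fun i => ?_, ?_, ?_⟩⟩⟩
  · gcongr
    exact le_add_of_nonneg_right (mul_nonneg hc₁0 hc₂0)
  · filter_upwards [hs.ae_count₃_le hS₁ hS₂ hS₃ hm h ha hA₁ (hc₂ ε hε hε1)] with ω hω
    refine (Finset.sum_le_card_nsmul _ _ _ fun i _ => hω i).trans ?_
    rw [Finset.card_range, nsmul_eq_mul]
    calc (D.N₁ m M₂ ε : ℝ) * (c₂ / ε) ≤ c₁ / ε * (c₂ / ε) :=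
          mul_le_mul_of_nonneg_right (hc₁ ε hε hε1) (by positivity)
      _ = c₁ * c₂ / ε ^ 2 := by rw [div_mul_div_comm, sq]
      _ ≤ _ := by
          gcongr
          exact le_add_of_nonneg_left hc₁0
  · exact (hs.lintegral_G₃_le hS₁ hS₂ hS₃ hm h ha hA₁ hD hε hM i j).trans
      (ENNReal.ofReal_le_ofReal hΓM)
  · exact (hs.lintegral_G₂_le hS₁ hS₂ hS₃ hm h ha hA₁ hD hε hM i).trans
      (ENNReal.ofReal_le_ofReal hΓM₂)
  · exact Filter.Eventually.of_forall fun ω => DSA.Problem.xbar₁_mem hS₁ M₂ M₃ ε _ _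
  · exact hs.outer hS₁ hS₂ hS₃ hm hv₂ h ha hA₁ hD₁ hD hε hM hM₂0 hMM
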